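/- **Setting.** A space of homogeneous type $(S,d,\mu)$ with constants $c_d,c_\mu\ge 1$ is a set $S$ with a quasi-metric $d$ (a metric, except that the triangle inequality is replaced by $d(s,t)\le c_d(d(s,u)+d(u,t))$) and a measure $\mu$ on the Borel $\sigma$-algebra of $(S,d)$ such that all balls $B(s,\rho)=\{t:d(s,t)<\rho\}$, $\rho>0$, are Borel sets with $0<\mu(B(s,\rho))<\infty$ and $\mu(B(s,2\rho))\le c_\mu\,\mu(B(s,\rho))$. For a ball $B=B(s,\rho)$ put $\alpha B=B(s,\alpha\rho)$. For $0<c_0\le C_0$ and $0<\delta<1$, a dyadic system with parameters $c_0,C_0,\delta$ consists, for each $k\in\mathbb Z$, of pairwise disjoint measurable sets (cubes) $Q_j^k$ with union $S$ and points $z_j^k$, $j\in J_k$, with $B(z_j^k,c_0\delta^k)\subseteq Q_j^k\subseteq B(z_j^k,C_0\delta^k)$, and such that for $k\ge l$ a cube of generation $k$ is either disjoint from or contained in a given cube of generation $l$. We call $(c_0,C_0,\delta,\gamma,m)$, with $\gamma\ge1$ and $m\in\mathbb N$, admissible for $S$ if there are $m$ dyadic systems on $S$ with parameters $c_0,C_0,\delta$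 such that every ball $B(s,\rho)$, $\rho>0$, is contained in a cube $Q$ of one of them with $\operatorname{diam}Q\le\gamma\rho$. For $q\in[1,\infty)$ let $\|g\|_{L^{q,\infty}}=\sup_{t>0}t\,\mu(\{\|g\|>t\})^{1/q}$. A weight is a function $w:S\to(0,\infty)$ that is integrable on balls, and for $q>1$ $$[w]_{A_q}=\sup_B\Big(\frac1{\mu(B)}\int_B w\,d\mu\Big)\Big(\frac1{\mu(B)}\int_B w^{-\frac1{q-1}}\,d\mu\Big)^{q-1},$$ the supremum being over all balls; $w\in A_q$ means $[w]_{A_q}<\infty$. $L^p(S,w;X)$ is the Bochner space $L^p(S,w\,d\mu;X)$. **Statement.** (i) There are $c_0,C_0,\delta,\gamma,m$, depending only on $c_d$ and $c_\mu$, that are admissible for every space of homogeneous type with constants $c_d,c_\mu$. (ii) Let $(S,d,\mu)$ be a space of homogeneous type with constants $c_d,c_\mu$, let $X$ and $Y$ be Banach spaces (over $\mathbb K=\mathbb R$ or $\mathbb C$), let $p_1,p_2,r\in[1,\infty)$ and $p_0=\max\{p_1,p_2\}$. Let $\alpha\ge 3c_d^2/\delta$, where $\delta$ is the third entry of some tuple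 $(c_0,C_0,\delta,\gamma,m)$ admissible for $S$. Suppose that * $T$ is a bounded linear operator from $L^{p_1}(S;X)$ to $L^{p_1,\infty}(S;Y)$; * the sharp grand maximal truncation operator $$\mathcal M^{\#}_{T,\alpha}f(s)=\sup_{B\ni s}\ \operatorname*{ess\,sup}_{s',s''\in B}\ \big\|T(f\mathbf 1_{S\setminus\alpha B})(s')-T(f\mathbf 1_{S\setminus\alpha B})(s'')\big\|_Y ,$$ the supremum being over all balls $B$ containing $s$, is bounded from $L^{p_2}(S;X)$ to $L^{p_2,\infty}(S)$, that is, $\|\mathcal M^{\#}_{T,\alpha}f\|_{L^{p_2,\infty}}\le C\|f\|_{L^{p_2}(S;X)}$ for all $f\in L^{p_1}(S;X)\cap L^{p_2}(S;X)$ and some $C<\infty$ (with outer measure in the definition of the left-hand side); its norm is the least such $C$; * there is a $C_r>0$ such that for all $n$ and all disjointly and boundedly supported $f_1,\dots,f_n\in L^{p_0}(S;X)$ $$\Big\|T\Big(\sum_{k=1}^n f_k\Big)(s)\Big\|_Y\le C_r\Big(\sum_{k=1}^n\|Tf_k(s)\|_Y^r\Big)^{1/r}\qquad\text{for a.e. }s\in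 S.$$ Set $C_T=\|T\|_{L^{p_1}\to L^{p_1,\infty}}+\|\mathcal M^{\#}_{T,\alpha}\|_{L^{p_2}\to L^{p_2,\infty}}$. Then for all $p\in(p_0,\infty)$ and all weights $w\in A_{p/p_0}$ there is a unique bounded linear operator $L^p(S,w;X)\to L^p(S,w;Y)$ that agrees with $T$ on $L^{p_1}(S;X)\cap L^p(S,w;X)$, and this operator, still denoted $T$, satisfies $$\|T\|_{L^p(S,w;X)\to L^p(S,w;Y)}\le K\,C_T\,C_r\,[w]_{A_{p/p_0}}^{\max\{\frac1{p-p_0},\frac1r\}},$$ where the constant $K$ depends only on $c_d,c_\mu,p_0,p,r$ and $\alpha$. -/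

import Mathlib

open MeasureTheory Filter
open scoped ENNReal NNReal

universe u v w x

/-- The ball `B(s, ρ) = {t : d(s,t) < ρ}`. -/
def qBall {S : Type u} (d : S → S → ℝ) (s : S) (ρ : ℝ) : Set S := {t | d s t < ρ}

/-- The topology of a quasi-metric: a set is open if it contains a ball around each of its
points. -/
@[reducible] def qTopology {S : Type u} (d : S → S → ℝ) : TopologicalSpace S where
  IsOpen U := ∀ s ∈ U, ∃ ρ : ℝ, 0 < ρ ∧ qBall d s ρ ⊆ U
  isOpen_univ := fun _ _ => ⟨1, one_pos, Set.subset_univ _⟩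
  isOpen_inter := by
    rintro U V hU hV s ⟨hsU, hsV⟩
    obtain ⟨a, ha, haU⟩ := hU s hsU
    obtain ⟨b, hb, hbV⟩ := hV s hsV
    exact ⟨min a b, lt_min ha hb, fun t ht =>
      ⟨haU (lt_of_lt_of_le ht (min_le_left a b)), hbV (lt_of_lt_of_le ht (min_le_right a b))⟩⟩
  isOpen_sUnion := by
    rintro A hA s ⟨U, hUA, hsU⟩
    obtain ⟨a, ha, haU⟩ := hA U hUA s hsU
    exact ⟨a, ha, haU.trans (Set.subset_sUnion_of_mem hUA)⟩

/-- `(S, d, μ)` is a space of homogeneous type with quasi-metric constant `c_d` and doubling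
constant `c_μ`: `d` is a quasi-metric, `μ` is a doubling measure on the Borel `σ`-algebra of
`(S, d)`, all balls are Borel sets, and all balls have positive finite measure. -/
structure IsSpaceOfHomogeneousType {S : Type u} [mS : MeasurableSpace S] (d : S → S → ℝ)
    (μ : Measure S) (c_d c_μ : ℝ) : Prop where
  nonneg : ∀ s t, 0 ≤ d s t
  eq_zero_iff : ∀ s t, d s t = 0 ↔ s = t
  symm : ∀ s t, d s t = d t s
  quasi_triangle : ∀ s t u, d s t ≤ c_d * (d s u + d u t)
  borel_eq : mS = @borel S (qTopology d)
  measurableSet_ball : ∀ s ρ, MeasurableSet (qBall d s ρ)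
  doubling : ∀ s ρ, 0 < ρ → μ (qBall d s (2 * ρ)) ≤ ENNReal.ofReal c_μ * μ (qBall d s ρ)
  measure_ball_pos : ∀ s ρ, 0 < ρ → 0 < μ (qBall d s ρ)
  measure_ball_lt_top : ∀ s ρ, 0 < ρ → μ (qBall d s ρ) < ∞

/-- A dyadic system with parameters `c₀`, `C₀` and `δ`. A cube of generation `k` contains its
center and the cubes of one generation are disjoint, so they are indexed by their centers:
`cube k z` is the cube of generation `k` with center `z`, for `z ∈ centers k`. -/
structure DyadicSystem {S : Type u} [MeasurableSpace S] (d : S → S → ℝ) (c₀ C₀ δ : ℝ) where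
  centers : ℤ → Set S
  cube : ℤ → S → Set S
  measurableSet_cube : ∀ k, ∀ z ∈ centers k, MeasurableSet (cube k z)
  disjoint : ∀ k, ∀ z ∈ centers k, ∀ z' ∈ centers k, z ≠ z' → Disjoint (cube k z) (cube k z')
  cover : ∀ k, (⋃ z ∈ centers k, cube k z) = Set.univ
  nested : ∀ k l, l ≤ k → ∀ z ∈ centers k, ∀ z' ∈ centers l,
    Disjoint (cube k z) (cube l z') ∨ cube k z ⊆ cube l z'
  ball_subset : ∀ k, ∀ z ∈ centers k, qBall d z (c₀ * δ ^ k) ⊆ cube k z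
  subset_ball : ∀ k, ∀ z ∈ centers k, cube k z ⊆ qBall d z (C₀ * δ ^ k)

/-- `0 < c₀ ≤ C₀`, `0 < δ < 1`, `γ ≥ 1`, and there are `m` dyadic systems on `(S, d)` with
parameters `c₀`, `C₀`, `δ` such that every ball `B(s, ρ)` is contained in a cube of one of them of
diameter at most `γ ρ`. -/
def HasAdjacentDyadicSystems {S : Type u} [MeasurableSpace S] (d : S → S → ℝ)
    (c₀ C₀ δ γ : ℝ) (m : ℕ) : Prop :=
  0 < c₀ ∧ c₀ ≤ C₀ ∧ 0 < δ ∧ δ < 1 ∧ 1 ≤ γ ∧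
    ∃ D : Fin m → DyadicSystem d c₀ C₀ δ, ∀ (s : S) (ρ : ℝ), 0 < ρ →
      ∃ (j : Fin m) (k : ℤ), ∃ z ∈ (D j).centers k,
        qBall d s ρ ⊆ (D j).cube k z ∧
        ∀ a ∈ (D j).cube k z, ∀ b ∈ (D j).cube k z, d a b ≤ γ * ρ

section Operators

variable {S : Type u} [MeasurableSpace S] {μ : Measure S}

/-- The weak quasi-norm `sup_{t > 0} t μ({g > t})^{1/q}` of a `[0,∞]`-valued function. -/
noncomputable def weakLpNorm (g : S → ℝ≥0∞) (q : ℝ) (μ : Measure S) : ℝ≥0∞ :=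
  ⨆ t : ℝ≥0, (t : ℝ≥0∞) * μ {s | (t : ℝ≥0∞) < g s} ^ (1 / q)

variable {𝕜 : Type x} [RCLike 𝕜]
  {X : Type v} [NormedAddCommGroup X] [NormedSpace 𝕜 X]
  {Y : Type w} [NormedAddCommGroup Y] [NormedSpace 𝕜 Y] {p₁ : ℝ}

/-- The operator norm of `T` from `L^{p₁}(S;X)` to `L^{p₁,∞}(S;Y)`; it is `∞` if `T` is not
bounded between these spaces. -/
noncomputable def weakOpNorm (T : Lp X (ENNReal.ofReal p₁) μ →ₗ[𝕜] (S →ₘ[μ] Y)) : ℝ≥0∞ :=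
  sInf {C : ℝ≥0∞ | ∀ f : Lp X (ENNReal.ofReal p₁) μ,
    weakLpNorm (fun s => ‖T f s‖ₑ) p₁ μ ≤ C * eLpNorm f (ENNReal.ofReal p₁) μ}

/-- The product `f 1_E`, as an element of `L^{p₁}(S;X)`. -/
noncomputable def lpIndicator (f : Lp X (ENNReal.ofReal p₁) μ) {E : Set S}
    (hE : MeasurableSet E) : Lp X (ENNReal.ofReal p₁) μ :=
  ((Lp.memLp f).indicator hE).toLp (E.indicator f)

/-- The sharp grand maximal truncation operator: the supremum, over all balls `B = B(c, ρ)` that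
contain `s`, of the essential supremum over `(s', s'') ∈ B × B` of
`‖T(f 1_{S \ αB})(s') - T(f 1_{S \ αB})(s'')‖`, where `αB = B(c, αρ)`. -/
noncomputable def sharpMaximal {d : S → S → ℝ} (hd : ∀ s ρ, MeasurableSet (qBall d s ρ))
    (T : Lp X (ENNReal.ofReal p₁) μ →ₗ[𝕜] (S →ₘ[μ] Y)) (α : ℝ)
    (f : Lp X (ENNReal.ofReal p₁) μ) (s : S) : ℝ≥0∞ :=
  ⨆ (c : S) (ρ : ℝ) (_ : 0 < ρ) (_ : s ∈ qBall d c ρ),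
    essSup (fun z : S × S => ‖T (lpIndicator f (hd c (α * ρ)).compl) z.1
        - T (lpIndicator f (hd c (α * ρ)).compl) z.2‖ₑ)
      ((μ.restrict (qBall d c ρ)).prod (μ.restrict (qBall d c ρ)))

/-- The operator norm of the sharp grand maximal truncation operator from `L^{p₂}(S;X)` to
`L^{p₂,∞}(S)`, tested on the functions of `L^{p₂}(S;X)` on which `T` is defined, i.e. on
`L^{p₁}(S;X) ∩ L^{p₂}(S;X)`. -/
noncomputable def sharpMaximalOpNorm {d : S → S → ℝ} (hd : ∀ s ρ, MeasurableSet (qBall d s ρ))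
    (T : Lp X (ENNReal.ofReal p₁) μ →ₗ[𝕜] (S →ₘ[μ] Y)) (α p₂ : ℝ) : ℝ≥0∞ :=
  sInf {C : ℝ≥0∞ | ∀ f : Lp X (ENNReal.ofReal p₁) μ, MemLp f (ENNReal.ofReal p₂) μ →
    weakLpNorm (sharpMaximal hd T α f) p₂ μ ≤ C * eLpNorm f (ENNReal.ofReal p₂) μ}

/-- `r`-sublinearity of `T` with constant `C_r`, tested on finitely many disjointly and boundedly
supported functions in `L^{p₀}(S;X)` (for `p₁ ≤ p₀` a boundedly supported function in
`L^{p₀}(S;X)` belongs to `L^{p₁}(S;X)`). -/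
def IsRSublinear (d : S → S → ℝ) (T : Lp X (ENNReal.ofReal p₁) μ →ₗ[𝕜] (S →ₘ[μ] Y))
    (p₀ r C_r : ℝ) : Prop :=
  ∀ (n : ℕ) (f : Fin n → Lp X (ENNReal.ofReal p₁) μ),
    (∀ k, MemLp (f k) (ENNReal.ofReal p₀) μ) →
    (∀ k, ∃ (c : S) (ρ : ℝ), ∀ᵐ s ∂μ, s ∉ qBall d c ρ → f k s = 0) →
    (∀ j k, j ≠ k → ∀ᵐ s ∂μ, f j s = 0 ∨ f k s = 0) →
    ∀ᵐ s ∂μ, ‖T (∑ k, f k) s‖ ≤ C_r * (∑ k, ‖T (f k) s‖ ^ r) ^ (1 / r)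

end Operators

/-- A weight: a positive function that is integrable on balls. -/
structure IsWeight {S : Type u} [MeasurableSpace S] (d : S → S → ℝ) (μ : Measure S)
    (W : S → ℝ) : Prop where
  pos : ∀ s, 0 < W s
  integrableOn_ball : ∀ s ρ, IntegrableOn W (qBall d s ρ) μ

/-- The Muckenhoupt characteristic `[W]_{A_q}` of a weight, for `q > 1`: the supremum over all
balls `B` of `(⨍_B W) (⨍_B W^{-1/(q-1)})^{q-1}`. The weight lies in `A_q` if this is finite. -/
noncomputable def muckenhouptChar {S : Type u} [MeasurableSpace S] (d : S → S → ℝ)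
    (μ : Measure S) (q : ℝ) (W : S → ℝ) : ℝ≥0∞ :=
  ⨆ (c : S) (ρ : ℝ) (_ : 0 < ρ),
    (⨍⁻ s in qBall d c ρ, ENNReal.ofReal (W s) ∂μ) *
      (⨍⁻ s in qBall d c ρ, ENNReal.ofReal (W s)⁻¹ ^ (1 / (q - 1)) ∂μ) ^ (q - 1)

/-- The measure `W dμ`; the weighted Bochner space `L^p(S,W;X)` is the space `L^p` of this
measure. -/
noncomputable def weightedMeasure {S : Type u} [MeasurableSpace S] (μ : Measure S) (W : S → ℝ) :
    Measure S :=
  μ.withDensity fun s => ENNReal.ofReal (W s)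

/-- `TW : L^p(S,W;X) → L^p(S,W;Y)` coincides with `T : L^{p₁}(S;X) → L^{p₁,∞}(S;Y)` on
`L^{p₁}(S;X) ∩ L^p(S,W;X)`. As `W` is positive, `μ` and `W dμ` have the same null sets. -/
def AgreesWith {S : Type u} [MeasurableSpace S] {μ : Measure S} {W : S → ℝ}
    {𝕜 : Type x} [RCLike 𝕜]
    {X : Type v} [NormedAddCommGroup X] [NormedSpace 𝕜 X]
    {Y : Type w} [NormedAddCommGroup Y] [NormedSpace 𝕜 Y]
    {p₁ p : ℝ} [Fact (1 ≤ ENNReal.ofReal p)]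
    (TW : Lp X (ENNReal.ofReal p) (weightedMeasure μ W) →L[𝕜]
      Lp Y (ENNReal.ofReal p) (weightedMeasure μ W))
    (T : Lp X (ENNReal.ofReal p₁) μ →ₗ[𝕜] (S →ₘ[μ] Y)) : Prop :=
  ∀ (f : Lp X (ENNReal.ofReal p₁) μ) (g : Lp X (ENNReal.ofReal p) (weightedMeasure μ W)),
    f =ᵐ[μ] g → TW g =ᵐ[μ] T f

/-! The proof bounds `T F` pointwise by a sparse sum of local means, estimates this sum in the
weighted space, and extends by density.

Dyadic cubes. In each generation a maximal separated net is split into boundedly many widely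
separated colour classes (`exists_coloring`). For a given colour, `exists_parent_map` sends points
to nearby net points so that every favoured point absorbs a large ball around it. Iterating the
parent maps from ever finer generations need not converge, but only finitely many ancestors can
occur, so a consistent measurable choice of limit ancestors exists (`exists_ancestor_thread`). Its
fibres are the cubes. One system per colour gives adjacent systems, because every ball lies near a
net point of some colour (`exists_hasAdjacentDyadicSystems`).

Sparse domination (`exists_sparse_domination`). For a cube `Q` let `L Q` be a large multiple of
`C_T` times the `p₀`-mean of `F` over `αQ`. The two weak-type bounds make the set `Ω Q`, where `T (F
1_{αQ})` or its sharp maximal function exceeds `L Q`, small compared with `Q`. Stop at the maximal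
subcubes `P` in which `Ω Q` has density above a threshold (`exists_stoppingRule`). Outside them `T
(F 1_{αQ})` is at most `L Q`. By maximality `Ω Q` still misses most of `P`, so `T (F 1_{αQ \ αP})`
is at most `L Q + L P` somewhere in `P`; since its oscillation on the ball around `P` is at most `L
Q`, it is bounded almost everywhere on `P`. The stopping cubes around almost every point form a
finite chain, and `r`-sublinearity adds the pieces of this chain in `ℓʳ`. At least half of each
stopping cube is left uncovered by later ones, which is sparseness.

Weighted estimate (`lintegral_sparse_le`). The dilates `αQ` are enlarged to cubes of the adjacent
systems, so that each system contributes a family of nested or disjoint sets. With `q = p / p₀` and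
`ρ = r / p₀`, the integral `I` of the sparse sum to the power `q / ρ` is tested against itself. The
`A_q` condition on each cube, Hölder's inequality and two Carleson embeddings, for `w` and for its
dual weight, give `I ≤ c A G^{ρ/q} I^{1-ρ/q}`, which can be solved for `I`. This needs `ρ ≤ q - 1`;
otherwise `ρ` is first lowered to `q - 1`. The two cases are the two terms of the maximum in the
exponent.

Extension. Truncation to balls maps `L^p(W)` into `L^{p₀}`, and it yields the bound on `L^{p₁} ∩
L^p(W)` by Fatou's lemma and the density of this intersection in `L^p(W)`. -/

/-! ### Separated sets and colourings in a doubling quasi-metric space. -/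

section HomogeneousType

variable {S : Type u} [MeasurableSpace S] {d : S → S → ℝ} {μ : Measure S} {c_d c_μ : ℝ}

theorem mem_qBall_iff {s t : S} {ρ : ℝ} : t ∈ qBall d s ρ ↔ d s t < ρ := Iff.rfl

theorem qBall_mono {s : S} {ρ R : ℝ} (h : ρ ≤ R) : qBall d s ρ ⊆ qBall d s R :=
  fun _ ht => lt_of_lt_of_le ht h

namespace IsSpaceOfHomogeneousType

theorem dist_self (hS : IsSpaceOfHomogeneousType d μ c_d c_μ) (s : S) : d s s = 0 :=
  (hS.eq_zero_iff s s).2 rfl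

theorem measure_ball_pow (hS : IsSpaceOfHomogeneousType d μ c_d c_μ) (s : S) {ρ : ℝ} (hρ : 0 < ρ)
    (n : ℕ) : μ (qBall d s (2 ^ n * ρ)) ≤ ENNReal.ofReal c_μ ^ n * μ (qBall d s ρ) := by
  induction n with
  | zero => simp
  | succ n ih =>
    have h := hS.doubling s (2 ^ n * ρ) (by positivity)
    calc μ (qBall d s (2 ^ (n + 1) * ρ)) = μ (qBall d s (2 * (2 ^ n * ρ))) := by
          congr 2; ring
      _ ≤ ENNReal.ofReal c_μ * μ (qBall d s (2 ^ n * ρ)) := h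
      _ ≤ ENNReal.ofReal c_μ * (ENNReal.ofReal c_μ ^ n * μ (qBall d s ρ)) := by gcongr
      _ = _ := by ring

theorem qBall_subset_qBall (hS : IsSpaceOfHomogeneousType d μ c_d c_μ) (hcd : 1 ≤ c_d) {s t : S}
    {ρ R : ℝ} (h : c_d * (d s t + R) ≤ ρ) : qBall d t R ⊆ qBall d s ρ := by
  intro y hy
  have h1 := hS.quasi_triangle s y t
  have h2 : d t y < R := hy
  have : c_d * (d s t + d t y) < c_d * (d s t + R) := by
    apply mul_lt_mul_of_pos_left _ (by linarith)
    linarith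
  exact lt_of_le_of_lt h1 (lt_of_lt_of_le this h)

theorem measure_ball_le (hS : IsSpaceOfHomogeneousType d μ c_d c_μ) (hcd : 1 ≤ c_d) {s t : S}
    {ρ R : ℝ} (hρ : 0 < ρ) (n : ℕ) (h : c_d * (d s t + R) ≤ 2 ^ n * ρ) :
    μ (qBall d t R) ≤ ENNReal.ofReal c_μ ^ n * μ (qBall d s ρ) :=
  (measure_mono (hS.qBall_subset_qBall hcd h)).trans (hS.measure_ball_pow s hρ n)

theorem iUnion_qBall (s : S) : ⋃ n : ℕ, qBall d s n = Set.univ := by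
  refine Set.eq_univ_of_forall fun t => ?_
  obtain ⟨n, hn⟩ := exists_nat_gt (d s t)
  exact Set.mem_iUnion.2 ⟨n, hn⟩

theorem measure_ball_lt_top' (hS : IsSpaceOfHomogeneousType d μ c_d c_μ) (s : S) (ρ : ℝ) :
    μ (qBall d s ρ) < ∞ :=
  (measure_mono (qBall_mono (le_max_left ρ 1))).trans_lt
    (hS.measure_ball_lt_top s (max ρ 1) (by positivity))

theorem sigmaFinite (hS : IsSpaceOfHomogeneousType d μ c_d c_μ) : SigmaFinite μ := by
  rcases isEmpty_or_nonempty S with h | ⟨⟨s⟩⟩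
  · rw [Measure.eq_zero_of_isEmpty μ]; infer_instance
  · exact ⟨⟨⟨fun n => qBall d s n, fun _ => trivial, fun n => hS.measure_ball_lt_top' s n,
      iUnion_qBall s⟩⟩⟩

theorem measurableSingletonClass (hS : IsSpaceOfHomogeneousType d μ c_d c_μ) :
    MeasurableSingletonClass S := by
  refine ⟨fun s => ?_⟩
  have : ({s} : Set S) = ⋂ n : ℕ, qBall d s (1 / ((n : ℝ) + 1)) := by
    ext t
    simp only [Set.mem_singleton_iff, Set.mem_iInter, mem_qBall_iff]
    constructor
    · rintro rfl n
      rw [hS.dist_self]; positivity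
    · intro h
      have h0 : d s t = 0 := by
        refine le_antisymm (le_of_forall_pos_lt_add fun ε hε => ?_) (hS.nonneg s t)
        obtain ⟨n, hn⟩ := exists_nat_one_div_lt hε
        linarith [h n]
      exact ((hS.eq_zero_iff s t).1 h0).symm
  rw [this]
  exact MeasurableSet.iInter fun n => hS.measurableSet_ball s _

theorem disjoint_qBall (hS : IsSpaceOfHomogeneousType d μ c_d c_μ) (hcd : 1 ≤ c_d) {s t : S}
    {η : ℝ} (h : η ≤ d s t) : Disjoint (qBall d s (η / (2 * c_d))) (qBall d t (η / (2 * c_d))) := by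
  rw [Set.disjoint_left]
  intro y hs ht
  rw [mem_qBall_iff] at hs ht
  rw [hS.symm] at ht
  have h1 := hS.quasi_triangle s t y
  have h2 : c_d * (d s y + d y t) < c_d * (η / (2 * c_d) + η / (2 * c_d)) :=
    mul_lt_mul_of_pos_left (by linarith) (by linarith)
  have h3 : c_d * (η / (2 * c_d) + η / (2 * c_d)) = η := by field_simp; ring
  linarith

/-- The cardinality of an `η`-separated set in a ball of radius `L η` is bounded. -/
theorem card_separated_le (hS : IsSpaceOfHomogeneousType d μ c_d c_μ) (hcd : 1 ≤ c_d)
    {η L : ℝ} (hη : 0 < η) (hL : 0 < L) (n : ℕ)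
    (hn : c_d * (L + c_d * (L + 1)) * (2 * c_d) ≤ 2 ^ n)
    (x : S) (F : Finset S) (hF : ∀ y ∈ F, ∀ z ∈ F, y ≠ z → η ≤ d y z)
    (hx : ∀ y ∈ F, d x y < L * η) : (F.card : ℝ≥0∞) ≤ ENNReal.ofReal c_μ ^ n := by
  set R := c_d * (L + 1) * η with hR
  have hRpos : 0 < R := by positivity
  have hr : 0 < η / (2 * c_d) := by positivity
  have hsub : ∀ y ∈ F, qBall d y (η / (2 * c_d)) ⊆ qBall d x R := by
    intro y hy
    apply hS.qBall_subset_qBall hcd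
    have h1 := hx y hy
    have h2 : η / (2 * c_d) ≤ η := div_le_self hη.le (by linarith)
    calc c_d * (d x y + η / (2 * c_d)) ≤ c_d * (L * η + η) := by gcongr
      _ = R := by rw [hR]; ring
  have hle : ∀ y ∈ F, μ (qBall d x R) ≤
      ENNReal.ofReal c_μ ^ n * μ (qBall d y (η / (2 * c_d))) := by
    intro y hy
    apply hS.measure_ball_le hcd hr n
    have h1 := hx y hy
    rw [hS.symm] at h1
    calc c_d * (d y x + R) ≤ c_d * (L * η + R) := by gcongr
      _ = c_d * (L + c_d * (L + 1)) * (2 * c_d) * (η / (2 * c_d)) := by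
          rw [hR]; field_simp
      _ ≤ 2 ^ n * (η / (2 * c_d)) := by gcongr
  have hsum : ∑ y ∈ F, μ (qBall d y (η / (2 * c_d))) ≤ μ (qBall d x R) := by
    rw [← measure_biUnion_finset]
    · exact measure_mono (Set.iUnion₂_subset hsub)
    · intro y hy z hz hyz
      exact hS.disjoint_qBall hcd (hF y hy z hz hyz)
    · exact fun y _ => hS.measurableSet_ball _ _
  -- Packing: the small balls are disjoint in `B(x, R)`, and by doubling each carries at least the
  -- fraction `c_μ ^ (-n)` of its measure.
  have hmain : (F.card : ℝ≥0∞) * μ (qBall d x R) ≤ ENNReal.ofReal c_μ ^ n * μ (qBall d x R) :=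
    calc (F.card : ℝ≥0∞) * μ (qBall d x R) = ∑ y ∈ F, μ (qBall d x R) := by simp
      _ ≤ ∑ y ∈ F, ENNReal.ofReal c_μ ^ n * μ (qBall d y (η / (2 * c_d))) :=
          Finset.sum_le_sum hle
      _ = ENNReal.ofReal c_μ ^ n * ∑ y ∈ F, μ (qBall d y (η / (2 * c_d))) := by
          rw [Finset.mul_sum]
      _ ≤ _ := by gcongr
  exact (ENNReal.mul_le_mul_iff_left (hS.measure_ball_pos x R hRpos).ne'
    (hS.measure_ball_lt_top x R hRpos).ne).1 hmain

theorem countable_of_separated (hS : IsSpaceOfHomogeneousType d μ c_d c_μ) (hcd : 1 ≤ c_d)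
    {η : ℝ} (hη : 0 < η) {N : Set S} (hN : ∀ y ∈ N, ∀ z ∈ N, y ≠ z → η ≤ d y z) :
    N.Countable := by
  have := hS.sigmaFinite
  have h := Measure.countable_meas_pos_of_disjoint_iUnion (μ := μ)
    (As := fun y : N => qBall d y.1 (η / (2 * c_d))) (fun y => hS.measurableSet_ball _ _)
    (fun y z hyz => hS.disjoint_qBall hcd (hN y y.2 z z.2 (fun h => hyz (Subtype.ext h))))
  have huniv : {y : N | 0 < μ (qBall d y.1 (η / (2 * c_d)))} = Set.univ :=
    Set.eq_univ_of_forall fun y => hS.measure_ball_pos _ _ (by positivity)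
  rw [huniv] at h
  exact Set.countable_coe_iff.1 (Set.countable_univ_iff.1 h)

/-- Every set contains a maximal `η`-separated subset. -/
theorem exists_maximal_separated (hS : IsSpaceOfHomogeneousType d μ c_d c_μ) (N : Set S)
    {η : ℝ} (hη : 0 < η) : ∃ A ⊆ N, (∀ y ∈ A, ∀ z ∈ A, y ≠ z → η ≤ d y z) ∧
      ∀ x ∈ N, ∃ y ∈ A, d x y < η := by
  obtain ⟨A, hA⟩ := zorn_subset {A : Set S | A ⊆ N ∧ ∀ y ∈ A, ∀ z ∈ A, y ≠ z → η ≤ d y z} (by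
    intro c hc hchain
    refine ⟨⋃₀ c, ⟨Set.sUnion_subset fun s hs => (hc hs).1, ?_⟩,
      fun s hs => Set.subset_sUnion_of_mem hs⟩
    rintro y ⟨s, hs, hys⟩ z ⟨t, ht, hzt⟩ hyz
    rcases hchain.total hs ht with h | h
    · exact (hc ht).2 y (h hys) z hzt hyz
    · exact (hc hs).2 y hys z (h hzt) hyz)
  refine ⟨A, hA.prop.1, hA.prop.2, fun x hx => ?_⟩
  by_contra! hcon
  have hxA : x ∉ A := fun h => by
    have := hcon x h
    rw [hS.dist_self] at this
    linarith
  have hmem : insert x A ⊆ A := hA.le_of_ge (y := insert x A) ⟨Set.insert_subset hx hA.prop.1, by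
    rintro y (rfl | hy) z (rfl | hz) hyz
    · exact absurd rfl hyz
    · exact hcon z hz
    · rw [hS.symm]; exact hcon y hy
    · exact hA.prop.2 y hy z hz hyz⟩ (Set.subset_insert x A)
  exact hxA (hmem (Set.mem_insert x A))

/-- A set with few points in balls of radius `R` is the union of few `R`-separated sets. -/
theorem exists_coloring (hS : IsSpaceOfHomogeneousType d μ c_d c_μ) (N : Set S) {R : ℝ}
    (hR : 0 < R) (M : ℕ)
    (hM : ∀ (x : S) (F : Finset S), (∀ y ∈ F, y ∈ N ∧ d x y < R) → F.card ≤ M) :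
    ∃ A : Fin (M + 1) → Set S, (∀ i, A i ⊆ N) ∧
      (∀ i, ∀ y ∈ A i, ∀ z ∈ A i, y ≠ z → R ≤ d y z) ∧ ∀ x ∈ N, ∃ i, x ∈ A i := by
  choose pick hpick_sub hpick_sep hpick_max using
    fun N : Set S => hS.exists_maximal_separated N hR
  -- Greedy colouring: class `i` is a maximal `R`-separated subset of what the earlier classes
  -- leave. A point still uncoloured after `M + 1` rounds would have a point of each class within
  -- distance `R`, and these points are distinct, against `hM`.
  let rest : ℕ → Set S := fun i => Nat.rec N (fun _ Q => Q \ pick Q) i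
  have hrest : ∀ i, rest (i + 1) = rest i \ pick (rest i) := fun i => rfl
  have hanti : ∀ i j, i ≤ j → rest j ⊆ rest i := fun i j hij => by
    induction j, hij using Nat.le_induction with
    | base => exact subset_rfl
    | succ j _ ih => rw [hrest]; exact Set.sdiff_subset.trans ih
  refine ⟨fun i => pick (rest i), fun i => (hpick_sub _).trans (hanti 0 i (Nat.zero_le _)),
    fun i => hpick_sep _, fun x hx => ?_⟩
  by_contra! hcon
  have hxrest : ∀ i ≤ M + 1, x ∈ rest i := by
    intro i hi
    induction i with
    | zero => exact hx
    | succ i ih => exact ⟨ih (by omega), hcon ⟨i, by omega⟩⟩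
  have hex : ∀ i : Fin (M + 1), ∃ y ∈ pick (rest i), d x y < R := fun i =>
    hpick_max _ x (hxrest i (by omega))
  choose y hy hxy using hex
  have hne : ∀ i j : Fin (M + 1), i < j → y i ≠ y j := by
    intro i j hij h
    have h1 : y j ∈ rest (i + 1) := hanti (i + 1) j hij (hpick_sub _ (hy j))
    rw [hrest] at h1
    exact h1.2 (h ▸ hy i)
  have hinj : Function.Injective y := by
    intro i j hij
    rcases lt_trichotomy i j with h | h | h
    · exact absurd hij (hne i j h)
    · exact h
    · exact absurd hij.symm (hne j i h)
  classical
  have := hM x (Finset.univ.image y) (by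
    intro z hz
    obtain ⟨i, -, rfl⟩ := Finset.mem_image.1 hz
    exact ⟨hanti 0 i (Nat.zero_le _) (hpick_sub _ (hy i)), hxy i⟩)
  rw [Finset.card_image_of_injective _ hinj] at this
  simp at this

end IsSpaceOfHomogeneousType

end HomogeneousType

/-! ### Parent maps and limit ancestors. -/

section DyadicConstruction

variable {S : Type u} [MeasurableSpace S] {d : S → S → ℝ} {μ : Measure S} {c_d c_μ : ℝ}

/-- The parent map of one scale `η`: every point is assigned a center of a subset `C` of the net
`N`, in such a way that large balls around the points of `A` are mapped to their center. -/
theorem IsSpaceOfHomogeneousType.exists_parent_map [Nonempty S]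
    (hS : IsSpaceOfHomogeneousType d μ c_d c_μ)
    (hcd : 1 ≤ c_d) {η : ℝ} (hη : 0 < η) {N A : Set S}
    (hN : ∀ y ∈ N, ∀ z ∈ N, y ≠ z → η ≤ d y z) (hNmax : ∀ x, ∃ y ∈ N, d x y < η)
    (hAN : A ⊆ N) (hA : ∀ y ∈ A, ∀ z ∈ A, y ≠ z → 8 * c_d ^ 3 * η ≤ d y z) :
    ∃ (C : Set S) (par : S → S), C ⊆ N ∧ Measurable par ∧ (∀ u, par u ∈ C) ∧
      (∀ u, d u (par u) < c_d * (1 + c_d * (4 * c_d ^ 2 + 1)) * η) ∧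
      (∀ v ∈ C, ∀ u, d u v < 1 / (2 * c_d) * η → par u = v) ∧
      ∀ v ∈ A, v ∈ C ∧ ∀ u, d u v < 4 * c_d ^ 2 * η → par u = v := by
  classical
  have hc0 : 0 < c_d := by linarith
  set R' := c_d * (4 * c_d ^ 2 + 1) with hR'
  set D := c_d * (1 + R') with hD
  -- Net points close to `A` are dropped, to make room for the large balls around `A`. The radius
  -- `R' η` keeps a ball of radius `4 c_d² η` around a point of `A` disjoint from the small ball of
  -- a surviving net point, and the separation `8 c_d³ η` does the same for two points of `A`.
  -- Dropped points still lie within `R' η` of `A`, which leads to the covering radius `D η`.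
  set C : Set S := A ∪ {z ∈ N | ∀ y ∈ A, R' * η ≤ d y z} with hCdef
  have hCN : C ⊆ N := Set.union_subset hAN (Set.sep_subset _ _)
  let rad : S → ℝ := fun v => if v ∈ A then 4 * c_d ^ 2 else 1 / (2 * c_d)
  have hc1 : 1 / (2 * c_d) ≤ 1 := by
    rw [div_le_one (by positivity)]; linarith
  have hradD : ∀ v, rad v ≤ D := by
    intro v
    have h1 : 4 * c_d ^ 2 ≤ D := by
      rw [hD, hR']
      nlinarith [mul_pos hc0 hc0, mul_pos (mul_pos hc0 hc0) hc0, mul_nonneg (sub_nonneg.2 hcd)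
        (mul_pos hc0 hc0).le, mul_nonneg (mul_nonneg (sub_nonneg.2 hcd)
        (mul_pos hc0 hc0).le) hc0.le]
    have h2 : 1 ≤ D := by nlinarith [sq_nonneg c_d]
    show (if v ∈ A then 4 * c_d ^ 2 else 1 / (2 * c_d)) ≤ D
    split_ifs
    · exact h1
    · linarith
  -- the distinguished neighbourhoods of different centers are disjoint
  have huniq : ∀ v ∈ C, ∀ v' ∈ C, ∀ u, d u v < rad v * η → d u v' < rad v' * η → v = v' := by
    intro v hv v' hv' u h h'
    have key : d v v' < c_d * (rad v + rad v') * η := by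
      have h1 := hS.quasi_triangle v v' u
      rw [hS.symm v u] at h1
      have : c_d * (d u v + d u v') < c_d * (rad v * η + rad v' * η) :=
        mul_lt_mul_of_pos_left (by linarith) hc0
      linarith
    by_contra hne
    by_cases hvA : v ∈ A <;> by_cases hvA' : v' ∈ A <;> simp only [rad, hvA, hvA', if_true, if_false] at key
    · have := hA v hvA v' hvA' hne
      have : 8 * c_d ^ 3 * η = c_d * (4 * c_d ^ 2 + 4 * c_d ^ 2) * η := by ring
      linarith
    · have h2 : R' * η ≤ d v v' := (hv'.resolve_left hvA').2 v hvA
      have h3 : c_d * (4 * c_d ^ 2 + 1 / (2 * c_d)) * η ≤ R' * η := by rw [hR']; gcongr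
      linarith
    · have h2 : R' * η ≤ d v' v := (hv.resolve_left hvA).2 v' hvA'
      rw [hS.symm] at h2
      have h3 : c_d * (1 / (2 * c_d) + 4 * c_d ^ 2) * η ≤ R' * η := by
        rw [hR', add_comm (1 / (2 * c_d))]; gcongr
      linarith
    · have h2 := hN v (hCN hv) v' (hCN hv') hne
      have : c_d * (1 / (2 * c_d) + 1 / (2 * c_d)) * η = η := by field_simp; ring
      linarith
  have hcover : ∀ u, ∃ v ∈ C, d u v < D * η := by
    intro u
    obtain ⟨z, hz, huz⟩ := hNmax u
    by_cases h : ∀ y ∈ A, R' * η ≤ d y z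
    · refine ⟨z, Or.inr ⟨hz, h⟩, huz.trans_le ?_⟩
      have : 1 ≤ D := by nlinarith [sq_nonneg c_d]
      nlinarith
    · push Not at h
      obtain ⟨y, hy, hyz⟩ := h
      refine ⟨y, Or.inl hy, ?_⟩
      rw [hS.symm] at hyz
      have h1 := hS.quasi_triangle u y z
      have : c_d * (d u z + d z y) < c_d * (η + R' * η) :=
        mul_lt_mul_of_pos_left (by linarith) hc0
      have h3 : c_d * (η + R' * η) = D * η := by rw [hD]; ring
      linarith
  have hCc : C.Countable := hS.countable_of_separated hcd hη fun y hy z hz h =>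
    hN y (hCN hy) z (hCN hz) h
  have hCne : C.Nonempty := by
    obtain ⟨v, hv, -⟩ := hcover (Classical.arbitrary S)
    exact ⟨v, hv⟩
  obtain ⟨c, hc⟩ := hCc.exists_eq_range hCne
  have hcC : ∀ n, c n ∈ C := fun n => hc ▸ Set.mem_range_self n
  -- A point in the reserved ball of a center goes to that center; any other point goes to the first
  -- center, in a fixed enumeration, within distance `D η`. Taking the first one makes the map
  -- measurable.
  let p : S → ℕ → Prop := fun u n => d u (c n) < rad (c n) * η ∨
    ((∀ m, ¬ d u (c m) < rad (c m) * η) ∧ d u (c n) < D * η)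
  have hp : ∀ u, ∃ n, p u n := by
    intro u
    by_cases h : ∃ n, d u (c n) < rad (c n) * η
    · exact ⟨h.choose, Or.inl h.choose_spec⟩
    · push Not at h
      obtain ⟨v, hv, huv⟩ := hcover u
      rw [hc] at hv
      obtain ⟨n, rfl⟩ := hv
      exact ⟨n, Or.inr ⟨fun m => not_lt.2 (h m), huv⟩⟩
  have hball : ∀ v t, MeasurableSet {u | d u v < t} := by
    intro v t
    have : {u | d u v < t} = qBall d v t := by ext u; simp [qBall, hS.symm u v]
    rw [this]; exact hS.measurableSet_ball v t
  have hmeas : Measurable fun u => Nat.find (hp u) := by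
    apply measurable_find
    intro n
    have : {u | p u n} = {u | d u (c n) < rad (c n) * η} ∪
        ((⋂ m, {u | d u (c m) < rad (c m) * η}ᶜ) ∩ {u | d u (c n) < D * η}) := by
      ext u; simp [p]
    rw [this]
    exact (hball _ _).union ((MeasurableSet.iInter fun m => (hball _ _).compl).inter (hball _ _))
  have hspec : ∀ u, p u (Nat.find (hp u)) := fun u => Nat.find_spec (hp u)
  have hpar : ∀ v ∈ C, ∀ u, d u v < rad v * η → c (Nat.find (hp u)) = v := by
    intro v hv u huv
    rcases hspec u with h | ⟨h, -⟩
    · exact huniq _ (hcC _) v hv u h huv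
    · rw [hc] at hv
      obtain ⟨n, rfl⟩ := hv
      exact absurd huv (h n)
  refine ⟨C, fun u => c (Nat.find (hp u)), hCN, measurable_from_nat.comp hmeas, fun u => hcC _,
    ?_, ?_, ?_⟩
  · intro u
    rcases hspec u with h | ⟨-, h⟩
    · exact h.trans_le (by gcongr; exact hradD _)
    · exact h
  · intro v hv u huv
    refine hpar v hv u (huv.trans_le ?_)
    gcongr
    show 1 / (2 * c_d) ≤ if v ∈ A then 4 * c_d ^ 2 else 1 / (2 * c_d)
    split_ifs
    · nlinarith
    · exact le_rfl
  · intro v hv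
    refine ⟨Or.inl hv, fun u huv => hpar v (Or.inl hv) u ?_⟩
    simpa [rad, hv] using huv

/-- The ancestor of generation `k` of a point, seen from the generation `k + n`. -/
def ancestor (par : ℤ → S → S) : ℕ → ℤ → S → S
  | 0, k => par k
  | n + 1, k => par k ∘ ancestor par n (k + 1)

theorem measurable_ancestor {par : ℤ → S → S} (h : ∀ k, Measurable (par k)) (n : ℕ) (k : ℤ) :
    Measurable (ancestor par n k) := by
  induction n generalizing k with
  | zero => exact h k
  | succ n ih => exact (h k).comp (ih (k + 1))

/-- The points that are infinitely often the ancestor of generation `k` of `x`. -/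
def IsLimitAncestor (par : ℤ → S → S) (k : ℤ) (x v : S) : Prop :=
  ∃ᶠ n in atTop, ancestor par n k x = v

theorem IsLimitAncestor.parent {par : ℤ → S → S} {k : ℤ} {x v : S}
    (h : IsLimitAncestor par (k + 1) x v) : IsLimitAncestor par k x (par k v) := by
  have h1 : ∃ᶠ n in atTop, ancestor par (n + 1) k x = par k v := by
    refine Frequently.mono h fun n hn => ?_
    simp [ancestor, hn]
  exact (tendsto_add_atTop_nat 1).frequently h1

theorem exists_frequently_eq_of_finite {f : ℕ → S} (hf : (Set.range f).Finite) {P : ℕ → Prop}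
    (hP : ∃ᶠ n in atTop, P n) : ∃ v, ∃ᶠ n in atTop, P n ∧ f n = v := by
  by_contra! hcon
  have := (eventually_all_finite hf).2 fun v _ => hcon v
  exact hP (this.mono fun n hn hPn => hn (f n) (Set.mem_range_self n) hPn rfl)

theorem exists_isLimitAncestor {par : ℤ → S → S}
    (hfin : ∀ k x, (Set.range fun n => ancestor par n k x).Finite) (k : ℤ) (x : S) :
    ∃ v, IsLimitAncestor par k x v := by
  obtain ⟨v, hv⟩ := exists_frequently_eq_of_finite (hfin k x) (P := fun _ => True)
    (Frequently.of_forall fun _ => trivial)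
  exact ⟨v, hv.mono fun n h => h.2⟩

/-- The converse of `IsLimitAncestor.parent`, as in König's lemma: among the finitely many ancestors
of generation `k + 1` that are mapped to `v`, one recurs infinitely often. It allows a choice of
limit ancestors to be continued to finer generations. -/
theorem IsLimitAncestor.exists_child {par : ℤ → S → S}
    (hfin : ∀ k x, (Set.range fun n => ancestor par n k x).Finite) {k : ℤ} {x v : S}
    (h : IsLimitAncestor par k x v) : ∃ u, IsLimitAncestor par (k + 1) x u ∧ par k u = v := by
  have h1 : ∃ᶠ n in atTop, ancestor par (n + 1) k x = v := by
    rw [IsLimitAncestor, frequently_atTop] at h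
    rw [frequently_atTop]
    intro a
    obtain ⟨b, hb, hbv⟩ := h (a + 1)
    obtain ⟨c, rfl⟩ : ∃ c, b = c + 1 := ⟨b - 1, by omega⟩
    exact ⟨c, by omega, hbv⟩
  obtain ⟨u, hu⟩ := exists_frequently_eq_of_finite (hfin (k + 1) x) h1
  refine ⟨u, hu.mono fun n h => h.2, ?_⟩
  obtain ⟨n, hn, hnu⟩ := hu.exists
  rw [← hnu]; exact hn

/-- A recurring value also occurs at a positive index, where it passes through an ancestor of
generation `k + 1`. Index `0` is of no use, since it applies `par k` to `x` directly. -/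
theorem IsLimitAncestor.exists_eq {par : ℤ → S → S} {k : ℤ} {x v : S}
    (h : IsLimitAncestor par k x v) : ∃ n, par k (ancestor par n (k + 1) x) = v := by
  rw [IsLimitAncestor, frequently_atTop] at h
  obtain ⟨b, hb, hbv⟩ := h 1
  obtain ⟨c, rfl⟩ : ∃ c, b = c + 1 := ⟨b - 1, by omega⟩
  exact ⟨c, hbv⟩

theorem measurableSet_isLimitAncestor [MeasurableSingletonClass S] {par : ℤ → S → S}
    (h : ∀ k, Measurable (par k)) (k : ℤ) (v : S) :
    MeasurableSet {x | IsLimitAncestor par k x v} := by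
  have : {x | IsLimitAncestor par k x v} =
      ⋂ a : ℕ, ⋃ b : ℕ, ⋃ _ : a ≤ b, ancestor par b k ⁻¹' {v} := by
    ext x
    simp [IsLimitAncestor, frequently_atTop]
  rw [this]
  exact MeasurableSet.iInter fun a => MeasurableSet.iUnion fun b => MeasurableSet.iUnion fun _ =>
    measurable_ancestor h b k (measurableSet_singleton v)

/-- A measurable, consistent choice of limit ancestors in all generations. -/
theorem exists_ancestor_thread [Nonempty S] [MeasurableSingletonClass S] {par : ℤ → S → S}
    (hmeas : ∀ k, Measurable (par k)) (hcount : ∀ k, (Set.range (par k)).Countable)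
    (hfin : ∀ k x, (Set.range fun n => ancestor par n k x).Finite) :
    ∃ a : ℤ → S → S, (∀ k, Measurable (a k)) ∧ (∀ k x, IsLimitAncestor par k x (a k x)) ∧
      ∀ k x, par k (a (k + 1) x) = a k x := by
  classical
  choose c hc using fun k => (hcount k).exists_eq_range (Set.range_nonempty (par k))
  have hrange : ∀ k x v, IsLimitAncestor par k x v → ∃ n, c k n = v := by
    intro k x v h
    obtain ⟨n, hn⟩ := h.exists_eq
    have : v ∈ Set.range (par k) := ⟨_, hn⟩
    rw [hc k] at this
    exact this
  -- Measurable selection: limit ancestors lie in the countable range of `par k`, and the first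
  -- admissible one in an enumeration is chosen.
  have hstep : ∀ (k : ℤ) (p : S → S → Prop), (∀ v, MeasurableSet {x | p x v}) →
      (∀ x, ∃ v, IsLimitAncestor par k x v ∧ p x v) →
      ∃ f : S → S, Measurable f ∧ ∀ x, IsLimitAncestor par k x (f x) ∧ p x (f x) := by
    intro k p hp hex
    have hex' : ∀ x, ∃ n, IsLimitAncestor par k x (c k n) ∧ p x (c k n) := by
      intro x
      obtain ⟨v, hv, hpv⟩ := hex x
      obtain ⟨n, rfl⟩ := hrange k x v hv
      exact ⟨n, hv, hpv⟩
    refine ⟨fun x => c k (Nat.find (hex' x)), measurable_from_nat.comp (measurable_find hex'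
      fun n => (measurableSet_isLimitAncestor hmeas k (c k n)).inter (hp (c k n))),
      fun x => Nat.find_spec (hex' x)⟩
  let F : ℤ → Type u := fun k => {f : S → S // Measurable f ∧ ∀ x, IsLimitAncestor par k x (f x)}
  have hnext : ∀ (k : ℤ) (f : F k), ∃ g : F (k + 1), ∀ x, par k (g.1 x) = f.1 x := by
    rintro k ⟨f, hf, hfv⟩
    obtain ⟨g, hg, hgv⟩ := hstep (k + 1) (fun x v => par k v = f x)
      (fun v => by simpa [Set.preimage, eq_comm] using hf (measurableSet_singleton (par k v)))
      fun x => (hfv x).exists_child hfin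
    exact ⟨⟨g, hg, fun x => (hgv x).1⟩, fun x => (hgv x).2⟩
  choose next hnext using hnext
  obtain ⟨f0, hf0⟩ : ∃ f : S → S, Measurable f ∧ ∀ x, IsLimitAncestor par 0 x (f x) := by
    obtain ⟨f, hf, hfv⟩ := hstep 0 (fun _ _ => True) (fun _ => MeasurableSet.univ)
      fun x => by simpa using exists_isLimitAncestor hfin 0 x
    exact ⟨f, hf, fun x => (hfv x).1⟩
  -- From generation `0`, finer generations require a choice of children, whereas coarser ones are
  -- forced by the parent maps.
  let pos : (n : ℕ) → F n := fun n => Nat.rec ⟨f0, hf0⟩ (fun n f => by exact_mod_cast next n f) n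
  have hpos : ∀ (n : ℕ) x, par (n : ℤ) ((pos (n + 1)).1 x) = (pos n).1 x := fun n x =>
    hnext n (pos n) x
  let neg : ℕ → S → S := fun n => Nat.rec f0 (fun n f => par (-((n : ℤ) + 1)) ∘ f) n
  have hneg : ∀ (n : ℕ) x, neg (n + 1) x = par (-((n : ℤ) + 1)) (neg n x) := fun n x => rfl
  let a : ℤ → S → S := fun k => if 0 ≤ k then (pos k.toNat).1 else neg (-k).toNat
  have hpos_eq : ∀ n : ℕ, a n = (pos n).1 := fun n => by simp [a]
  have hneg_eq : ∀ n : ℕ, a (-(n : ℤ)) = neg n := by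
    intro n
    rcases Nat.eq_zero_or_pos n with rfl | h
    · simp only [Nat.cast_zero, neg_zero]
      exact hpos_eq 0
    · have : ¬ (0 : ℤ) ≤ -(n : ℤ) := by omega
      simp [a, h.ne']
  have hpar : ∀ k x, par k (a (k + 1) x) = a k x := by
    intro k x
    rcases le_or_gt 0 k with h | h
    · obtain ⟨n, rfl⟩ := Int.eq_ofNat_of_zero_le h
      have : ((n : ℤ) + 1) = ((n + 1 : ℕ) : ℤ) := by push_cast; rfl
      rw [this, hpos_eq, hpos_eq]
      exact hpos n x
    · obtain ⟨n, rfl⟩ : ∃ n : ℕ, k = -((n + 1 : ℕ) : ℤ) := ⟨(-k - 1).toNat, by omega⟩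
      have : -((n + 1 : ℕ) : ℤ) + 1 = -(n : ℤ) := by push_cast; ring
      rw [this, hneg_eq, hneg_eq, hneg]
      push_cast
      rfl
  have hposprop : ∀ n : ℕ, Measurable (a n) ∧ ∀ x, IsLimitAncestor par n x (a n x) := by
    intro n
    rw [hpos_eq]
    exact (pos n).2
  have hnegprop : ∀ n : ℕ, Measurable (a (-(n : ℤ))) ∧
      ∀ x, IsLimitAncestor par (-(n : ℤ)) x (a (-(n : ℤ)) x) := by
    intro n
    induction n with
    | zero => simpa using hposprop 0
    | succ n ih =>
      have h1 : -((n + 1 : ℕ) : ℤ) + 1 = -(n : ℤ) := by push_cast; ring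
      have h2 : a (-((n + 1 : ℕ) : ℤ)) = par (-((n + 1 : ℕ) : ℤ)) ∘ a (-(n : ℤ)) := by
        funext x
        rw [← hpar, h1]; rfl
      refine ⟨by rw [h2]; exact (hmeas _).comp ih.1, fun x => ?_⟩
      rw [h2]
      apply IsLimitAncestor.parent
      rw [h1]
      exact ih.2 x
  have hall : ∀ k, Measurable (a k) ∧ ∀ x, IsLimitAncestor par k x (a k x) := by
    intro k
    rcases le_or_gt 0 k with h | h
    · obtain ⟨n, rfl⟩ := Int.eq_ofNat_of_zero_le h
      exact hposprop n
    · obtain ⟨n, rfl⟩ : ∃ n : ℕ, k = -(n : ℤ) := ⟨(-k).toNat, by omega⟩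
      exact hnegprop n
  exact ⟨a, fun k => (hall k).1, fun k => (hall k).2, hpar⟩

end DyadicConstruction

/-! ### Adjacent dyadic systems from coloured nets. -/

section AdjacentSystems

variable {S : Type u} [MeasurableSpace S] {d : S → S → ℝ} {μ : Measure S} {c_d c_μ : ℝ}

/-- A geometric series: going one generation up multiplies the old error by `c_d`, but that error is
smaller by the factor `δ`, and `2 c_d δ ≤ 1` closes the induction with a bound independent of `n`.
-/
theorem IsSpaceOfHomogeneousType.dist_ancestor_lt (hS : IsSpaceOfHomogeneousType d μ c_d c_μ)
    (hcd : 1 ≤ c_d) {δ D : ℝ} (hδ : 0 < δ) (hD : 0 < D) (hδd : 2 * c_d * δ ≤ 1) {par : ℤ → S → S}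
    (hpar : ∀ k u, d u (par k u) < D * δ ^ k) (n : ℕ) (k : ℤ) (x : S) :
    d x (ancestor par n k x) < 2 * c_d * D * δ ^ k := by
  have hc0 : 0 < c_d := by linarith
  induction n generalizing k with
  | zero =>
    refine (hpar k x).trans_le ?_
    gcongr
    nlinarith
  | succ n ih =>
    have h1 := ih (k + 1)
    have h2 := hpar k (ancestor par n (k + 1) x)
    have h3 := hS.quasi_triangle x (ancestor par (n + 1) k x) (ancestor par n (k + 1) x)
    rw [zpow_add_one₀ hδ.ne'] at h1
    have h4 : 0 < δ ^ k := by positivity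
    calc d x (ancestor par (n + 1) k x)
        ≤ c_d * (d x (ancestor par n (k + 1) x) + d (ancestor par n (k + 1) x)
          (par k (ancestor par n (k + 1) x))) := h3
      _ < c_d * (2 * c_d * D * (δ ^ k * δ) + D * δ ^ k) :=
          mul_lt_mul_of_pos_left (add_lt_add h1 h2) hc0
      _ = c_d * D * δ ^ k * (2 * c_d * δ + 1) := by ring
      _ ≤ c_d * D * δ ^ k * (1 + 1) := by gcongr
      _ = _ := by ring

/-- Parent maps yield a dyadic system whose cubes contain balls around their centers. -/
theorem IsSpaceOfHomogeneousType.exists_dyadicSystem [Nonempty S]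
    (hS : IsSpaceOfHomogeneousType d μ c_d c_μ)
    (hcd : 1 ≤ c_d) {δ D c₀ c₁ : ℝ} (hδ : 0 < δ) (hD : 0 < D) (hδd : 2 * c_d * δ ≤ 1)
    (hc : c_d * (2 * c_d * D * δ + c₀) ≤ c₁)
    {C : ℤ → Set S} {par : ℤ → S → S}
    (hC : ∀ k, ∀ y ∈ C k, ∀ z ∈ C k, y ≠ z → δ ^ k ≤ d y z)
    (hmeas : ∀ k, Measurable (par k)) (hparC : ∀ k u, par k u ∈ C k)
    (hpar : ∀ k u, d u (par k u) < D * δ ^ k)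
    (hnear : ∀ k, ∀ v ∈ C k, ∀ u, d u v < c₁ * δ ^ k → par k u = v) :
    ∃ 𝒟 : DyadicSystem d c₀ (2 * c_d * D) δ, ∀ k v t t', 0 < t →
      c_d * (2 * c_d * D * δ + t') ≤ t → (∀ u, d u v < t * δ ^ k → par k u = v) →
      v ∈ 𝒟.centers k ∧ qBall d v (t' * δ ^ k) ⊆ 𝒟.cube k v := by
  have hc0 : 0 < c_d := by linarith
  have := hS.measurableSingletonClass
  have hcount : ∀ k, (Set.range (par k)).Countable := fun k =>
    (hS.countable_of_separated hcd (zpow_pos hδ k) (hC k)).mono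
      (Set.range_subset_iff.2 (hparC k))
  have hancC : ∀ n k x, ancestor par n k x ∈ C k := by
    intro n k x
    cases n with
    | zero => exact hparC k x
    | succ n => exact hparC k _
  have hdist := fun n k x => hS.dist_ancestor_lt hcd hδ hD hδd hpar n k x
  -- All ancestors of `x` in generation `k` belong to one `δ ^ k`-separated set and to one ball, so
  -- the packing bound applies.
  have hfin : ∀ k x, (Set.range fun n => ancestor par n k x).Finite := by
    intro k x
    by_contra hinf
    set L := 2 * c_d * D
    obtain ⟨n, hn⟩ := pow_unbounded_of_one_lt (c_d * (L + c_d * (L + 1)) * (2 * c_d))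
      (one_lt_two : (1 : ℝ) < 2)
    obtain ⟨M, hM⟩ := exists_nat_gt (c_μ ^ n)
    obtain ⟨F, hF, hFM⟩ := Set.Infinite.exists_subset_card_eq hinf M
    have hFx : ∀ y ∈ F, y ∈ C k ∧ d x y < L * δ ^ k := by
      intro y hy
      obtain ⟨m, rfl⟩ := hF hy
      exact ⟨hancC m k x, hdist m k x⟩
    have h := hS.card_separated_le hcd (zpow_pos hδ k) (by positivity : 0 < L) n hn.le x F
      (fun y hy z hz => hC k y (hFx y hy).1 z (hFx z hz).1) fun y hy => (hFx y hy).2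
    rw [hFM] at h
    rcases le_or_gt c_μ 0 with hneg | hpos
    · have hb := hS.doubling x 1 one_pos
      rw [ENNReal.ofReal_of_nonpos hneg, zero_mul] at hb
      exact absurd hb (not_le.2 (hS.measure_ball_pos x _ (by norm_num)))
    · rw [← ENNReal.ofReal_pow hpos.le, ← ENNReal.ofReal_natCast,
        ENNReal.ofReal_le_ofReal_iff (by positivity)] at h
      linarith
  obtain ⟨a, ha, hlim, hcons⟩ := exists_ancestor_thread hmeas hcount hfin
  have haC : ∀ k x, a k x ∈ C k := fun k x => hcons k x ▸ hparC k _
  -- If `x` is close to `v`, then so is every ancestor of `x` of generation `k + 1`, at an extra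
  -- cost proportional to `δ`. Hence it lies in the ball that `par k` sends to `v`.
  have hinner : ∀ k v t t', c_d * (2 * c_d * D * δ + t') ≤ t →
      (∀ u, d u v < t * δ ^ k → par k u = v) → ∀ x, d v x < t' * δ ^ k → a k x = v := by
    intro k v t t' htt' hv x hx
    obtain ⟨n, hn⟩ := (hlim k x).exists_eq
    rw [← hn]
    apply hv
    have h1 := hdist n (k + 1) x
    rw [zpow_add_one₀ hδ.ne', hS.symm] at h1
    rw [hS.symm] at hx
    have h3 := hS.quasi_triangle (ancestor par n (k + 1) x) v x
    have h4 : 0 < δ ^ k := by positivity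
    calc d (ancestor par n (k + 1) x) v ≤ c_d * (d (ancestor par n (k + 1) x) x + d x v) := h3
      _ < c_d * (2 * c_d * D * (δ ^ k * δ) + t' * δ ^ k) :=
          mul_lt_mul_of_pos_left (add_lt_add h1 hx) hc0
      _ = c_d * (2 * c_d * D * δ + t') * δ ^ k := by ring
      _ ≤ t * δ ^ k := by gcongr
  refine ⟨{ centers := C
            cube := fun k z => {x | a k x = z}
            measurableSet_cube := fun k z _ => ha k (measurableSet_singleton z)
            disjoint := ?_
            cover := ?_
            nested := ?_
            ball_subset := ?_
            subset_ball := ?_ }, ?_⟩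
  · intro k z _ z' _ hzz'
    exact Set.disjoint_left.2 fun x hx hx' => hzz' (hx.symm.trans hx')
  · intro k
    exact Set.eq_univ_of_forall fun x => Set.mem_iUnion₂.2 ⟨a k x, haC k x, rfl⟩
  · have key : ∀ k l, l ≤ k → ∀ x y, a k x = a k y → a l x = a l y := by
      intro k l hlk x y
      induction k, hlk using Int.leInduction with
      | base => exact id
      | succ k _ ih =>
        intro h
        exact ih (by rw [← hcons k x, ← hcons k y, h])
    intro k l hlk z _ z' _
    by_cases h : ∃ x, a k x = z ∧ a l x = z'
    · obtain ⟨x, hx, hx'⟩ := h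
      right
      intro y hy
      exact (key k l hlk y x (hy.trans hx.symm)).trans hx'
    · left
      exact Set.disjoint_left.2 fun x hx hx' => h ⟨x, hx, hx'⟩
  · intro k z hz x hx
    exact hinner k z c₁ c₀ hc (hnear k z hz) x hx
  · rintro k z _ x rfl
    obtain ⟨n, hn⟩ := (hlim k x).exists
    have := hdist n k x
    rw [hn, hS.symm] at this
    exact this
  · intro k v t t' ht htt' hv
    refine ⟨?_, fun x hx => hinner k v t t' htt' hv x hx⟩
    have : par k v = v := hv v (by rw [hS.dist_self]; positivity)
    exact this ▸ hparC k v

/-- Adjacent dyadic systems exist, with parameters that depend only on the constants of the space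
of homogeneous type. -/
theorem exists_hasAdjacentDyadicSystems (c_d c_μ : ℝ) (hcd : 1 ≤ c_d) (hcμ : 1 ≤ c_μ) :
    ∃ (c₀ C₀ δ γ : ℝ) (m : ℕ), 2 * c_d * δ ≤ 1 ∧
      ∀ (S : Type u) [MeasurableSpace S] (d : S → S → ℝ)
        (μ : Measure S), IsSpaceOfHomogeneousType d μ c_d c_μ →
          HasAdjacentDyadicSystems d c₀ C₀ δ γ m := by
  have hc0 : 0 < c_d := by linarith
  set D := c_d * (1 + c_d * (4 * c_d ^ 2 + 1)) with hD
  have hD1 : 1 ≤ D := by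
    rw [hD]; nlinarith [sq_nonneg c_d, mul_pos hc0 hc0]
  have hD0 : 0 < D := by linarith
  -- With this `δ` the drift `2 c_d² D δ` of the ancestors equals `1 / (8 c_d)`. An ordinary center,
  -- with reserved radius `1 / (2 c_d)`, then keeps the inner radius `c₀ = 1 / (8 c_d²)`; a favoured
  -- one, with reserved radius `4 c_d²`, keeps `2 c_d`.
  set δ := 1 / (16 * c_d ^ 3 * D) with hδ
  have hδ0 : 0 < δ := by positivity
  have hcd2 : 1 ≤ c_d ^ 2 := one_le_pow₀ hcd
  have hδ16 : 16 * c_d ^ 3 * D * δ = 1 := by rw [hδ]; field_simp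
  have hδle : c_d * δ ≤ 1 / 16 := by
    have : 16 * (c_d * δ) * (c_d ^ 2 * D) = 1 := by rw [← hδ16]; ring
    have h2 : 1 ≤ c_d ^ 2 * D := by nlinarith
    nlinarith [mul_pos hc0 hδ0]
  have hDδ : c_d ^ 2 * D * δ ≤ 1 / 16 := by
    have : 16 * (c_d ^ 2 * D * δ) * c_d = 1 := by rw [← hδ16]; ring
    have : 0 < c_d ^ 2 * D * δ := by positivity
    nlinarith
  have hδ1 : δ < 1 := by nlinarith
  set Λ := 8 * c_d ^ 3 with hΛ
  obtain ⟨n, hn⟩ := pow_unbounded_of_one_lt (c_d * (Λ + c_d * (Λ + 1)) * (2 * c_d))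
    (one_lt_two : (1 : ℝ) < 2)
  obtain ⟨M, hM⟩ := exists_nat_gt (c_μ ^ n)
  refine ⟨1 / (8 * c_d ^ 2), 2 * c_d * D, δ, 2 * c_d * (2 * c_d * D) / δ, M + 1, by linarith,
    fun S _ d μ hS => ⟨by positivity, ?_, hδ0, hδ1, ?_, ?_⟩⟩
  · rw [div_le_iff₀ (by positivity)]
    have : 1 ≤ c_d * D := by nlinarith
    nlinarith
  · rw [le_div_iff₀ hδ0]
    have : 1 ≤ c_d * c_d * D := by nlinarith
    nlinarith
  rcases isEmpty_or_nonempty S with hempty | hne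
  · refine ⟨fun _ => ⟨fun _ => ∅, fun _ _ => ∅, ?_, ?_, ?_, ?_, ?_, ?_⟩, fun s => ?_⟩
    any_goals simp
    · exact Subsingleton.elim _ _
    · exact (hempty.false s).elim
  choose N _ hNsep hNmax using fun k : ℤ =>
    hS.exists_maximal_separated Set.univ (zpow_pos hδ0 k)
  have hcol := fun k : ℤ => hS.exists_coloring (N k) (R := Λ * δ ^ k)
    (mul_pos (by positivity) (zpow_pos hδ0 k)) M (by
      intro x F hF
      have h := hS.card_separated_le hcd (zpow_pos hδ0 k) (by positivity : 0 < Λ) n hn.le x F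
        (fun y hy z hz => hNsep k y (hF y hy).1 z (hF z hz).1) fun y hy => (hF y hy).2
      rw [← ENNReal.ofReal_pow (by linarith), ← ENNReal.ofReal_natCast,
        ENNReal.ofReal_le_ofReal_iff (by positivity)] at h
      exact_mod_cast (h.trans hM.le))
  choose A hAN hAsep hAcov using hcol
  choose C par hCN hmeas hparC hpar hnear hAball using fun (k : ℤ) (i : Fin (M + 1)) =>
    hS.exists_parent_map hcd (zpow_pos hδ0 k) (hNsep k) (fun x => hNmax k x trivial)
      (hAN k i) (hAsep k i)
  have hsys := fun i : Fin (M + 1) => hS.exists_dyadicSystem hcd (c₀ := 1 / (8 * c_d ^ 2))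
    (c₁ := 1 / (2 * c_d)) hδ0 hD0 (by linarith) (by
      have e1 : c_d * (2 * c_d * D * δ + 1 / (8 * c_d ^ 2)) =
        2 * (c_d ^ 2 * D * δ) + 1 / (8 * c_d) := by field_simp
      have e2 : 2 * (c_d ^ 2 * D * δ) = 1 / (8 * c_d) := by
        rw [hδ]; field_simp; norm_num
      rw [e1, e2]
      have : 1 / (8 * c_d) + 1 / (8 * c_d) = 1 / (4 * c_d) := by field_simp; norm_num
      rw [this]
      exact one_div_le_one_div_of_le (by positivity) (by linarith))
    (C := fun k => C k i) (par := fun k => par k i)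
    (fun k y hy z hz => hNsep k y (hCN k i hy) z (hCN k i hz)) (fun k => hmeas k i)
    (fun k => hparC k i) (fun k => hpar k i) (fun k => hnear k i)
  choose 𝒟 h𝒟 using hsys
  refine ⟨𝒟, fun s ρ hρ => ?_⟩
  -- The generation `k` is fixed by `δ ^ (k + 1) < ρ ≤ δ ^ k`. The lower bound on `ρ` controls the
  -- diameter of the cube, and produces the factor `1 / δ` in `γ`.
  obtain ⟨j, hj1, hj2⟩ := exists_mem_Ioc_zpow hρ (one_lt_inv_iff₀.2 ⟨hδ0, hδ1⟩)
  set k : ℤ := -(j + 1) with hk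
  have hk1 : ρ ≤ δ ^ k := by rw [hk, zpow_neg, ← inv_zpow]; exact hj2
  have hk2 : δ ^ k * δ < ρ := by
    rw [← zpow_add_one₀ hδ0.ne', hk, show -(j + 1) + 1 = -j by ring, zpow_neg, ← inv_zpow]
    exact hj1
  obtain ⟨z, hz, hsz⟩ := hNmax k s trivial
  obtain ⟨i, hi⟩ := hAcov k z hz
  -- In the system of its own colour, the cube of `z` contains `B(z, 2 c_d δ ^ k)`, hence also `B(s,
  -- ρ)`.
  obtain ⟨hzc, hzb⟩ := h𝒟 i k z (4 * c_d ^ 2) (2 * c_d) (by positivity)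
    (by nlinarith) (hAball k i z hi).2
  have hδk : 0 < δ ^ k := zpow_pos hδ0 k
  refine ⟨i, k, z, hzc, ?_, ?_⟩
  · refine (hS.qBall_subset_qBall hcd ?_).trans hzb
    rw [hS.symm]
    calc c_d * (d s z + ρ) ≤ c_d * (δ ^ k + δ ^ k) := by gcongr
      _ = 2 * c_d * δ ^ k := by ring
  · intro a ha b hb
    have ha' := (𝒟 i).subset_ball k z hzc ha
    have hb' := (𝒟 i).subset_ball k z hzc hb
    rw [mem_qBall_iff] at ha' hb'
    rw [hS.symm] at ha'
    have h1 := hS.quasi_triangle a b z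
    calc d a b ≤ c_d * (d a z + d z b) := h1
      _ ≤ c_d * (2 * c_d * D * δ ^ k + 2 * c_d * D * δ ^ k) := by gcongr
      _ = 2 * c_d * (2 * c_d * D) / δ * (δ ^ k * δ) := by field_simp; ring
      _ ≤ 2 * c_d * (2 * c_d * D) / δ * ρ := by gcongr

end AdjacentSystems

/-! ### Doob's inequality and the Carleson embedding for nested families. -/

section LaminarMaximal

variable {S : Type u} [MeasurableSpace S] {ι : Type v}

/-- A finite family of sets that are pairwise nested or disjoint has a disjoint subfamily with the
same union. -/
theorem exists_pairwiseDisjoint_biUnion_eq (J : Finset ι) (P : ι → Set S)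
    (hlam : ∀ i ∈ J, ∀ j ∈ J, Disjoint (P i) (P j) ∨ P i ⊆ P j ∨ P j ⊆ P i) :
    ∃ J' ⊆ J, (J' : Set ι).PairwiseDisjoint P ∧ ⋃ i ∈ J', P i = ⋃ i ∈ J, P i := by
  classical
  induction J using Finset.induction with
  | empty => exact ⟨∅, subset_rfl, by simp, rfl⟩
  | insert a J ha ih =>
    obtain ⟨J', hJ', hdis, hun⟩ := ih fun i hi j hj =>
      hlam i (Finset.mem_insert_of_mem hi) j (Finset.mem_insert_of_mem hj)
    by_cases hex : ∃ j ∈ J, P a ⊆ P j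
    · obtain ⟨j, hj, haj⟩ := hex
      refine ⟨J', hJ'.trans (Finset.subset_insert a J), hdis, ?_⟩
      rw [hun, Finset.set_biUnion_insert, Set.union_eq_self_of_subset_left]
      exact haj.trans (Set.subset_biUnion_of_mem (u := fun i => P i) hj)
    · push Not at hex
      refine ⟨insert a (J'.filter fun j => Disjoint (P j) (P a)), ?_, ?_, ?_⟩
      · exact Finset.insert_subset_insert a ((Finset.filter_subset _ _).trans hJ')
      · rw [Finset.coe_insert]
        refine Set.PairwiseDisjoint.insert (hdis.subset (Finset.coe_subset.2 (Finset.filter_subset _ _))) ?_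
        intro j hj _
        exact (Finset.mem_filter.1 hj).2.symm
      · rw [Finset.set_biUnion_insert, Finset.set_biUnion_insert, ← hun]
        apply subset_antisymm
        · apply Set.union_subset_union_right
          exact Set.biUnion_subset_biUnion_left (Finset.filter_subset _ _)
        · apply Set.union_subset Set.subset_union_left
          refine Set.iUnion₂_subset fun j hj => ?_
          rcases hlam j (Finset.mem_insert_of_mem (hJ' hj)) a (Finset.mem_insert_self a J)
            with h | h | h
          · exact (Set.subset_biUnion_of_mem (u := fun i => P i)
              (Finset.mem_filter.2 ⟨hj, h⟩)).trans Set.subset_union_right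
          · exact h.trans Set.subset_union_left
          · exact absurd h (hex j (hJ' hj))

/-- The weak-type estimate behind Doob's inequality. The maximal sets of the family are disjoint and
have the same union, so no covering constant is lost. -/
theorem measure_biUnion_le_of_laminar (J : Finset ι) (P : ι → Set S)
    (hP : ∀ i ∈ J, MeasurableSet (P i))
    (hlam : ∀ i ∈ J, ∀ j ∈ J, Disjoint (P i) (P j) ∨ P i ⊆ P j ∨ P j ⊆ P i)
    (ν κ : Measure S) (t : ℝ≥0∞) (h : ∀ i ∈ J, t * ν (P i) ≤ κ (P i)) :
    t * ν (⋃ i ∈ J, P i) ≤ κ (⋃ i ∈ J, P i) := by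
  obtain ⟨J', hJ', hdis, hun⟩ := exists_pairwiseDisjoint_biUnion_eq J P hlam
  rw [← hun, measure_biUnion_finset hdis fun i hi => hP i (hJ' hi),
    measure_biUnion_finset hdis fun i hi => hP i (hJ' hi), Finset.mul_sum]
  exact Finset.sum_le_sum fun i hi => h i (hJ' hi)

/-- Absorption: division by `I ^ (1 - 1 / s)`, for which `I` has to be known finite. It closes both
Doob's inequality and the weighted sparse bound. -/
theorem ENNReal.le_rpow_of_le_mul_rpow {I c : ℝ≥0∞} {s : ℝ} (hs : 0 < s) (hI : I ≠ ∞)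
    (h : I ≤ c * I ^ (1 - 1 / s)) : I ≤ c ^ s := by
  rcases eq_or_ne I 0 with rfl | h0
  · simp
  have h1 : I ^ (1 / s) ≤ c := by
    have h2 : I = I ^ (1 / s) * I ^ (1 - 1 / s) := by
      rw [← ENNReal.rpow_add _ _ h0 hI]; simp
    have h3 : I ^ (1 - 1 / s) ≠ 0 := (ENNReal.rpow_pos (pos_iff_ne_zero.2 h0) hI).ne'
    have h4 : I ^ (1 - 1 / s) ≠ ∞ := by
      intro h; rw [ENNReal.rpow_eq_top_iff] at h; tauto
    nth_rewrite 1 [h2] at h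
    exact (ENNReal.mul_le_mul_iff_left h3 h4).1 h
  calc I = (I ^ (1 / s)) ^ s := by
        rw [← ENNReal.rpow_mul, one_div_mul_cancel hs.ne', ENNReal.rpow_one]
    _ ≤ c ^ s := ENNReal.rpow_le_rpow h1 hs.le

/-- Doob's maximal inequality for finite families of sets that are pairwise nested or disjoint. -/
theorem lintegral_laminar_maximal_le (J : Finset ι) (P : ι → Set S)
    (hP : ∀ i ∈ J, MeasurableSet (P i))
    (hlam : ∀ i ∈ J, ∀ j ∈ J, Disjoint (P i) (P j) ∨ P i ⊆ P j ∨ P j ⊆ P i)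
    (ν : Measure S) (hν : ∀ i ∈ J, ν (P i) ≠ ∞) {h : S → ℝ≥0∞} (hh : Measurable h)
    (a : ι → ℝ≥0) (ha : ∀ i ∈ J, a i * ν (P i) ≤ ∫⁻ x in P i, h x ∂ν) {q : ℝ} (hq : 1 < q) :
    ∫⁻ x, ((J.sup fun i => (P i).indicator (fun _ => a i) x : ℝ≥0) : ℝ≥0∞) ^ q ∂ν ≤
      ENNReal.ofReal (q / (q - 1)) ^ q * ∫⁻ x, h x ^ q ∂ν := by
  have hq0 : 0 < q := by linarith
  set M : S → ℝ≥0 := fun x => J.sup fun i => (P i).indicator (fun _ => a i) x with hM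
  set κ := ν.withDensity h with hκ
  have hMmeas : Measurable M := by
    have : M = J.sup fun i => (P i).indicator (fun _ => a i) := by
      ext x; simp [hM, Finset.sup_apply]
    rw [this]
    exact Finset.sup_induction (p := Measurable) measurable_const (fun _ h _ h' => h.sup h')
      fun i hi => measurable_const.indicator (hP i hi)
  have hMreal : Measurable fun x => (M x : ℝ) := hMmeas.coe_nnreal_real
  have hrpow : ∀ (x : S) (p : ℝ), 0 ≤ p →
      ENNReal.ofReal ((M x : ℝ) ^ p) = (M x : ℝ≥0∞) ^ p := by
    intro x p hp
    rw [← ENNReal.ofReal_rpow_of_nonneg (NNReal.coe_nonneg (M x)) hp]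
    simp
  -- The level set is the union of those `P i` with `t < a i`, and each of these satisfies `t ν (P
  -- i) ≤ κ (P i)`.
  have hlevel : ∀ t : ℝ, 0 < t → ENNReal.ofReal t * ν {x | t < (M x : ℝ)} ≤
      κ {x | t < (M x : ℝ)} := by
    intro t ht
    classical
    have hset : {x | t < (M x : ℝ)} = ⋃ i ∈ J.filter (fun i => t < (a i : ℝ)), P i := by
      ext x
      have h0 : t < (M x : ℝ) ↔ t.toNNReal < M x := by
        rw [Real.toNNReal_lt_iff_lt_coe ht.le]
      rw [Set.mem_ofPred_eq, h0, hM]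
      simp only [Finset.lt_sup_iff, Set.mem_iUnion, Finset.mem_filter, exists_prop]
      constructor
      · rintro ⟨i, hi, hlt⟩
        by_cases hx : x ∈ P i
        · rw [Set.indicator_of_mem hx, Real.toNNReal_lt_iff_lt_coe ht.le] at hlt
          exact ⟨i, ⟨hi, hlt⟩, hx⟩
        · rw [Set.indicator_of_notMem hx] at hlt
          exact absurd hlt not_lt_zero
      · rintro ⟨i, ⟨hi, hlt⟩, hx⟩
        refine ⟨i, hi, ?_⟩
        rw [Set.indicator_of_mem hx, Real.toNNReal_lt_iff_lt_coe ht.le]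
        exact hlt
    rw [hset]
    have hsub : ∀ i ∈ J.filter (fun i => t < (a i : ℝ)), i ∈ J := fun i hi =>
      (Finset.mem_filter.1 hi).1
    refine measure_biUnion_le_of_laminar _ P (fun i hi => hP i (hsub i hi))
      (fun i hi j hj => hlam i (hsub i hi) j (hsub j hj)) ν κ _ fun i hi => ?_
    rw [hκ, withDensity_apply _ (hP i (hsub i hi))]
    refine le_trans ?_ (ha i (hsub i hi))
    gcongr
    have := (Finset.mem_filter.1 hi).2
    rw [ENNReal.ofReal_le_iff_le_toReal ENNReal.coe_ne_top]
    exact this.le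
  -- The layer-cake formula for `ν` with exponent `q` is compared with the one for `κ` with exponent
  -- `q - 1`; the ratio of their prefactors is `q / (q - 1)`.
  have hlayer : ∫⁻ x, (M x : ℝ≥0∞) ^ q ∂ν ≤
      ENNReal.ofReal (q / (q - 1)) * ∫⁻ x, (M x : ℝ≥0∞) ^ (q - 1) ∂κ := by
    have e1 := lintegral_rpow_eq_lintegral_meas_lt_mul ν (f := fun x => (M x : ℝ))
      (Eventually.of_forall fun x => (M x).2) hMreal.aemeasurable hq0
    have e2 := lintegral_rpow_eq_lintegral_meas_lt_mul κ (f := fun x => (M x : ℝ))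
      (Eventually.of_forall fun x => (M x).2) hMreal.aemeasurable (p := q - 1) (by linarith)
    simp only [hrpow _ _ hq0.le] at e1
    simp only [hrpow _ (q - 1) (by linarith)] at e2
    rw [e1, e2, ← mul_assoc, ← ENNReal.ofReal_mul (by apply div_nonneg <;> linarith),
      div_mul_cancel₀ _ (by linarith)]
    gcongr ENNReal.ofReal q * ?_
    apply setLIntegral_mono_ae' measurableSet_Ioi
    refine Eventually.of_forall fun t ht => ?_
    have ht' : 0 < t := ht
    calc ν {x | t < (M x : ℝ)} * ENNReal.ofReal (t ^ (q - 1))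
        = ENNReal.ofReal t * ν {x | t < (M x : ℝ)} * ENNReal.ofReal (t ^ (q - 1 - 1)) := by
          have : t ^ (q - 1) = t * t ^ (q - 1 - 1) := by
            rw [Real.rpow_sub_one ht'.ne' (q - 1)]; field_simp
          rw [this, ENNReal.ofReal_mul ht'.le]; ring
      _ ≤ _ := by gcongr; exact hlevel t ht'
  have hHolder : ∫⁻ x, (M x : ℝ≥0∞) ^ (q - 1) ∂κ ≤
      (∫⁻ x, h x ^ q ∂ν) ^ (1 / q) * (∫⁻ x, (M x : ℝ≥0∞) ^ q ∂ν) ^ (1 - 1 / q) := by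
    have hconj : q.HolderConjugate (q / (q - 1)) := Real.HolderConjugate.conjExponent hq
    rw [hκ, lintegral_withDensity_eq_lintegral_mul ν hh (hMmeas.coe_nnreal_ennreal.pow_const _)]
    refine (ENNReal.lintegral_mul_le_Lp_mul_Lq ν hconj hh.aemeasurable
      (hMmeas.coe_nnreal_ennreal.pow_const _).aemeasurable).trans (le_of_eq ?_)
    have e3 : 1 / (q / (q - 1)) = 1 - 1 / q := by field_simp
    rw [e3]
    congr 3
    funext x
    rw [← ENNReal.rpow_mul]
    congr 1
    have : q - 1 ≠ 0 := by linarith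
    field_simp
  have hfinite : ∫⁻ x, (M x : ℝ≥0∞) ^ q ∂ν ≠ ∞ := by
    have hle : ∀ x, (M x : ℝ≥0∞) ^ q ≤
        ∑ i ∈ J, (P i).indicator (fun _ => (a i : ℝ≥0∞) ^ q) x := by
      intro x
      rcases J.eq_empty_or_nonempty with rfl | hne
      · simp [hM, hq0]
      obtain ⟨i, hi, hieq⟩ := Finset.exists_mem_eq_sup J hne
        (fun i => (P i).indicator (fun _ => a i) x)
      have : (M x : ℝ≥0∞) ^ q = (P i).indicator (fun _ => (a i : ℝ≥0∞) ^ q) x := by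
        simp only [hM]
        rw [hieq]
        by_cases hx : x ∈ P i <;> simp [hx, hq0]
      rw [this]
      exact Finset.single_le_sum (f := fun i => (P i).indicator (fun _ => (a i : ℝ≥0∞) ^ q) x)
        (fun _ _ => zero_le) hi
    refine ne_top_of_le_ne_top ?_ (lintegral_mono hle)
    rw [lintegral_finsetSum' _ fun i hi =>
      (measurable_const.indicator (hP i hi)).aemeasurable]
    refine ENNReal.sum_ne_top.2 fun i hi => ?_
    rw [lintegral_indicator_const (hP i hi)]
    exact ENNReal.mul_ne_top (ENNReal.rpow_ne_top_of_nonneg hq0.le ENNReal.coe_ne_top) (hν i hi)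
  have hfin := ENNReal.le_rpow_of_le_mul_rpow hq0 hfinite
    (c := ENNReal.ofReal (q / (q - 1)) * (∫⁻ x, h x ^ q ∂ν) ^ (1 / q))
    (by rw [mul_assoc]; exact hlayer.trans (by gcongr))
  refine hfin.trans (le_of_eq ?_)
  rw [ENNReal.mul_rpow_of_nonneg _ _ hq0.le, ← ENNReal.rpow_mul, one_div_mul_cancel hq0.ne',
    ENNReal.rpow_one]

/-- The Carleson embedding that follows from Doob's maximal inequality. -/
theorem sum_rpow_mul_measure_le (J : Finset ι) (P E : ι → Set S)
    (hP : ∀ i ∈ J, MeasurableSet (P i)) (hE : ∀ i ∈ J, MeasurableSet (E i))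
    (hEP : ∀ i ∈ J, E i ⊆ P i) (hdis : (J : Set ι).PairwiseDisjoint E)
    (hlam : ∀ i ∈ J, ∀ j ∈ J, Disjoint (P i) (P j) ∨ P i ⊆ P j ∨ P j ⊆ P i)
    (ν : Measure S) (hν : ∀ i ∈ J, ν (P i) ≠ ∞) {h : S → ℝ≥0∞} (hh : Measurable h)
    (a : ι → ℝ≥0) (ha : ∀ i ∈ J, a i * ν (P i) ≤ ∫⁻ x in P i, h x ∂ν) {q : ℝ} (hq : 1 < q) :
    ∑ i ∈ J, (a i : ℝ≥0∞) ^ q * ν (E i) ≤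
      ENNReal.ofReal (q / (q - 1)) ^ q * ∫⁻ x, h x ^ q ∂ν := by
  refine le_trans ?_ (lintegral_laminar_maximal_le J P hP hlam ν hν hh a ha hq)
  calc ∑ i ∈ J, (a i : ℝ≥0∞) ^ q * ν (E i)
      ≤ ∑ i ∈ J, ∫⁻ x in E i,
        ((J.sup fun i => (P i).indicator (fun _ => a i) x : ℝ≥0) : ℝ≥0∞) ^ q ∂ν := by
        refine Finset.sum_le_sum fun i hi => ?_
        rw [← setLIntegral_const]
        refine setLIntegral_mono_ae' (hE i hi) (Eventually.of_forall fun x hx => ?_)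
        gcongr
        refine le_trans (le_of_eq ?_)
          (Finset.le_sup (f := fun i => (P i).indicator (fun _ => a i) x) hi)
        simp [hEP i hi hx]
    _ = ∫⁻ x in ⋃ i ∈ J, E i,
        ((J.sup fun i => (P i).indicator (fun _ => a i) x : ℝ≥0) : ℝ≥0∞) ^ q ∂ν :=
        (lintegral_biUnion_finset hdis hE _).symm
    _ ≤ _ := setLIntegral_le_lintegral _ _

end LaminarMaximal

/-! ### The weighted estimate for sparse sums within one dyadic system. -/

section WeightedSparse

/-- Here `m, W, s` stand for the measures `μ, w, σ` of a cube and `e, we, se` for those of its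
sparse part. The `A_q` condition is spent once, on `W s ^ (q - 1)`. What remains is moved to the
sparse part by sparseness, by Hölder's inequality `h3`, and by `se ≤ s` with the exponent `-(q - 1 -
ρ)`, whose sign is where `ρ ≤ q - 1` enters. -/
theorem muckenhoupt_exponent_le {m e W s we se A C q ρ : ℝ} (hm : 0 < m) (he : 0 < e) (hW : 0 < W)
    (hs : 0 < s) (hwe : 0 < we) (hse : 0 < se) (hA : 0 ≤ A) (hC : 0 ≤ C)
    (hq : 1 < q) (hρq : ρ ≤ q - 1) (h1 : W * s ^ (q - 1) ≤ A * m ^ q)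
    (h2 : m ≤ C * e) (h3 : e ^ q ≤ we * se ^ (q - 1)) (h4 : se ≤ s) :
    (s / m) ^ ρ * W ≤ A * C ^ (q - ρ) * (we ^ (1 - ρ / q) * se ^ (ρ / q)) := by
  have hq0 : 0 < q := by linarith
  have hqρ : 0 < q - ρ := by linarith
  have e1 : (s / m) ^ ρ * W = (W * s ^ (q - 1)) * (m ^ (-ρ) * s ^ (-(q - 1 - ρ))) := by
    rw [Real.div_rpow hs.le hm.le, Real.rpow_neg hm.le,
      show -(q - 1 - ρ) = ρ - (q - 1) by ring, Real.rpow_sub hs ρ (q - 1)]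
    have : s ^ (q - 1) ≠ 0 := (Real.rpow_pos_of_pos hs _).ne'
    field_simp
  have e2 : e ^ (q - ρ) ≤ we ^ (1 - ρ / q) * se ^ ((q - 1) * (1 - ρ / q)) := by
    have := Real.rpow_le_rpow (Real.rpow_nonneg he.le _) h3
      (show 0 ≤ 1 - ρ / q by rw [sub_nonneg, div_le_one hq0]; linarith)
    rw [← Real.rpow_mul he.le, Real.mul_rpow hwe.le (Real.rpow_nonneg hse.le _),
      ← Real.rpow_mul hse.le] at this
    rwa [show q * (1 - ρ / q) = q - ρ by field_simp] at this
  have e3 : s ^ (-(q - 1 - ρ)) ≤ se ^ (-(q - 1 - ρ)) :=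
    Real.rpow_le_rpow_of_nonpos hse h4 (by linarith)
  have e4 : m ^ (q - ρ) ≤ C ^ (q - ρ) * e ^ (q - ρ) := by
    rw [← Real.mul_rpow hC he.le]
    exact Real.rpow_le_rpow hm.le h2 hqρ.le
  calc (s / m) ^ ρ * W = (W * s ^ (q - 1)) * (m ^ (-ρ) * s ^ (-(q - 1 - ρ))) := e1
    _ ≤ (A * m ^ q) * (m ^ (-ρ) * s ^ (-(q - 1 - ρ))) := by gcongr
    _ = A * m ^ (q - ρ) * s ^ (-(q - 1 - ρ)) := by
        rw [sub_eq_add_neg q ρ, Real.rpow_add hm]; ring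
    _ ≤ A * (C ^ (q - ρ) * (we ^ (1 - ρ / q) * se ^ ((q - 1) * (1 - ρ / q)))) *
          se ^ (-(q - 1 - ρ)) := by
        gcongr
        exact e4.trans (by gcongr)
    _ = A * C ^ (q - ρ) * (we ^ (1 - ρ / q) *
          (se ^ ((q - 1) * (1 - ρ / q)) * se ^ (-(q - 1 - ρ)))) := by ring
    _ = _ := by
        rw [← Real.rpow_add hse]
        congr 3
        field_simp
        ring

/-- One term of the sparse sum is split for Hölder's inequality: `b m / s` is a mean with respect to
`σ` and `Φ / W` one with respect to `w`. Each comes with the power of the measure of the sparse part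
that the matching Carleson embedding needs. -/
theorem muckenhoupt_exponent_mul_le {m e W s we se A C b Φ : ℝ≥0} {q ρ : ℝ} (hm : 0 < m)
    (he : 0 < e) (hW : 0 < W) (hs : 0 < s) (hwe : 0 < we) (hse : 0 < se)
    (hq : 1 < q) (hρq : ρ ≤ q - 1) (h1 : W * s ^ (q - 1) ≤ A * m ^ q)
    (h2 : m ≤ C * e) (h3 : e ^ q ≤ we * se ^ (q - 1)) (h4 : se ≤ s) :
    b ^ ρ * Φ ≤ A * C ^ (q - ρ) *
      (((b * m / s) ^ ρ * se ^ (ρ / q)) * ((Φ / W) * we ^ (1 - ρ / q))) := by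
  have key : (s / m) ^ ρ * W ≤ A * C ^ (q - ρ) * (we ^ (1 - ρ / q) * se ^ (ρ / q)) := by
    have := muckenhoupt_exponent_le (m := m) (e := e) (W := W) (s := s) (we := we) (se := se)
      (A := A) (C := C) (by exact_mod_cast hm) (by exact_mod_cast he) (by exact_mod_cast hW)
      (by exact_mod_cast hs) (by exact_mod_cast hwe) (by exact_mod_cast hse) A.2 C.2 hq hρq
      (by exact_mod_cast h1) (by exact_mod_cast h2) (by exact_mod_cast h3) (by exact_mod_cast h4)
    exact_mod_cast this
  calc b ^ ρ * Φ = ((b * m / s) ^ ρ * (Φ / W)) * ((s / m) ^ ρ * W) := by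
        have : b ^ ρ = (b * m / s) ^ ρ * (s / m) ^ ρ := by
          rw [← NNReal.mul_rpow]; congr 1; field_simp
        rw [this]; field_simp
    _ ≤ ((b * m / s) ^ ρ * (Φ / W)) *
        (A * C ^ (q - ρ) * (we ^ (1 - ρ / q) * se ^ (ρ / q))) := by gcongr
    _ = _ := by ring

variable {S : Type u} [MeasurableSpace S] {ι : Type v}

/-- The dual weight. -/
noncomputable def dualWeight (q : ℝ) (w : S → ℝ≥0∞) : S → ℝ≥0∞ := fun x => w x ^ (-(1 / (q - 1)))

theorem dualWeight_rpow {q : ℝ} (hq : 1 < q) {w : S → ℝ≥0∞} (x : S) :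
    dualWeight q w x ^ (1 - q) = w x := by
  rw [dualWeight, ← ENNReal.rpow_mul]
  have : -(1 / (q - 1)) * (1 - q) = 1 := by
    have : q - 1 ≠ 0 := by linarith
    field_simp
    ring
  rw [this, ENNReal.rpow_one]

/-- Hölder's inequality for `g w ^ (1 / q)` and `w ^ (-1 / q)`. With `g = 1` it compares the
measures of a sparse set; with `g` a power of a norm it gives local integrability. -/
theorem setLIntegral_rpow_le_dualWeight (μ : Measure S) {w : S → ℝ≥0∞} (hw : Measurable w)
    (hw0 : ∀ x, w x ≠ 0) (hwt : ∀ x, w x ≠ ∞) {q : ℝ} (hq : 1 < q) {g : S → ℝ≥0∞}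
    (hg : Measurable g) (E : Set S) :
    (∫⁻ x in E, g x ∂μ) ^ q ≤
      (∫⁻ x in E, g x ^ q * w x ∂μ) * (∫⁻ x in E, dualWeight q w x ∂μ) ^ (q - 1) := by
  have hq0 : 0 < q := by linarith
  have hconj : q.HolderConjugate (q / (q - 1)) := Real.HolderConjugate.conjExponent hq
  have h := ENNReal.lintegral_mul_le_Lp_mul_Lq (μ.restrict E) hconj
    (hg.mul (hw.pow_const (1 / q))).aemeasurable
    (hw.pow_const (-(1 / q))).aemeasurable
  have e1 : ∀ x, ((g * fun x => w x ^ (1 / q)) * fun x => w x ^ (-(1 / q))) x = g x := by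
    intro x
    rw [Pi.mul_apply, Pi.mul_apply, mul_assoc, ← ENNReal.rpow_add _ _ (hw0 x) (hwt x)]
    simp
  have e2 : ∀ x, (g * fun x => w x ^ (1 / q)) x ^ q = g x ^ q * w x := by
    intro x
    rw [Pi.mul_apply, ENNReal.mul_rpow_of_nonneg _ _ hq0.le, ← ENNReal.rpow_mul,
      one_div_mul_cancel hq0.ne', ENNReal.rpow_one]
  have e3 : ∀ x, (w x ^ (-(1 / q))) ^ (q / (q - 1)) = dualWeight q w x := by
    intro x
    rw [dualWeight, ← ENNReal.rpow_mul]
    congr 1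
    have : q - 1 ≠ 0 := by linarith
    field_simp
  simp only [e1, e2, e3] at h
  calc (∫⁻ x in E, g x ∂μ) ^ q ≤ ((∫⁻ x in E, g x ^ q * w x ∂μ) ^ (1 / q) *
        (∫⁻ x in E, dualWeight q w x ∂μ) ^ (1 / (q / (q - 1)))) ^ q := by gcongr
    _ = _ := by
        rw [ENNReal.mul_rpow_of_nonneg _ _ hq0.le, ← ENNReal.rpow_mul, ← ENNReal.rpow_mul,
          one_div_mul_cancel hq0.ne', ENNReal.rpow_one]
        congr 2
        field_simp

theorem measure_rpow_le_dualWeight (μ : Measure S) {w : S → ℝ≥0∞} (hw : Measurable w)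
    (hw0 : ∀ x, w x ≠ 0) (hwt : ∀ x, w x ≠ ∞) {q : ℝ} (hq : 1 < q) (E : Set S) :
    μ E ^ q ≤ (∫⁻ x in E, w x ∂μ) * (∫⁻ x in E, dualWeight q w x ∂μ) ^ (q - 1) := by
  simpa using setLIntegral_rpow_le_dualWeight μ hw hw0 hwt hq (measurable_const (a := 1)) E

theorem setLIntegral_pos_of_pos (μ : Measure S) {w : S → ℝ≥0∞} (hw : Measurable w)
    (hw0 : ∀ x, w x ≠ 0) {E : Set S} (hE : μ E ≠ 0) : ∫⁻ x in E, w x ∂μ ≠ 0 := by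
  intro h
  rw [lintegral_eq_zero_iff hw] at h
  have h1 : ∀ᵐ x ∂(μ.restrict E), False := by
    filter_upwards [h] with x hx using hw0 x hx
  rw [eventually_false_iff_eq_bot, ae_eq_bot, Measure.restrict_eq_zero] at h1
  exact hE h1

/-- The weighted bound for the sums `∑ b_i^ρ 1_{P_i}` over sparse families of one dyadic system,
where `b_i` is dominated by the mean of `g` over `P_i`. -/
theorem lintegral_sparse_le (J : Finset ι) (P E : ι → Set S)
    (hP : ∀ i ∈ J, MeasurableSet (P i)) (hE : ∀ i ∈ J, MeasurableSet (E i))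
    (hEP : ∀ i ∈ J, E i ⊆ P i) (hdis : (J : Set ι).PairwiseDisjoint E)
    (hlam : ∀ i ∈ J, ∀ j ∈ J, Disjoint (P i) (P j) ∨ P i ⊆ P j ∨ P j ⊆ P i)
    (μ : Measure S) {w : S → ℝ≥0∞} (hw : Measurable w) (hw0 : ∀ x, w x ≠ 0) (hwt : ∀ x, w x ≠ ∞)
    {q ρ : ℝ} (hq : 1 < q) (hρ : 0 < ρ) (hρq : ρ ≤ q - 1) (A C : ℝ≥0)
    (hμ0 : ∀ i ∈ J, μ (P i) ≠ 0) (hμt : ∀ i ∈ J, μ (P i) ≠ ∞)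
    (hC : ∀ i ∈ J, μ (P i) ≤ C * μ (E i))
    (hA : ∀ i ∈ J, (∫⁻ x in P i, w x ∂μ) * (∫⁻ x in P i, dualWeight q w x ∂μ) ^ (q - 1) ≤
      A * μ (P i) ^ q)
    {g : S → ℝ≥0∞} (hg : Measurable g) (b : ι → ℝ≥0)
    (hb : ∀ i ∈ J, b i * μ (P i) ≤ ∫⁻ x in P i, g x ∂μ) :
    ∫⁻ x, (∑ i ∈ J, (P i).indicator (fun _ => (b i : ℝ≥0∞) ^ ρ) x) ^ (q / ρ) * w x ∂μ ≤
      ((C : ℝ≥0∞) ^ (q - ρ) * ENNReal.ofReal (q / (q - 1)) ^ ρ * ENNReal.ofReal (q / ρ)) ^ (q / ρ) *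
        (A : ℝ≥0∞) ^ (q / ρ) * ∫⁻ x, g x ^ q * w x ∂μ := by
  have hq0 : 0 < q := by linarith
  set s := q / ρ with hs
  have hs1 : 1 < s := by rw [hs, one_lt_div hρ]; linarith
  have hs0 : 0 < s := by linarith
  set s' := s / (s - 1) with hs'
  have hconj : s.HolderConjugate s' := Real.HolderConjugate.conjExponent hs1
  set σ := dualWeight q w with hσ
  have hσm : Measurable σ := hw.pow_const _
  have hσ0 : ∀ x, σ x ≠ 0 := fun x =>
    (ENNReal.rpow_pos (pos_iff_ne_zero.2 (hw0 x)) (hwt x)).ne'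
  have hσt : ∀ x, σ x ≠ ∞ := by
    intro x h
    rw [hσ, dualWeight, ENNReal.rpow_eq_top_iff] at h
    rcases h with h | h
    · exact hw0 x h.1
    · exact hwt x h.1
  set F : S → ℝ≥0∞ := fun x => ∑ i ∈ J, (P i).indicator (fun _ => (b i : ℝ≥0∞) ^ ρ) x with hF
  have hFm : Measurable F := Finset.measurable_sum _ fun i hi =>
    measurable_const.indicator (hP i hi)
  set B : ℝ≥0 := ∑ i ∈ J, b i ^ ρ with hB
  have hFB : ∀ x, F x ≤ B := by
    intro x
    rw [hB, ENNReal.ofNNReal_finsetSum]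
    refine Finset.sum_le_sum fun i _ => ?_
    rw [ENNReal.coe_rpow_of_nonneg _ hρ.le]
    exact Set.indicator_le_self' (fun _ _ => zero_le) x
  -- the weighted measures of the sets are positive and finite
  have hEne : ∀ i ∈ J, μ (E i) ≠ 0 := by
    intro i hi h
    have := hC i hi
    rw [h, mul_zero] at this
    exact hμ0 i hi (le_antisymm this zero_le)
  have hw1 : ∀ i ∈ J, ∫⁻ x in P i, w x ∂μ ≠ 0 := fun i hi =>
    setLIntegral_pos_of_pos μ hw hw0 (hμ0 i hi)
  have hσ1 : ∀ i ∈ J, ∫⁻ x in P i, σ x ∂μ ≠ 0 := fun i hi =>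
    setLIntegral_pos_of_pos μ hσm hσ0 (hμ0 i hi)
  have hAt : ∀ i ∈ J, (A : ℝ≥0∞) * μ (P i) ^ q ≠ ∞ := fun i hi =>
    ENNReal.mul_ne_top ENNReal.coe_ne_top (ENNReal.rpow_ne_top_of_nonneg hq0.le (hμt i hi))
  have hw2 : ∀ i ∈ J, ∫⁻ x in P i, w x ∂μ ≠ ∞ := by
    intro i hi h
    have := hA i hi
    rw [h, ENNReal.top_mul] at this
    · exact hAt i hi (top_le_iff.1 this)
    · rw [Ne, ENNReal.rpow_eq_zero_iff]
      rintro (⟨h0, -⟩ | ⟨-, h0⟩)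
      · exact hσ1 i hi h0
      · linarith
  have hσ2 : ∀ i ∈ J, ∫⁻ x in P i, σ x ∂μ ≠ ∞ := by
    intro i hi h
    have := hA i hi
    rw [h, ENNReal.top_rpow_of_pos (by linarith), ENNReal.mul_top (hw1 i hi)] at this
    exact hAt i hi (top_le_iff.1 this)
  set I := ∫⁻ x, F x ^ s * w x ∂μ with hI
  have hΦt : ∀ i ∈ J, ∫⁻ x in P i, F x ^ (s - 1) * w x ∂μ ≠ ∞ := by
    intro i hi
    refine ne_top_of_le_ne_top (b := (B : ℝ≥0∞) ^ (s - 1) * ∫⁻ x in P i, w x ∂μ) ?_ ?_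
    · exact ENNReal.mul_ne_top (ENNReal.rpow_ne_top_of_nonneg (by linarith) ENNReal.coe_ne_top)
        (hw2 i hi)
    · rw [← lintegral_const_mul _ hw]
      refine lintegral_mono fun x => ?_
      gcongr
      exact hFB x
  -- Writing `F ^ s = F * F ^ (s - 1)` and expanding the first factor, `F ^ (s - 1)` takes the role
  -- of the dual test function.
  have hIsum : I = ∑ i ∈ J, (b i : ℝ≥0∞) ^ ρ * ∫⁻ x in P i, F x ^ (s - 1) * w x ∂μ := by
    have e1 : ∀ x, F x ^ s * w x =
        ∑ i ∈ J, (P i).indicator (fun x => (b i : ℝ≥0∞) ^ ρ * (F x ^ (s - 1) * w x)) x := by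
      intro x
      have : F x ^ s = F x * F x ^ (s - 1) := by
        rcases eq_or_ne (F x) 0 with h | h
        · rw [h]; simp [hs0]
        · nth_rewrite 2 [← ENNReal.rpow_one (F x)]
          rw [← ENNReal.rpow_add _ _ h (ne_top_of_le_ne_top ENNReal.coe_ne_top (hFB x))]
          congr 1; ring
      rw [this, mul_assoc]
      nth_rewrite 1 [hF]
      rw [Finset.sum_mul]
      refine Finset.sum_congr rfl fun i _ => ?_
      by_cases hx : x ∈ P i <;> simp [hx]
    have hFw : Measurable fun x => F x ^ (s - 1) * w x := (hFm.pow_const _).mul hw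
    rw [hI]
    simp only [e1]
    rw [lintegral_finsetSum' _ fun i hi => ((hFw.const_mul _).indicator (hP i hi)).aemeasurable]
    refine Finset.sum_congr rfl fun i hi => ?_
    rw [lintegral_indicator (hP i hi), lintegral_const_mul _ hFw]
  have hIt : I ≠ ∞ := by
    rw [hIsum]
    exact ENNReal.sum_ne_top.2 fun i hi => ENNReal.mul_ne_top
      (ENNReal.rpow_ne_top_of_nonneg hρ.le ENNReal.coe_ne_top) (hΦt i hi)
  let m : ι → ℝ≥0 := fun i => (μ (P i)).toNNReal
  let W : ι → ℝ≥0 := fun i => (∫⁻ x in P i, w x ∂μ).toNNReal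
  let V : ι → ℝ≥0 := fun i => (∫⁻ x in P i, σ x ∂μ).toNNReal
  let Φ : ι → ℝ≥0 := fun i => (∫⁻ x in P i, F x ^ (s - 1) * w x ∂μ).toNNReal
  have hmc : ∀ i ∈ J, (m i : ℝ≥0∞) = μ (P i) := fun i hi => ENNReal.coe_toNNReal (hμt i hi)
  have hWc : ∀ i ∈ J, (W i : ℝ≥0∞) = ∫⁻ x in P i, w x ∂μ := fun i hi =>
    ENNReal.coe_toNNReal (hw2 i hi)
  have hSc : ∀ i ∈ J, (V i : ℝ≥0∞) = ∫⁻ x in P i, σ x ∂μ := fun i hi =>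
    ENNReal.coe_toNNReal (hσ2 i hi)
  have hΦc : ∀ i ∈ J, (Φ i : ℝ≥0∞) = ∫⁻ x in P i, F x ^ (s - 1) * w x ∂μ := fun i hi =>
    ENNReal.coe_toNNReal (hΦt i hi)
  have hW0 : ∀ i ∈ J, 0 < W i := fun i hi => ENNReal.toNNReal_pos (hw1 i hi) (hw2 i hi)
  have hS0 : ∀ i ∈ J, 0 < V i := fun i hi => ENNReal.toNNReal_pos (hσ1 i hi) (hσ2 i hi)
  have hm0 : ∀ i ∈ J, 0 < m i := fun i hi => ENNReal.toNNReal_pos (hμ0 i hi) (hμt i hi)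
  let a : ι → ℝ≥0 := fun i => b i * m i / V i
  let φ : ι → ℝ≥0 := fun i => Φ i / W i
  set wμ := μ.withDensity w with hwμ
  set σμ := μ.withDensity σ with hσμ
  have hterm : ∀ i ∈ J, (b i : ℝ≥0∞) ^ ρ * ∫⁻ x in P i, F x ^ (s - 1) * w x ∂μ ≤
      A * (C : ℝ≥0∞) ^ (q - ρ) * (((a i : ℝ≥0∞) ^ ρ * σμ (E i) ^ (ρ / q)) *
        ((φ i : ℝ≥0∞) * wμ (E i) ^ (1 - ρ / q))) := by
    intro i hi
    rw [hσμ, hwμ, withDensity_apply _ (hE i hi), withDensity_apply _ (hE i hi), ← hΦc i hi]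
    have hsubE : ∀ f : S → ℝ≥0∞, ∫⁻ x in E i, f x ∂μ ≤ ∫⁻ x in P i, f x ∂μ := fun f =>
      lintegral_mono_set (hEP i hi)
    have t1 : μ (E i) ≠ ∞ := ne_top_of_le_ne_top (hμt i hi) (measure_mono (hEP i hi))
    have t2 : ∫⁻ x in E i, w x ∂μ ≠ ∞ := ne_top_of_le_ne_top (hw2 i hi) (hsubE w)
    have t3 : ∫⁻ x in E i, σ x ∂μ ≠ ∞ := ne_top_of_le_ne_top (hσ2 i hi) (hsubE σ)
    have z1 := hEne i hi
    have z2 := setLIntegral_pos_of_pos μ hw hw0 z1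
    have z3 := setLIntegral_pos_of_pos μ hσm hσ0 z1
    have hHol := measure_rpow_le_dualWeight μ hw hw0 hwt hq (E i)
    have h1 := hA i hi
    have h2 := hC i hi
    have h4 := hsubE σ
    rw [← hσ] at hHol
    rw [← hWc i hi, ← hSc i hi, ← hmc i hi] at h1
    rw [← hmc i hi] at h2
    rw [← hSc i hi] at h4
    lift μ (E i) to ℝ≥0 using t1 with e he
    lift ∫⁻ x in E i, w x ∂μ to ℝ≥0 using t2 with we hwe
    lift ∫⁻ x in E i, σ x ∂μ to ℝ≥0 using t3 with se hse
    simp only [ne_eq, ENNReal.coe_eq_zero, ← pos_iff_ne_zero] at z1 z2 z3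
    have hq1 : 0 ≤ q - 1 := by linarith
    have hqρ : 0 ≤ q - ρ := by linarith
    have hρq' : 0 ≤ ρ / q := by positivity
    have hρq2 : 0 ≤ 1 - ρ / q := by rw [sub_nonneg, div_le_one hq0]; linarith
    simp only [← ENNReal.coe_rpow_of_nonneg _ hq0.le, ← ENNReal.coe_rpow_of_nonneg _ hq1,
      ← ENNReal.coe_mul, ENNReal.coe_le_coe] at hHol h1 h2 h4
    simp only [← ENNReal.coe_rpow_of_nonneg _ hρ.le, ← ENNReal.coe_rpow_of_nonneg _ hqρ,
      ← ENNReal.coe_rpow_of_nonneg _ hρq', ← ENNReal.coe_rpow_of_nonneg _ hρq2,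
      ← ENNReal.coe_mul, ENNReal.coe_le_coe]
    exact muckenhoupt_exponent_mul_le (hm0 i hi) z1 (hW0 i hi) (hS0 i hi) z2 z3 hq hρq h1 h2
      hHol h4
  -- The Carleson embedding for `σ` and the function `g / σ`; since `σ ^ (1 - q) = w`, the
  -- right-hand side is the weighted integral of `g ^ q`.
  have hCarl1 : ∑ i ∈ J, (a i : ℝ≥0∞) ^ q * σμ (E i) ≤
      ENNReal.ofReal (q / (q - 1)) ^ q * ∫⁻ x, g x ^ q * w x ∂μ := by
    have hm' : Measurable fun x => g x * (σ x)⁻¹ := hg.mul hσm.inv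
    have := sum_rpow_mul_measure_le J P E hP hE hEP hdis hlam σμ (fun i hi => by
        rw [hσμ, withDensity_apply _ (hP i hi)]; exact hσ2 i hi) hm' a (fun i hi => by
        rw [hσμ, withDensity_apply _ (hP i hi), ← hSc i hi,
          restrict_withDensity (hP i hi), lintegral_withDensity_eq_lintegral_mul _ hσm hm']
        have e1 : ∀ x, (σ * fun x => g x * (σ x)⁻¹) x = g x := by
          intro x
          rw [Pi.mul_apply, mul_comm, mul_assoc, ENNReal.inv_mul_cancel (hσ0 x) (hσt x), mul_one]
        simp only [e1]
        refine le_trans (le_of_eq ?_) (hb i hi)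
        rw [← hmc i hi, ← ENNReal.coe_mul, ← ENNReal.coe_mul]
        congr 1
        exact div_mul_cancel₀ _ (hS0 i hi).ne') hq
    refine this.trans (le_of_eq ?_)
    congr 1
    rw [hσμ, lintegral_withDensity_eq_lintegral_mul _ hσm (hm'.pow_const _)]
    refine lintegral_congr fun x => ?_
    rw [Pi.mul_apply, ENNReal.mul_rpow_of_nonneg _ _ hq0.le, ENNReal.inv_rpow, ← ENNReal.rpow_neg,
      mul_left_comm]
    congr 1
    nth_rewrite 1 [← ENNReal.rpow_one (σ x)]
    rw [← ENNReal.rpow_add _ _ (hσ0 x) (hσt x), ← sub_eq_add_neg]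
    exact dualWeight_rpow hq x
  -- The Carleson embedding for `w` and `F ^ (s - 1)`; as `(s - 1) s' = s`, it returns `I` itself.
  have hCarl2 : ∑ i ∈ J, (φ i : ℝ≥0∞) ^ s' * wμ (E i) ≤ ENNReal.ofReal s ^ s' * I := by
    have hm' : Measurable fun x => F x ^ (s - 1) := hFm.pow_const _
    have := sum_rpow_mul_measure_le J P E hP hE hEP hdis hlam wμ (fun i hi => by
        rw [hwμ, withDensity_apply _ (hP i hi)]; exact hw2 i hi) hm' φ (fun i hi => by
        rw [hwμ, withDensity_apply _ (hP i hi), ← hWc i hi,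
          restrict_withDensity (hP i hi), lintegral_withDensity_eq_lintegral_mul _ hw hm']
        have e1 : ∀ x, (w * fun x => F x ^ (s - 1)) x = F x ^ (s - 1) * w x := fun x => by
          rw [Pi.mul_apply, mul_comm]
        simp only [e1]
        rw [← hΦc i hi, ← ENNReal.coe_mul]
        refine le_of_eq ?_
        congr 1
        exact div_mul_cancel₀ _ (hW0 i hi).ne') hconj.symm.lt
    refine this.trans (le_of_eq ?_)
    have e2 : s' / (s' - 1) = s := by
      rw [hs']
      have : s - 1 ≠ 0 := by linarith
      field_simp
      ring
    rw [e2]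
    congr 1
    rw [hwμ, lintegral_withDensity_eq_lintegral_mul _ hw (hm'.pow_const _)]
    refine lintegral_congr fun x => ?_
    rw [Pi.mul_apply, ← ENNReal.rpow_mul, mul_comm]
    congr 2
    rw [hs']
    have : s - 1 ≠ 0 := by linarith
    field_simp
  have hs'0 : 0 < s' := hconj.symm.pos
  have h1s : ρ / q = 1 / s := by rw [hs]; field_simp
  have h1s' : 1 - ρ / q = 1 / s' := by rw [h1s, hs']; field_simp
  have hmain : I ≤ (A * (C : ℝ≥0∞) ^ (q - ρ) * (ENNReal.ofReal (q / (q - 1)) ^ ρ *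
      (∫⁻ x, g x ^ q * w x ∂μ) ^ (1 / s) * ENNReal.ofReal s)) * I ^ (1 - 1 / s) := by
    calc I = ∑ i ∈ J, (b i : ℝ≥0∞) ^ ρ * ∫⁻ x in P i, F x ^ (s - 1) * w x ∂μ := hIsum
      _ ≤ ∑ i ∈ J, A * (C : ℝ≥0∞) ^ (q - ρ) * (((a i : ℝ≥0∞) ^ ρ * σμ (E i) ^ (ρ / q)) *
          ((φ i : ℝ≥0∞) * wμ (E i) ^ (1 - ρ / q))) := Finset.sum_le_sum hterm
      _ = A * (C : ℝ≥0∞) ^ (q - ρ) * ∑ i ∈ J, ((a i : ℝ≥0∞) ^ ρ * σμ (E i) ^ (ρ / q)) *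
          ((φ i : ℝ≥0∞) * wμ (E i) ^ (1 - ρ / q)) := by rw [Finset.mul_sum]
      _ ≤ A * (C : ℝ≥0∞) ^ (q - ρ) *
          ((∑ i ∈ J, ((a i : ℝ≥0∞) ^ ρ * σμ (E i) ^ (ρ / q)) ^ s) ^ (1 / s) *
          (∑ i ∈ J, ((φ i : ℝ≥0∞) * wμ (E i) ^ (1 - ρ / q)) ^ s') ^ (1 / s')) := by
        gcongr
        exact ENNReal.inner_le_Lp_mul_Lq J _ _ hconj
      _ = A * (C : ℝ≥0∞) ^ (q - ρ) *
          ((∑ i ∈ J, (a i : ℝ≥0∞) ^ q * σμ (E i)) ^ (1 / s) *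
          (∑ i ∈ J, (φ i : ℝ≥0∞) ^ s' * wμ (E i)) ^ (1 / s')) := by
        congr 3
        · refine Finset.sum_congr rfl fun i _ => ?_
          rw [ENNReal.mul_rpow_of_nonneg _ _ hs0.le, ← ENNReal.rpow_mul, ← ENNReal.rpow_mul, h1s,
            one_div_mul_cancel hs0.ne', ENNReal.rpow_one, hs, mul_div_cancel₀ _ hρ.ne']
        · refine Finset.sum_congr rfl fun i _ => ?_
          rw [ENNReal.mul_rpow_of_nonneg _ _ hs'0.le, ← ENNReal.rpow_mul, h1s',
            one_div_mul_cancel hs'0.ne', ENNReal.rpow_one]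
      _ ≤ A * (C : ℝ≥0∞) ^ (q - ρ) *
          ((ENNReal.ofReal (q / (q - 1)) ^ q * ∫⁻ x, g x ^ q * w x ∂μ) ^ (1 / s) *
          (ENNReal.ofReal s ^ s' * I) ^ (1 / s')) := by gcongr
      _ = _ := by
        rw [ENNReal.mul_rpow_of_nonneg _ _ (by positivity),
          ENNReal.mul_rpow_of_nonneg _ _ (by positivity), ← ENNReal.rpow_mul, ← ENNReal.rpow_mul,
          mul_one_div_cancel hs'0.ne', ENNReal.rpow_one, ← h1s', h1s,
          show q * (1 / s) = ρ by rw [hs]; field_simp]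
        ring
  refine (ENNReal.le_rpow_of_le_mul_rpow hs0 hIt hmain).trans (le_of_eq ?_)
  have e5 : (A : ℝ≥0∞) * (C : ℝ≥0∞) ^ (q - ρ) * (ENNReal.ofReal (q / (q - 1)) ^ ρ *
      (∫⁻ x, g x ^ q * w x ∂μ) ^ (1 / s) * ENNReal.ofReal s) =
      ((C : ℝ≥0∞) ^ (q - ρ) * ENNReal.ofReal (q / (q - 1)) ^ ρ * ENNReal.ofReal s) * A *
      (∫⁻ x, g x ^ q * w x ∂μ) ^ (1 / s) := by ring
  rw [e5, ENNReal.mul_rpow_of_nonneg _ _ hs0.le, ENNReal.mul_rpow_of_nonneg _ _ hs0.le,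
    ← ENNReal.rpow_mul (∫⁻ x, g x ^ q * w x ∂μ), one_div_mul_cancel hs0.ne', ENNReal.rpow_one]

end WeightedSparse

/-! ### Cubes and density points of a dyadic system. -/

section DyadicCubes

variable {S : Type u} [MeasurableSpace S] {d : S → S → ℝ} {μ : Measure S} {c_d c_μ c₀ C₀ δ : ℝ}

namespace DyadicSystem

/-- The cubes of a dyadic system, together with their generation. -/
def Cube (𝒟 : DyadicSystem d c₀ C₀ δ) : Type u := Σ k : ℤ, 𝒟.centers k

variable {𝒟 : DyadicSystem d c₀ C₀ δ}

/-- The set of points of a cube. -/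
def Cube.carrier (Q : 𝒟.Cube) : Set S := 𝒟.cube Q.1 Q.2

/-- The center of a cube. -/
def Cube.center (Q : 𝒟.Cube) : S := Q.2

/-- The ball that contains a cube by definition, dilated by the factor `α`. -/
def Cube.ball (α : ℝ) (Q : 𝒟.Cube) : Set S := qBall d Q.center (α * (C₀ * δ ^ Q.1))

theorem exists_cube_at (𝒟 : DyadicSystem d c₀ C₀ δ) (k : ℤ) (x : S) :
    ∃ Q : 𝒟.Cube, Q.1 = k ∧ x ∈ Q.carrier := by
  have : x ∈ ⋃ z ∈ 𝒟.centers k, 𝒟.cube k z := 𝒟.cover k ▸ Set.mem_univ x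
  obtain ⟨z, hz, hx⟩ := Set.mem_iUnion₂.1 this
  exact ⟨⟨k, z, hz⟩, rfl, hx⟩

/-- The cube of generation `k` that contains `x`. -/
noncomputable def cubeAt (𝒟 : DyadicSystem d c₀ C₀ δ) (k : ℤ) (x : S) : 𝒟.Cube :=
  (𝒟.exists_cube_at k x).choose

theorem cubeAt_generation (𝒟 : DyadicSystem d c₀ C₀ δ) (k : ℤ) (x : S) : (𝒟.cubeAt k x).1 = k :=
  (𝒟.exists_cube_at k x).choose_spec.1

theorem mem_cubeAt (𝒟 : DyadicSystem d c₀ C₀ δ) (k : ℤ) (x : S) : x ∈ (𝒟.cubeAt k x).carrier :=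
  (𝒟.exists_cube_at k x).choose_spec.2

theorem Cube.eq_of_mem {P Q : 𝒟.Cube} (h : P.1 = Q.1) {x : S} (hP : x ∈ P.carrier)
    (hQ : x ∈ Q.carrier) : P = Q := by
  obtain ⟨k, z, hz⟩ := P
  obtain ⟨l, z', hz'⟩ := Q
  obtain rfl : k = l := h
  by_cases hzz : z = z'
  · subst hzz; rfl
  · exact absurd hQ (Set.disjoint_left.1 (𝒟.disjoint k z hz z' hz' hzz) hP)

theorem Cube.eq_cubeAt {Q : 𝒟.Cube} {x : S} (h : x ∈ Q.carrier) : 𝒟.cubeAt Q.1 x = Q :=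
  Cube.eq_of_mem (𝒟.cubeAt_generation _ _) (𝒟.mem_cubeAt _ _) h

theorem Cube.subset_of_mem {P Q : 𝒟.Cube} (h : Q.1 ≤ P.1) {x : S} (hP : x ∈ P.carrier)
    (hQ : x ∈ Q.carrier) : P.carrier ⊆ Q.carrier := by
  rcases 𝒟.nested P.1 Q.1 h P.2 P.2.2 Q.2 Q.2.2 with hd | hs
  · exact absurd hQ (Set.disjoint_left.1 hd hP)
  · exact hs

theorem Cube.nested (P Q : 𝒟.Cube) :
    Disjoint P.carrier Q.carrier ∨ P.carrier ⊆ Q.carrier ∨ Q.carrier ⊆ P.carrier := by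
  by_cases h : Disjoint P.carrier Q.carrier
  · exact Or.inl h
  · obtain ⟨x, hP, hQ⟩ := Set.not_disjoint_iff.1 h
    rcases le_total Q.1 P.1 with h1 | h1
    · exact Or.inr (Or.inl (Cube.subset_of_mem h1 hP hQ))
    · exact Or.inr (Or.inr (Cube.subset_of_mem h1 hQ hP))

theorem cubeAt_subset_cubeAt {k l : ℤ} (h : l ≤ k) (x : S) :
    (𝒟.cubeAt k x).carrier ⊆ (𝒟.cubeAt l x).carrier :=
  Cube.subset_of_mem (by rwa [cubeAt_generation, cubeAt_generation]) (𝒟.mem_cubeAt k x)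
    (𝒟.mem_cubeAt l x)

theorem cubeAt_eq_of_mem {k l : ℤ} (h : l ≤ k) {x y : S} (hy : y ∈ (𝒟.cubeAt k x).carrier) :
    𝒟.cubeAt l y = 𝒟.cubeAt l x :=
  Cube.eq_of_mem (by rw [cubeAt_generation, cubeAt_generation]) (𝒟.mem_cubeAt l y)
    (cubeAt_subset_cubeAt h x hy)

theorem Cube.measurableSet (Q : 𝒟.Cube) : MeasurableSet Q.carrier :=
  𝒟.measurableSet_cube Q.1 Q.2 Q.2.2

theorem Cube.carrier_subset (Q : 𝒟.Cube) : Q.carrier ⊆ qBall d Q.center (C₀ * δ ^ Q.1) :=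
  𝒟.subset_ball Q.1 Q.2 Q.2.2

theorem Cube.ball_subset_carrier (Q : 𝒟.Cube) : qBall d Q.center (c₀ * δ ^ Q.1) ⊆ Q.carrier :=
  𝒟.ball_subset Q.1 Q.2 Q.2.2

theorem Cube.measure_pos (hS : IsSpaceOfHomogeneousType d μ c_d c_μ) (hc₀ : 0 < c₀) (hδ : 0 < δ)
    (Q : 𝒟.Cube) : 0 < μ Q.carrier :=
  (hS.measure_ball_pos _ _ (mul_pos hc₀ (zpow_pos hδ _))).trans_le
    (measure_mono Q.ball_subset_carrier)

theorem Cube.measure_lt_top (hS : IsSpaceOfHomogeneousType d μ c_d c_μ)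
    (Q : 𝒟.Cube) : μ Q.carrier < ∞ :=
  (measure_mono Q.carrier_subset).trans_lt (hS.measure_ball_lt_top' _ _)

theorem countable_cube (hS : IsSpaceOfHomogeneousType d μ c_d c_μ) (hc₀ : 0 < c₀) (hδ : 0 < δ)
    (𝒟 : DyadicSystem d c₀ C₀ δ) : Countable 𝒟.Cube := by
  have := hS.sigmaFinite
  have hk : ∀ k, Countable (𝒟.centers k) := by
    intro k
    have h := Measure.countable_meas_pos_of_disjoint_iUnion (μ := μ)
      (As := fun z : 𝒟.centers k => 𝒟.cube k z) (fun z => 𝒟.measurableSet_cube k z z.2)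
      (fun y z hyz => 𝒟.disjoint k y y.2 z z.2 (fun h => hyz (Subtype.ext h)))
    have huniv : {z : 𝒟.centers k | 0 < μ (𝒟.cube k z)} = Set.univ :=
      Set.eq_univ_of_forall fun z => Cube.measure_pos hS hc₀ hδ (𝒟 := 𝒟) ⟨k, z⟩
    rw [huniv] at h
    exact Set.countable_univ_iff.1 h
  exact inferInstanceAs (Countable (Σ k : ℤ, 𝒟.centers k))

theorem measurableSet_cubeAt [Countable 𝒟.Cube] (k : ℤ) (p : 𝒟.Cube → Prop) :
    MeasurableSet {x | p (𝒟.cubeAt k x)} := by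
  have : {x | p (𝒟.cubeAt k x)} = ⋃ Q : 𝒟.Cube, ⋃ _ : Q.1 = k ∧ p Q, Q.carrier := by
    ext x
    simp only [Set.mem_ofPred_eq, Set.mem_iUnion, exists_prop]
    constructor
    · exact fun h => ⟨_, ⟨𝒟.cubeAt_generation k x, h⟩, 𝒟.mem_cubeAt k x⟩
    · rintro ⟨Q, ⟨rfl, hp⟩, hx⟩
      rwa [Cube.eq_cubeAt hx]
  rw [this]
  exact MeasurableSet.iUnion fun Q => MeasurableSet.iUnion fun _ => Q.measurableSet

/-- The topology generated by the cubes of a dyadic system. -/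
@[reducible] def topology (𝒟 : DyadicSystem d c₀ C₀ δ) : TopologicalSpace S where
  IsOpen U := ∀ x ∈ U, ∃ k : ℤ, (𝒟.cubeAt k x).carrier ⊆ U
  isOpen_univ := fun _ _ => ⟨0, Set.subset_univ _⟩
  isOpen_inter := by
    rintro U V hU hV x ⟨hxU, hxV⟩
    obtain ⟨a, ha⟩ := hU x hxU
    obtain ⟨b, hb⟩ := hV x hxV
    exact ⟨max a b, Set.subset_inter ((cubeAt_subset_cubeAt (le_max_left a b) x).trans ha)
      ((cubeAt_subset_cubeAt (le_max_right a b) x).trans hb)⟩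
  isOpen_sUnion := by
    rintro A hA x ⟨U, hUA, hxU⟩
    obtain ⟨a, ha⟩ := hA U hUA x hxU
    exact ⟨a, ha.trans (Set.subset_sUnion_of_mem hUA)⟩

/-- This gives access to regularity of measures for open sets made of cubes. Sets open for `d` are
open here because cubes of high generation have small diameter, and the sets open here are
measurable as countable unions of cubes. -/
theorem borelSpace_topology (hS : IsSpaceOfHomogeneousType d μ c_d c_μ) (hcd : 1 ≤ c_d)
    (hc₀ : 0 < c₀) (hC₀ : 0 < C₀)
    (hδ : 0 < δ) (hδ1 : δ < 1) (𝒟 : DyadicSystem d c₀ C₀ δ) :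
    @BorelSpace S 𝒟.topology _ := by
  have := countable_cube hS hc₀ hδ 𝒟
  let := 𝒟.topology
  constructor
  apply le_antisymm
  · refine hS.borel_eq.le.trans (borel_anti ?_)
    intro U hU x hx
    obtain ⟨ρ, hρ, hρU⟩ := @hU x hx
    obtain ⟨n, hn⟩ := exists_pow_lt_of_lt_one (y := δ) (x := ρ / (2 * c_d * C₀))
      (by positivity) hδ1
    refine ⟨n, Set.Subset.trans (fun y hy => ?_) hρU⟩
    have h1 := (𝒟.cubeAt n x).carrier_subset (𝒟.mem_cubeAt n x)
    have h2 := (𝒟.cubeAt n x).carrier_subset hy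
    rw [cubeAt_generation, mem_qBall_iff] at h1 h2
    rw [hS.symm] at h1
    rw [lt_div_iff₀ (by positivity)] at hn
    have h3 := hS.quasi_triangle x y (𝒟.cubeAt n x).center
    rw [zpow_natCast] at h1 h2
    rw [mem_qBall_iff]
    calc d x y ≤ c_d * (d x (𝒟.cubeAt n x).center + d (𝒟.cubeAt n x).center y) := h3
      _ ≤ c_d * (C₀ * δ ^ n + C₀ * δ ^ n) := by gcongr
      _ = δ ^ n * (2 * c_d * C₀) := by ring
      _ < ρ := hn
  · apply MeasurableSpace.generateFrom_le
    intro U hU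
    have : U = ⋃ Q : 𝒟.Cube, ⋃ _ : Q.carrier ⊆ U, Q.carrier := by
      apply subset_antisymm
      · intro x hx
        obtain ⟨k, hk⟩ := @hU x hx
        exact Set.mem_iUnion₂.2 ⟨_, hk, 𝒟.mem_cubeAt k x⟩
      · exact Set.iUnion₂_subset fun Q hQ => hQ
    rw [this]
    exact MeasurableSet.iUnion fun Q => MeasurableSet.iUnion fun _ => Q.measurableSet

/-- Almost every point of a subset of a cube lies in a small subcube in which the set
has large density. -/
theorem measure_small_density_eq_zero (hS : IsSpaceOfHomogeneousType d μ c_d c_μ) (hcd : 1 ≤ c_d)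
    (hc₀ : 0 < c₀) (hC₀ : 0 < C₀)
    (hδ : 0 < δ) (hδ1 : δ < 1) (Q : 𝒟.Cube) {Ω : Set S} {κ : ℝ≥0∞}
    (hκ : κ < 1) :
    μ {x | (x ∈ Q.carrier ∧ x ∈ Ω) ∧ ∀ k, Q.1 < k →
      μ ((𝒟.cubeAt k x).carrier ∩ Ω) ≤ κ * μ (𝒟.cubeAt k x).carrier} = 0 := by
  have := countable_cube hS hc₀ hδ 𝒟
  let := 𝒟.topology
  have := borelSpace_topology hS hcd hc₀ hC₀ hδ hδ1 𝒟
  set A := {x | (x ∈ Q.carrier ∧ x ∈ Ω) ∧ ∀ k, Q.1 < k →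
      μ ((𝒟.cubeAt k x).carrier ∩ Ω) ≤ κ * μ (𝒟.cubeAt k x).carrier} with hA
  have hAQ : A ⊆ Q.carrier := fun x hx => hx.1.1
  set ν := μ.restrict Q.carrier with hν
  have : IsFiniteMeasure ν := ⟨by
    rw [hν, Measure.restrict_apply_univ]; exact Q.measure_lt_top hS⟩
  -- the cubes of generation `n` in an open set
  let In : Set S → ℕ → Set S := fun U n => {x | (𝒟.cubeAt n x).carrier ⊆ U}
  have hIn_mono : ∀ U, Monotone (In U) := fun U m n hmn x hx =>
    (cubeAt_subset_cubeAt (by exact_mod_cast hmn) x).trans hx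
  have hIn_meas : ∀ U n, MeasurableSet (In U n) := fun U n =>
    measurableSet_cubeAt (𝒟 := 𝒟) n fun P => P.carrier ⊆ U
  have hIn_sub : ∀ U n, In U n ⊆ U := fun U n x hx => hx (𝒟.mem_cubeAt n x)
  have hIn_union : ∀ U, IsOpen U → ⋃ n, In U n = U := by
    intro U hU
    apply subset_antisymm
    · exact Set.iUnion_subset (hIn_sub U)
    · intro x hx
      obtain ⟨k, hk⟩ := @hU x hx
      exact Set.mem_iUnion.2 ⟨k.toNat, (cubeAt_subset_cubeAt (Int.self_le_toNat k) x).trans hk⟩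
  -- Open sets are exhausted from inside by the sets `In U n`. These are closed, since their
  -- complements are also unions of cubes of generation `n`.
  have hreg : ν.WeaklyRegular := by
    apply Measure.InnerRegularWRT.weaklyRegular_of_finite
    intro U hU r hr
    rw [← hIn_union U hU, (hIn_mono U).measure_iUnion, lt_iSup_iff] at hr
    obtain ⟨n, hn⟩ := hr
    refine ⟨In U n, ?_, ?_, hn⟩
    · exact hIn_sub U n
    · refine ⟨fun x hx => ⟨n, fun y hy hyU => hx ?_⟩⟩
      have h := cubeAt_eq_of_mem le_rfl hy
      show (𝒟.cubeAt n x).carrier ⊆ U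
      rw [← h]
      exact hyU
  -- Each `In U n` is a disjoint union of cubes of generation `n`, and those that meet `A` have
  -- `Ω`-density at most `κ`. Shrinking `U` to `A` by outer regularity then gives `ν A ≤ κ ν A`, so
  -- `ν A = 0`. Only outer measure of `A` is involved.
  have key : ∀ U, A ⊆ U → IsOpen U → ν A ≤ κ * ν U := by
    intro U hAU hU
    have hstep : ∀ n : ℕ, Q.1 < n → ν (A ∩ In U n) ≤ κ * ν (In U n) := by
      intro n hn
      have hunion : ∀ B : Set S, B = ⋃ z : 𝒟.centers n, B ∩ 𝒟.cube n z := by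
        intro B
        rw [← Set.inter_iUnion, Set.iUnion_coe_set, 𝒟.cover n, Set.inter_univ]
      have : Countable (𝒟.centers n) :=
        have : Countable (Σ k : ℤ, 𝒟.centers k) := countable_cube hS hc₀ hδ 𝒟
        Function.Injective.countable
          (sigma_mk_injective (β := fun k : ℤ => 𝒟.centers k) (i := (n : ℤ)))
      have hsum : ν (In U n) = ∑' z : 𝒟.centers n, ν (In U n ∩ 𝒟.cube n z) := by
        nth_rewrite 1 [hunion (In U n)]
        refine measure_iUnion (fun y z hyz => ?_) fun z =>
          (hIn_meas U n).inter (𝒟.measurableSet_cube n z z.2)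
        exact (𝒟.disjoint n y y.2 z z.2 fun h => hyz (Subtype.ext h)).mono
          Set.inter_subset_right Set.inter_subset_right
      rw [hsum, ← ENNReal.tsum_mul_left]
      nth_rewrite 1 [hunion (A ∩ In U n)]
      refine (measure_iUnion_le _).trans (ENNReal.tsum_le_tsum fun z => ?_)
      rcases (A ∩ In U n ∩ 𝒟.cube n z).eq_empty_or_nonempty with h | ⟨x, ⟨hxA, hxU⟩, hxz⟩
      · rw [h]; simp
      · let P : 𝒟.Cube := ⟨n, z⟩
        have hP : 𝒟.cubeAt n x = P := Cube.eq_cubeAt (Q := P) hxz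
        have hPU : P.carrier ⊆ In U n := by
          intro y hy
          show (𝒟.cubeAt n y).carrier ⊆ U
          rw [Cube.eq_cubeAt (Q := P) hy, ← hP]
          exact hxU
        have hPQ : P.carrier ⊆ Q.carrier := Cube.subset_of_mem hn.le hxz (hAQ hxA)
        have h1 : ν (In U n ∩ 𝒟.cube n z) = μ P.carrier := by
          change ν (In U n ∩ P.carrier) = _
          rw [Set.inter_eq_self_of_subset_right hPU, hν, Measure.restrict_apply P.measurableSet,
            Set.inter_eq_self_of_subset_left hPQ]
        rw [h1]
        have h2 := hxA.2 n hn
        rw [hP] at h2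
        refine le_trans ?_ h2
        refine (Measure.restrict_apply_le _ _).trans (measure_mono ?_)
        exact fun y hy => ⟨hy.2, hy.1.1.1.2⟩
    have hAeq : A = ⋃ n, A ∩ In U n := by
      rw [← Set.inter_iUnion, hIn_union U hU, Set.inter_eq_self_of_subset_left hAU]
    rw [hAeq, Monotone.measure_iUnion fun m n h => Set.inter_subset_inter_right A (hIn_mono U h)]
    refine iSup_le fun n => ?_
    calc ν (A ∩ In U n) ≤ ν (A ∩ In U (max n (Q.1 + 1).toNat)) :=
          measure_mono (Set.inter_subset_inter_right A (hIn_mono U (le_max_left _ _)))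
      _ ≤ κ * ν (In U (max n (Q.1 + 1).toNat)) := hstep _ (by
          have h1 := Int.self_le_toNat (Q.1 + 1)
          have h2 : (((Q.1 + 1).toNat : ℕ) : ℤ) ≤ (max n (Q.1 + 1).toNat : ℕ) := by
            exact_mod_cast le_max_right _ _
          omega)
      _ ≤ κ * ν U := by
          gcongr
          exact hIn_sub U _
  have hfin : ν A ≤ κ * ν A := by
    rcases eq_or_ne κ 0 with rfl | hκ0
    · simpa using key Set.univ (Set.subset_univ A) isOpen_univ
    · rw [mul_comm, ← ENNReal.div_le_iff_le_mul (Or.inl hκ0) (Or.inl (ne_top_of_lt hκ)),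
        Set.measure_eq_iInf_isOpen A ν]
      refine le_iInf₂ fun U hAU => le_iInf fun hU => ?_
      rw [← Set.measure_eq_iInf_isOpen A ν,
        ENNReal.div_le_iff_le_mul (Or.inl hκ0) (Or.inl (ne_top_of_lt hκ)), mul_comm]
      exact key U hAU hU
  have hνA : ν A = μ A := by
    rw [hν, Measure.restrict_apply' Q.measurableSet, Set.inter_eq_self_of_subset_left hAQ]
  rw [← hνA]
  by_contra h0
  have : κ * ν A < 1 * ν A := by
    rw [ENNReal.mul_lt_mul_iff_left h0 (measure_ne_top ν A)]
    exact hκ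
  rw [one_mul] at this
  exact absurd hfin (not_le.2 this)

end DyadicSystem

end DyadicCubes

/-! ### Stopping cubes and their sparse remainders. -/

section StoppingTree

variable {S : Type u} [MeasurableSpace S] {d : S → S → ℝ} {μ : Measure S} {c_d c_μ c₀ C₀ δ : ℝ}

namespace DyadicSystem

variable {𝒟 : DyadicSystem d c₀ C₀ δ}

/-- A stopping rule: `next Q x` is the first cube below `Q` around `x` at which we hit, if there
is one. It is constant on this cube. -/
def IsStoppingRule (next : 𝒟.Cube → S → Option 𝒟.Cube) : Prop :=
  ∀ Q x P, next Q x = some P → x ∈ Q.carrier ∧ x ∈ P.carrier ∧ P.carrier ⊆ Q.carrier ∧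
    ∀ y ∈ P.carrier, next Q y = some P

theorem IsStoppingRule.preimage_eq {next : 𝒟.Cube → S → Option 𝒟.Cube}
    (h : IsStoppingRule next) (Q P : 𝒟.Cube) :
    {x | next Q x = some P} = ∅ ∨ {x | next Q x = some P} = P.carrier := by
  rcases Set.eq_empty_or_nonempty {x | next Q x = some P} with h0 | ⟨x, hx⟩
  · exact Or.inl h0
  · exact Or.inr (subset_antisymm (fun y hy => (h Q y P hy).2.1) (h Q x P hx).2.2.2)

theorem IsStoppingRule.measurableSet {next : 𝒟.Cube → S → Option 𝒟.Cube}
    (h : IsStoppingRule next) (Q P : 𝒟.Cube) : MeasurableSet {x | next Q x = some P} := by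
  rcases h.preimage_eq Q P with h0 | h0 <;> rw [h0]
  · exact MeasurableSet.empty
  · exact P.measurableSet

theorem IsStoppingRule.measurableSet_none [Countable 𝒟.Cube]
    {next : 𝒟.Cube → S → Option 𝒟.Cube} (h : IsStoppingRule next) (Q : 𝒟.Cube) :
    MeasurableSet {x | next Q x = none} := by
  have : {x | next Q x = none} = (⋃ P, {x | next Q x = some P})ᶜ := by
    ext x
    simp [Option.eq_none_iff_forall_ne_some]
  rw [this]
  exact (MeasurableSet.iUnion fun P => h.measurableSet Q P).compl

/-- Stopping at the maximal subcubes in which the set `Ω Q` has density larger than `κ`. -/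
theorem exists_stoppingRule (hS : IsSpaceOfHomogeneousType d μ c_d c_μ) (hcd : 1 ≤ c_d)
    (hc₀ : 0 < c₀) (hC₀ : 0 < C₀) (hδ : 0 < δ) (hδ1 : δ < 1) {Ω : 𝒟.Cube → Set S}
    (hΩ : ∀ Q, MeasurableSet (Ω Q)) {κ Cp : ℝ≥0∞} (hκ0 : κ ≠ 0) (hκ1 : κ < 1)
    (hsmall : ∀ Q, μ (Q.carrier ∩ Ω Q) ≤ κ / 2 * μ Q.carrier)
    (hCp : ∀ k x, μ (𝒟.cubeAt k x).carrier ≤ Cp * μ (𝒟.cubeAt (k + 1) x).carrier) :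
    ∃ next : 𝒟.Cube → S → Option 𝒟.Cube, IsStoppingRule next ∧
      (∀ Q x P, next Q x = some P → Q.1 < P.1 ∧ μ (P.carrier ∩ Ω Q) ≤ κ * (Cp * μ P.carrier)) ∧
      (∀ Q, ∀ᵐ x ∂μ, x ∈ Q.carrier → next Q x = none → x ∉ Ω Q) ∧
      ∀ Q, μ Q.carrier ≤ 2 * μ (Q.carrier ∩ {x | next Q x = none}) := by
  classical
  have := countable_cube hS hc₀ hδ 𝒟
  -- Index `n` refers to generation `Q.1 + 1 + n`, so that `Q` itself is never tested.
  let hit : 𝒟.Cube → S → ℕ → Prop := fun Q x n =>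
    κ * μ (𝒟.cubeAt (Q.1 + 1 + n) x).carrier < μ ((𝒟.cubeAt (Q.1 + 1 + n) x).carrier ∩ Ω Q)
  let next : 𝒟.Cube → S → Option 𝒟.Cube := fun Q x =>
    if h : x ∈ Q.carrier ∧ ∃ n, hit Q x n then some (𝒟.cubeAt (Q.1 + 1 + Nat.find h.2) x) else none
  have hnext : ∀ Q x P, next Q x = some P ↔ x ∈ Q.carrier ∧
      ∃ n, hit Q x n ∧ (∀ m < n, ¬ hit Q x m) ∧ 𝒟.cubeAt (Q.1 + 1 + n) x = P := by
    intro Q x P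
    by_cases h : x ∈ Q.carrier ∧ ∃ n, hit Q x n
    · simp only [next, dif_pos h, Option.some_inj]
      constructor
      · intro hP
        exact ⟨h.1, Nat.find h.2, Nat.find_spec h.2, fun m hm => Nat.find_min h.2 hm, hP⟩
      · rintro ⟨-, n, hn, hmin, rfl⟩
        have : Nat.find h.2 = n := (Nat.find_eq_iff h.2).2 ⟨hn, hmin⟩
        rw [this]
    · simp only [next, dif_neg h]
      constructor
      · intro h0; cases h0
      · rintro ⟨h1, n, hn, -⟩
        exact absurd ⟨h1, n, hn⟩ h
  have hrule : IsStoppingRule next := by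
    intro Q x P hP
    obtain ⟨hx, n, hn, hmin, rfl⟩ := (hnext Q x P).1 hP
    have hsub : (𝒟.cubeAt (Q.1 + 1 + n) x).carrier ⊆ Q.carrier :=
      Cube.subset_of_mem (by rw [cubeAt_generation]; omega) (𝒟.mem_cubeAt _ x) hx
    refine ⟨hx, 𝒟.mem_cubeAt _ x, hsub, fun y hy => ?_⟩
    have heq : ∀ m ≤ n, 𝒟.cubeAt (Q.1 + 1 + m) y = 𝒟.cubeAt (Q.1 + 1 + m) x := fun m hm =>
      cubeAt_eq_of_mem (by omega) hy
    refine (hnext Q y _).2 ⟨hsub hy, n, ?_, fun m hm => ?_, heq n le_rfl⟩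
    · simpa only [hit, heq n le_rfl] using hn
    · simpa only [hit, heq m hm.le] using hmin m hm
  have hdens : ∀ Q x P, next Q x = some P → κ * μ P.carrier < μ (P.carrier ∩ Ω Q) := by
    intro Q x P hP
    obtain ⟨hx, n, hn, hmin, rfl⟩ := (hnext Q x P).1 hP
    exact hn
  refine ⟨next, hrule, ?_, ?_, ?_⟩
  · intro Q x P hP
    obtain ⟨hx, n, hn, hmin, rfl⟩ := (hnext Q x P).1 hP
    refine ⟨by rw [cubeAt_generation]; omega, ?_⟩
    -- The cube one generation above a stopping cube was not selected: it is either `Q`, where the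
    -- density is small by `hsmall`, or it was rejected because `n` is minimal.
    have hparent : μ ((𝒟.cubeAt (Q.1 + n) x).carrier ∩ Ω Q) ≤
        κ * μ (𝒟.cubeAt (Q.1 + n) x).carrier := by
      rcases Nat.eq_zero_or_pos n with rfl | hn0
      · rw [Nat.cast_zero, add_zero, Cube.eq_cubeAt hx]
        refine (hsmall Q).trans ?_
        gcongr
        exact ENNReal.half_le_self
      · have h1 := hmin (n - 1) (by omega)
        have h2 : Q.1 + 1 + ((n - 1 : ℕ) : ℤ) = Q.1 + n := by omega
        simpa only [hit, h2, not_lt] using h1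
    calc μ ((𝒟.cubeAt (Q.1 + 1 + n) x).carrier ∩ Ω Q)
        ≤ μ ((𝒟.cubeAt (Q.1 + n) x).carrier ∩ Ω Q) :=
          measure_mono (Set.inter_subset_inter_left _ (cubeAt_subset_cubeAt (by omega) x))
      _ ≤ κ * μ (𝒟.cubeAt (Q.1 + n) x).carrier := hparent
      _ ≤ κ * (Cp * μ (𝒟.cubeAt (Q.1 + 1 + n) x).carrier) := by
          gcongr
          have := hCp (Q.1 + n) x
          rwa [show Q.1 + n + 1 = Q.1 + 1 + n by ring] at this
  · intro Q
    have h0 := measure_small_density_eq_zero hS hcd hc₀ hC₀ hδ hδ1 Q (Ω := Ω Q) hκ1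
    filter_upwards [measure_eq_zero_iff_ae_notMem.1 h0] with x hx hxQ hnone hxΩ
    refine hx ⟨⟨hxQ, hxΩ⟩, fun k hk => ?_⟩
    by_contra hcon
    have hex : ∃ n, hit Q x n := by
      refine ⟨(k - Q.1 - 1).toNat, ?_⟩
      have h2 : Q.1 + 1 + ((k - Q.1 - 1).toNat : ℤ) = k := by omega
      simpa only [hit, h2, not_le] using hcon
    have : next Q x = some _ := dif_pos ⟨hxQ, hex⟩
    rw [hnone] at this
    cases this
  · intro Q
    set H := ⋃ P, {x | next Q x = some P} with hH
    have hHm : MeasurableSet H := MeasurableSet.iUnion fun P => hrule.measurableSet Q P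
    have hHQ : H ⊆ Q.carrier := Set.iUnion_subset fun P x hx => (hrule Q x P hx).1
    have hdis : Pairwise (Function.onFun Disjoint fun P => {x | next Q x = some P}) := by
      intro P P' hne
      refine Set.disjoint_left.2 fun x hx hx' => hne ?_
      have : some P = some P' := hx.symm.trans hx'
      exact Option.some_inj.1 this
    have h1 : κ * μ H ≤ μ (H ∩ Ω Q) := by
      rw [hH, Set.iUnion_inter, measure_iUnion hdis fun P => hrule.measurableSet Q P,
        measure_iUnion (fun P P' h => (hdis h).mono Set.inter_subset_left Set.inter_subset_left)
          fun P => (hrule.measurableSet Q P).inter (hΩ Q), ← ENNReal.tsum_mul_left]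
      refine ENNReal.tsum_le_tsum fun P => ?_
      rcases hrule.preimage_eq Q P with h0 | h0
      · rw [h0]; simp
      · rcases Q.carrier.eq_empty_or_nonempty with hQ | _
        · have : {x | next Q x = some P} = ∅ := by
            rw [← Set.subset_empty_iff, ← hQ]
            exact fun x hx => (hrule Q x P hx).1
          rw [this]; simp
        · have hPne : P.carrier.Nonempty :=
            nonempty_of_measure_ne_zero (Cube.measure_pos hS hc₀ hδ P).ne'
          obtain ⟨x, hx⟩ := hPne
          rw [← h0] at hx
          rw [h0]
          exact (hdens Q x P hx).le
    -- On `H` the set `Ω Q` has density at least `κ`, while its measure in `Q` is at most `κ / 2`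
    -- times that of `Q`.
    have h2 : μ H ≤ μ Q.carrier / 2 := by
      have h3 : κ * μ H ≤ κ * (μ Q.carrier / 2) :=
        calc κ * μ H ≤ μ (H ∩ Ω Q) := h1
          _ ≤ μ (Q.carrier ∩ Ω Q) := measure_mono (Set.inter_subset_inter_left _ hHQ)
          _ ≤ κ / 2 * μ Q.carrier := hsmall Q
          _ = κ * (μ Q.carrier / 2) := by
            rw [ENNReal.div_eq_inv_mul, ENNReal.div_eq_inv_mul]; ring
      exact (ENNReal.mul_le_mul_iff_right hκ0 (ne_top_of_lt hκ1)).1 h3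
    have h4 : Q.carrier ∩ {x | next Q x = none} = Q.carrier \ H := by
      ext x
      simp [hH, Option.eq_none_iff_forall_ne_some]
    have hfin := (Q.measure_lt_top hS).ne
    have h5 : μ (Q.carrier \ H) + μ H = μ Q.carrier := by
      have := measure_sdiff_add_inter (μ := μ) Q.carrier hHm
      rwa [Set.inter_eq_self_of_subset_right hHQ] at this
    rw [h4]
    have h6 : μ Q.carrier / 2 ≤ μ (Q.carrier \ H) := by
      have h7 : μ Q.carrier / 2 + μ Q.carrier / 2 ≤ μ (Q.carrier \ H) + μ Q.carrier / 2 := by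
        rw [ENNReal.add_halves]
        nth_rewrite 1 [← h5]
        gcongr
      exact (ENNReal.add_le_add_iff_right (ENNReal.div_ne_top hfin two_ne_zero)).1 h7
    calc μ Q.carrier = 2 * (μ Q.carrier / 2) := by
          rw [ENNReal.mul_div_cancel two_ne_zero ENNReal.ofNat_ne_top]
      _ ≤ 2 * μ (Q.carrier \ H) := by gcongr

/-- The `n`-th stopping cube around `x` below `root`. -/
noncomputable def stoppingNode (next : 𝒟.Cube → S → Option 𝒟.Cube) (root : 𝒟.Cube) :
    ℕ → S → Option 𝒟.Cube
  | 0, x => open Classical in if x ∈ root.carrier then some root else none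
  | n + 1, x => (stoppingNode next root n x).bind fun Q => next Q x

/-- The part of the `n`-th stopping cubes equal to `Q` that is not covered by later stopping
cubes. -/
def stoppingRemainder (next : 𝒟.Cube → S → Option 𝒟.Cube) (root : 𝒟.Cube) (n : ℕ) (Q : 𝒟.Cube) :
    Set S :=
  {x | stoppingNode next root n x = some Q ∧ next Q x = none}

variable {next : 𝒟.Cube → S → Option 𝒟.Cube} {root : 𝒟.Cube}

theorem stoppingNode_succ_eq_some {n : ℕ} {x : S} {P : 𝒟.Cube} :
    stoppingNode next root (n + 1) x = some P ↔
      ∃ Q, stoppingNode next root n x = some Q ∧ next Q x = some P := by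
  rw [stoppingNode, Option.bind_eq_some_iff]

theorem IsStoppingRule.stoppingNode (h : IsStoppingRule next) {n : ℕ} {x : S} {Q : 𝒟.Cube}
    (hx : stoppingNode next root n x = some Q) : x ∈ Q.carrier ∧ Q.carrier ⊆ root.carrier ∧
      ∀ y ∈ Q.carrier, DyadicSystem.stoppingNode next root n y = some Q := by
  induction n generalizing Q with
  | zero =>
    rw [DyadicSystem.stoppingNode] at hx
    split_ifs at hx with h0
    obtain rfl := Option.some_inj.1 hx
    refine ⟨h0, subset_rfl, fun y hy => ?_⟩
    rw [DyadicSystem.stoppingNode, if_pos hy]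
  | succ n ih =>
    obtain ⟨Q', hQ', hQ⟩ := stoppingNode_succ_eq_some.1 hx
    obtain ⟨h1, h2, h3⟩ := ih hQ'
    obtain ⟨h4, h5, h6, h7⟩ := h Q' x Q hQ
    exact ⟨h5, h6.trans h2, fun y hy => stoppingNode_succ_eq_some.2
      ⟨Q', h3 y (h6 hy), h7 y hy⟩⟩

theorem IsStoppingRule.stoppingNode_preimage_eq (h : IsStoppingRule next) (n : ℕ) (Q : 𝒟.Cube) :
    {x | DyadicSystem.stoppingNode next root n x = some Q} = ∅ ∨
      {x | DyadicSystem.stoppingNode next root n x = some Q} = Q.carrier := by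
  rcases Set.eq_empty_or_nonempty {x | DyadicSystem.stoppingNode next root n x = some Q}
    with h0 | ⟨x, hx⟩
  · exact Or.inl h0
  · exact Or.inr (subset_antisymm (fun y hy => (h.stoppingNode hy).1) (h.stoppingNode hx).2.2)

theorem stoppingNode_eq_none_of_le {n m : ℕ} (hnm : n ≤ m) {x : S}
    (h : stoppingNode next root n x = none) : stoppingNode next root m x = none := by
  induction m, hnm using Nat.le_induction with
  | base => exact h
  | succ m _ ih => rw [stoppingNode, ih]; rfl

theorem pairwise_disjoint_stoppingRemainder :
    Pairwise (Function.onFun Disjoint fun i : ℕ × 𝒟.Cube =>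
      stoppingRemainder next root i.1 i.2) := by
  have hlt : ∀ n m Q P x, n < m → x ∈ stoppingRemainder next root n Q →
      x ∉ stoppingRemainder next root m P := by
    intro n m Q P x hnm hx hx'
    have h1 : stoppingNode next root (n + 1) x = none := by
      rw [stoppingNode, hx.1]; exact hx.2
    have h2 := stoppingNode_eq_none_of_le (m := m) hnm h1
    rw [hx'.1] at h2
    cases h2
  rintro ⟨n, Q⟩ ⟨m, P⟩ hne
  refine Set.disjoint_left.2 fun x hx hx' => ?_
  rcases lt_trichotomy n m with h | rfl | h
  · exact hlt n m Q P x h hx hx'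
  · have : some Q = some P := hx.1.symm.trans hx'.1
    exact hne (by rw [Option.some_inj.1 this])
  · exact hlt m n P Q x h hx' hx

theorem IsStoppingRule.stoppingRemainder_subset (h : IsStoppingRule next) (n : ℕ) (Q : 𝒟.Cube) :
    stoppingRemainder next root n Q ⊆ Q.carrier := fun _ hx => (h.stoppingNode hx.1).1

theorem IsStoppingRule.measurableSet_stoppingRemainder [Countable 𝒟.Cube] (h : IsStoppingRule next)
    (n : ℕ) (Q : 𝒟.Cube) : MeasurableSet (stoppingRemainder next root n Q) := by
  refine MeasurableSet.inter (s₁ := {x | DyadicSystem.stoppingNode next root n x = some Q}) ?_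
    (h.measurableSet_none Q)
  rcases h.stoppingNode_preimage_eq (root := root) n Q with h0 | h0 <;> rw [h0]
  · exact MeasurableSet.empty
  · exact Q.measurableSet

theorem IsStoppingRule.measure_le_stoppingRemainder (h : IsStoppingRule next)
    (hhalf : ∀ Q : 𝒟.Cube, μ Q.carrier ≤ 2 * μ (Q.carrier ∩ {x | next Q x = none})) {n : ℕ} {x : S}
    {Q : 𝒟.Cube} (hx : DyadicSystem.stoppingNode next root n x = some Q) :
    μ Q.carrier ≤ 2 * μ (stoppingRemainder next root n Q) := by
  refine (hhalf Q).trans ?_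
  gcongr
  exact fun y hy => ⟨(h.stoppingNode hx).2.2 y hy.1, hy.2⟩

/-- The stopping procedure terminates at almost every point of the root. -/
theorem IsStoppingRule.ae_exists_mem_stoppingRemainder [Countable 𝒟.Cube]
    (hS : IsSpaceOfHomogeneousType d μ c_d c_μ) (h : IsStoppingRule next)
    (hhalf : ∀ Q : 𝒟.Cube, μ Q.carrier ≤ 2 * μ (Q.carrier ∩ {x | next Q x = none})) :
    ∀ᵐ x ∂μ, x ∈ root.carrier → ∃ n Q, x ∈ stoppingRemainder next root n Q := by
  have hsub : (⋃ i : ℕ × 𝒟.Cube, stoppingRemainder next root i.1 i.2) ⊆ root.carrier :=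
    Set.iUnion_subset fun i x hx => (h.stoppingNode hx.1).2.1 (h.stoppingNode hx.1).1
  have hsum : ∑' n, ∑' Q, μ (stoppingRemainder next root n Q) ≤ μ root.carrier := by
    rw [← ENNReal.tsum_prod (f := fun n Q => μ (stoppingRemainder next root n Q)),
      ← measure_iUnion pairwise_disjoint_stoppingRemainder fun i =>
        h.measurableSet_stoppingRemainder i.1 i.2]
    exact measure_mono hsub
  -- For Borel–Cantelli: every stopping cube has at most twice the measure of its remainder, and all
  -- the remainders are disjoint inside the root.
  have hU : ∑' n, μ {x | ∃ Q, DyadicSystem.stoppingNode next root n x = some Q} ≠ ∞ := by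
    refine ne_top_of_le_ne_top (b := 2 * μ root.carrier)
      (ENNReal.mul_ne_top ENNReal.ofNat_ne_top (root.measure_lt_top hS).ne) ?_
    refine le_trans ?_ (mul_le_mul_right hsum 2)
    rw [← ENNReal.tsum_mul_left]
    refine ENNReal.tsum_le_tsum fun n => ?_
    rw [← ENNReal.tsum_mul_left]
    have : {x | ∃ Q, DyadicSystem.stoppingNode next root n x = some Q} =
        ⋃ Q, {x | DyadicSystem.stoppingNode next root n x = some Q} := by
      ext x; simp
    rw [this]
    refine (measure_iUnion_le _).trans (ENNReal.tsum_le_tsum fun Q => ?_)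
    rcases Set.eq_empty_or_nonempty {x | DyadicSystem.stoppingNode next root n x = some Q}
      with h0 | ⟨x, hx⟩
    · rw [h0]; simp
    · refine (measure_mono fun y hy => (h.stoppingNode hy).1).trans
        (h.measure_le_stoppingRemainder hhalf hx)
  filter_upwards [ae_eventually_notMem hU] with x hx hxroot
  obtain ⟨n, hn⟩ := hx.exists
  have hn' : DyadicSystem.stoppingNode next root n x = none := by
    rw [Option.eq_none_iff_forall_ne_some]
    exact fun Q hQ => hn ⟨Q, hQ⟩
  clear hn hx
  induction n with
  | zero =>
    rw [DyadicSystem.stoppingNode, if_pos hxroot] at hn'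
    cases hn'
  | succ n ih =>
    rcases hc : DyadicSystem.stoppingNode next root n x with _ | Q
    · exact ih hc
    · refine ⟨n, Q, hc, ?_⟩
      rw [DyadicSystem.stoppingNode, hc] at hn'
      exact hn'

end DyadicSystem

end StoppingTree

/-! ### Local means and weak-type inequalities. -/

section WeakType

variable {S : Type u} [MeasurableSpace S] {μ : Measure S}
  {X : Type v} [NormedAddCommGroup X]

/-- The `p`-mean of a function over a set. -/
noncomputable def pMean (p : ℝ) (μ : Measure S) (F : S → X) (B : Set S) : ℝ≥0∞ :=
  ((μ B)⁻¹ * ∫⁻ x in B, ‖F x‖ₑ ^ p ∂μ) ^ (1 / p)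

theorem eLpNorm_ofReal_eq {p : ℝ} (hp : 0 < p) (F : S → X) (ν : Measure S) :
    eLpNorm F (ENNReal.ofReal p) ν = (∫⁻ x, ‖F x‖ₑ ^ p ∂ν) ^ (1 / p) := by
  rw [eLpNorm_eq_lintegral_rpow_enorm_toReal (by simpa using hp) ENNReal.ofReal_ne_top,
    ENNReal.toReal_ofReal hp.le]

/-- Jensen's inequality. It lets the `p₀`-mean serve for both exponents `p₁` and `p₂`. -/
theorem eLpNorm_indicator_le_pMean {p q : ℝ} (hq : 0 < q) (hqp : q ≤ p) {F : S → X}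
    (hF : AEStronglyMeasurable F μ) {B : Set S} (hB : MeasurableSet B) (hB0 : μ B ≠ 0)
    (hBt : μ B ≠ ∞) :
    eLpNorm (B.indicator F) (ENNReal.ofReal q) μ ≤ pMean p μ F B * μ B ^ (1 / q) := by
  have hp : 0 < p := hq.trans_le hqp
  rw [eLpNorm_indicator_eq_eLpNorm_restrict hB]
  refine (eLpNorm_le_eLpNorm_mul_rpow_measure_univ (ENNReal.ofReal_le_ofReal hqp)
    hF.restrict).trans (le_of_eq ?_)
  rw [eLpNorm_ofReal_eq hp, ENNReal.toReal_ofReal hq.le, ENNReal.toReal_ofReal hp.le,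
    Measure.restrict_apply_univ, pMean, ENNReal.mul_rpow_of_nonneg _ _ (by positivity),
    sub_eq_add_neg, ENNReal.rpow_add _ _ hB0 hBt, ENNReal.rpow_neg, ENNReal.inv_rpow]
  ring

/-- Chebyshev gives `M / l ^ q`, and `l ≤ l ^ q` removes `q` from the bound, so the later constants
involve `p₁` and `p₂` only through `p₀`. For `a = 0` the set `{g > 0}` has to be shown null by
exhausting it with level sets. -/
theorem measure_lt_le_of_weakLpNorm_le {g : S → ℝ≥0∞} {q : ℝ} (hq : 1 ≤ q) {a M : ℝ≥0∞}
    (ha : a ≠ ∞) (h : weakLpNorm g q μ ≤ a * M ^ (1 / q)) {l : ℝ≥0} (hl : 1 ≤ l) :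
    μ {x | l * a < g x} ≤ M / l := by
  have hq0 : 0 < q := by linarith
  have hbound : ∀ t : ℝ≥0, (t : ℝ≥0∞) * μ {s | (t : ℝ≥0∞) < g s} ^ (1 / q) ≤ a * M ^ (1 / q) :=
    fun t => (le_iSup (fun t : ℝ≥0 => (t : ℝ≥0∞) * μ {s | (t : ℝ≥0∞) < g s} ^ (1 / q)) t).trans h
  rcases eq_or_ne a 0 with rfl | ha0
  · simp only [zero_mul, nonpos_iff_eq_zero, mul_eq_zero, ENNReal.coe_eq_zero,
      ENNReal.rpow_eq_zero_iff] at hbound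
    have hnull : μ {x | (0 : ℝ≥0∞) < g x} = 0 := by
      have : {x | (0 : ℝ≥0∞) < g x} ⊆ ⋃ n : ℕ, {x | (((1 : ℝ≥0) / (n + 1) : ℝ≥0) : ℝ≥0∞) < g x} := by
        intro x hx
        obtain ⟨r, hr0, hr⟩ := ENNReal.lt_iff_exists_nnreal_btwn.1 hx
        obtain ⟨n, hn⟩ := NNReal.exists_nat_pos_inv_lt (by exact_mod_cast hr0 : 0 < r)
        refine Set.mem_iUnion.2 ⟨n, lt_of_le_of_lt ?_ hr⟩
        rw [ENNReal.coe_le_coe]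
        refine le_trans ?_ hn.2.le
        rw [one_div]
        gcongr
        · exact_mod_cast hn.1
        · simp
      refine measure_mono_null this (measure_iUnion_null fun n => ?_)
      rcases hbound ((1 : ℝ≥0) / (n + 1)) with h0 | h0 | h0
      · have : (0 : ℝ≥0) < 1 / (n + 1) := by positivity
        exact absurd h0 this.ne'
      · exact h0.1
      · have : 0 < 1 / q := by positivity
        linarith [h0.2]
    simp only [mul_zero]
    rw [hnull]; exact zero_le
  · lift a to ℝ≥0 using ha
    have h1 := hbound (l * a)
    rw [ENNReal.coe_mul] at h1
    have h2 : (l : ℝ≥0∞) * μ {x | l * (a : ℝ≥0∞) < g x} ^ (1 / q) ≤ M ^ (1 / q) := by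
      rw [mul_comm (l : ℝ≥0∞), mul_assoc] at h1
      exact (ENNReal.mul_le_mul_iff_right ha0 ENNReal.coe_ne_top).1 (by
        simpa only [mul_comm (a : ℝ≥0∞) l] using h1)
    have h3 := ENNReal.rpow_le_rpow h2 hq0.le
    rw [ENNReal.mul_rpow_of_nonneg _ _ hq0.le, ← ENNReal.rpow_mul, ← ENNReal.rpow_mul,
      one_div_mul_cancel hq0.ne', ENNReal.rpow_one, ENNReal.rpow_one] at h3
    have hl0 : (l : ℝ≥0∞) ≠ 0 := by
      have : (0 : ℝ≥0) < l := lt_of_lt_of_le one_pos hl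
      exact_mod_cast this.ne'
    rw [ENNReal.le_div_iff_mul_le (Or.inl hl0) (Or.inl ENNReal.coe_ne_top), mul_comm]
    refine le_trans ?_ h3
    gcongr
    nth_rewrite 1 [← ENNReal.rpow_one (l : ℝ≥0∞)]
    exact ENNReal.rpow_le_rpow_of_exponent_le (by exact_mod_cast hl) hq

/-- Operator norms are infima of admissible constants; this makes the infimum itself admissible. -/
theorem ENNReal.le_sInf_mul {A : Set ℝ≥0∞} (hA : A.Nonempty) {W e : ℝ≥0∞} (he : e ≠ ∞)
    (h : ∀ C ∈ A, W ≤ C * e) : W ≤ sInf A * e := by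
  rcases eq_or_ne e 0 with rfl | he0
  · obtain ⟨C, hC⟩ := hA
    simpa using h C hC
  · rw [← ENNReal.div_le_iff_le_mul (Or.inl he0) (Or.inl he)]
    refine le_sInf fun C hC => ?_
    rw [ENNReal.div_le_iff_le_mul (Or.inl he0) (Or.inl he)]
    exact h C hC

end WeakType

/-! ### Operator norms as constants, and cut-offs in `Lp`. -/

section Operators

variable {S : Type u} [MeasurableSpace S] {μ : Measure S} {d : S → S → ℝ}
  {𝕜 : Type x} [RCLike 𝕜]
  {X : Type v} [NormedAddCommGroup X] [NormedSpace 𝕜 X]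
  {Y : Type w} [NormedAddCommGroup Y] [NormedSpace 𝕜 Y] {p₁ p₂ : ℝ}

theorem weakLpNorm_le_weakOpNorm_mul (T : Lp X (ENNReal.ofReal p₁) μ →ₗ[𝕜] (S →ₘ[μ] Y))
    (hT : weakOpNorm T < ∞) (f : Lp X (ENNReal.ofReal p₁) μ) :
    weakLpNorm (fun s => ‖T f s‖ₑ) p₁ μ ≤ weakOpNorm T * eLpNorm f (ENNReal.ofReal p₁) μ := by
  refine ENNReal.le_sInf_mul (Set.nonempty_iff_ne_empty.2 fun h => ?_) (Lp.eLpNorm_ne_top f)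
    fun C hC => hC f
  rw [weakOpNorm, h] at hT
  simp at hT

theorem weakLpNorm_le_sharpMaximalOpNorm_mul (hd : ∀ s ρ, MeasurableSet (qBall d s ρ))
    (T : Lp X (ENNReal.ofReal p₁) μ →ₗ[𝕜] (S →ₘ[μ] Y)) {α : ℝ}
    (hT : sharpMaximalOpNorm hd T α p₂ < ∞) (f : Lp X (ENNReal.ofReal p₁) μ)
    (hf : MemLp f (ENNReal.ofReal p₂) μ) :
    weakLpNorm (sharpMaximal hd T α f) p₂ μ ≤
      sharpMaximalOpNorm hd T α p₂ * eLpNorm f (ENNReal.ofReal p₂) μ := by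
  refine ENNReal.le_sInf_mul (Set.nonempty_iff_ne_empty.2 fun h => ?_) hf.eLpNorm_ne_top
    fun C hC => hC f hf
  rw [sharpMaximalOpNorm, h] at hT
  simp at hT

theorem lpIndicator_coe (f : Lp X (ENNReal.ofReal p₁) μ) {E : Set S} (hE : MeasurableSet E) :
    lpIndicator f hE =ᵐ[μ] E.indicator f :=
  MemLp.coeFn_toLp _

theorem lpIndicator_congr (f : Lp X (ENNReal.ofReal p₁) μ) {E E' : Set S} (hE : MeasurableSet E)
    (hE' : MeasurableSet E') (h : E = E') : lpIndicator f hE = lpIndicator f hE' := by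
  subst h; rfl

end Operators

/-! ### Dilated cubes: inclusions and measures. -/

section Geometry

variable {S : Type u} [MeasurableSpace S] {d : S → S → ℝ} {μ : Measure S} {c_d c_μ c₀ C₀ δ : ℝ}

namespace DyadicSystem

variable {𝒟 : DyadicSystem d c₀ C₀ δ}

theorem Cube.measurableSet_ball (hS : IsSpaceOfHomogeneousType d μ c_d c_μ) (α : ℝ) (Q : 𝒟.Cube) :
    MeasurableSet (Q.ball α) := hS.measurableSet_ball _ _

theorem Cube.carrier_subset_ball (hC₀ : 0 < C₀) (hδ : 0 < δ) {α : ℝ} (hα : 1 ≤ α) (Q : 𝒟.Cube) :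
    Q.carrier ⊆ Q.ball α :=
  Q.carrier_subset.trans (qBall_mono (le_mul_of_one_le_left
    (mul_pos hC₀ (zpow_pos hδ _)).le hα))

theorem Cube.center_mem (hS : IsSpaceOfHomogeneousType d μ c_d c_μ) (hc₀ : 0 < c₀) (hδ : 0 < δ)
    (Q : 𝒟.Cube) : Q.center ∈ Q.carrier := by
  apply Q.ball_subset_carrier
  rw [mem_qBall_iff, hS.dist_self]
  exact mul_pos hc₀ (zpow_pos hδ _)

/-- Passing down at least one generation gains the factor `δ`, and `2 c_d ≤ α` together with `2 c_d
δ ≤ 1` pays for the quasi-triangle inequality. The nested dilates are what makes the chain of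
cut-offs telescope. -/
theorem Cube.ball_subset_ball (hS : IsSpaceOfHomogeneousType d μ c_d c_μ) (hcd : 1 ≤ c_d)
    (hc₀ : 0 < c₀) (hC₀ : 0 < C₀) (hδ : 0 < δ) (hδ1 : δ < 1) (hδd : 2 * c_d * δ ≤ 1) {α : ℝ}
    (hα : 2 * c_d ≤ α) {P Q : 𝒟.Cube} (hPQ : P.carrier ⊆ Q.carrier) (hgen : Q.1 < P.1) :
    P.ball α ⊆ Q.ball α := by
  apply hS.qBall_subset_qBall hcd
  have h1 : d Q.center P.center < C₀ * δ ^ Q.1 :=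
    Q.carrier_subset (hPQ (P.center_mem hS hc₀ hδ))
  have h2 : δ ^ P.1 ≤ δ ^ Q.1 * δ := by
    rw [← zpow_add_one₀ hδ.ne']
    exact zpow_le_zpow_right_of_le_one₀ hδ hδ1.le (by omega)
  have hα0 : 0 < α := by linarith
  have h3 : 0 < δ ^ Q.1 := zpow_pos hδ _
  calc c_d * (d Q.center P.center + α * (C₀ * δ ^ P.1))
      ≤ c_d * (C₀ * δ ^ Q.1 + α * (C₀ * (δ ^ Q.1 * δ))) := by gcongr
    _ = (2 * c_d + α * (2 * c_d * δ)) * (C₀ * δ ^ Q.1) / 2 := by ring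
    _ ≤ (α + α * 1) * (C₀ * δ ^ Q.1) / 2 := by gcongr
    _ = α * (C₀ * δ ^ Q.1) := by ring

theorem Cube.measure_ball_le (hS : IsSpaceOfHomogeneousType d μ c_d c_μ) (hcd : 1 ≤ c_d)
    (hc₀ : 0 < c₀) (hδ : 0 < δ) {α : ℝ} {n : ℕ} (hn : c_d * (α * C₀) ≤ 2 ^ n * c₀) (Q : 𝒟.Cube) :
    μ (Q.ball α) ≤ ENNReal.ofReal c_μ ^ n * μ Q.carrier := by
  have h3 : 0 < δ ^ Q.1 := zpow_pos hδ _
  refine (hS.measure_ball_le hcd (s := Q.center) (ρ := c₀ * δ ^ Q.1) (mul_pos hc₀ h3) n ?_).trans ?_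
  · rw [hS.dist_self]
    calc c_d * (0 + α * (C₀ * δ ^ Q.1)) = c_d * (α * C₀) * δ ^ Q.1 := by ring
      _ ≤ 2 ^ n * c₀ * δ ^ Q.1 := by gcongr
      _ = _ := by ring
  · gcongr
    exact Q.ball_subset_carrier

theorem measure_cubeAt_le (hS : IsSpaceOfHomogeneousType d μ c_d c_μ) (hcd : 1 ≤ c_d)
    (hc₀ : 0 < c₀) (hC₀ : 0 < C₀) (hδ : 0 < δ) (hδ1 : δ < 1) {n : ℕ}
    (hn : c_d * (2 * c_d * C₀ + C₀) ≤ 2 ^ n * (c₀ * δ)) (k : ℤ) (x : S) :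
    μ (𝒟.cubeAt k x).carrier ≤ ENNReal.ofReal c_μ ^ n * μ (𝒟.cubeAt (k + 1) x).carrier := by
  set Q := 𝒟.cubeAt k x with hQ
  set P := 𝒟.cubeAt (k + 1) x with hP
  have hQk : Q.1 = k := 𝒟.cubeAt_generation k x
  have hPk : P.1 = k + 1 := 𝒟.cubeAt_generation (k + 1) x
  have h1 : d Q.center x < C₀ * δ ^ k := hQk ▸ Q.carrier_subset (𝒟.mem_cubeAt k x)
  have h2 : d P.center x < C₀ * δ ^ (k + 1) := hPk ▸ P.carrier_subset (𝒟.mem_cubeAt (k + 1) x)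
  have h3 : 0 < δ ^ k := zpow_pos hδ _
  rw [zpow_add_one₀ hδ.ne'] at h2
  have h4 := hS.quasi_triangle P.center Q.center x
  rw [hS.symm x] at h4
  refine (measure_mono Q.carrier_subset).trans ((hS.measure_ball_le hcd (s := P.center)
    (ρ := c₀ * δ ^ P.1) (mul_pos hc₀ (zpow_pos hδ _)) n ?_).trans ?_)
  · rw [hQk, hPk, zpow_add_one₀ hδ.ne']
    calc c_d * (d P.center Q.center + C₀ * δ ^ k)
        ≤ c_d * (c_d * (C₀ * (δ ^ k * 1) + C₀ * δ ^ k) + C₀ * δ ^ k) := by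
          gcongr
          refine h4.trans ?_
          gcongr
          exact h2.le.trans (by gcongr)
      _ = c_d * (2 * c_d * C₀ + C₀) * δ ^ k := by ring
      _ ≤ 2 ^ n * (c₀ * δ) * δ ^ k := by gcongr
      _ = _ := by ring
  · gcongr
    exact P.ball_subset_carrier

end DyadicSystem

end Geometry

/-! ### Telescoping and oscillation estimates for `T`. -/

section SparseDomination

variable {S : Type u} [MeasurableSpace S] {d : S → S → ℝ} {μ : Measure S} {c_d c_μ c₀ C₀ δ : ℝ}
  {𝕜 : Type x} [RCLike 𝕜]
  {X : Type v} [NormedAddCommGroup X] [NormedSpace 𝕜 X]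
  {Y : Type w} [NormedAddCommGroup Y] [NormedSpace 𝕜 Y] {p₁ p₂ : ℝ}

theorem lpIndicator_sdiff (F : Lp X (ENNReal.ofReal p₁) μ) {A B : Set S} (hA : MeasurableSet A)
    (hB : MeasurableSet B) (hBA : B ⊆ A) :
    lpIndicator F (hA.diff hB) = lpIndicator F hA - lpIndicator F hB := by
  apply Lp.ext
  filter_upwards [lpIndicator_coe F (hA.diff hB), lpIndicator_coe F hA, lpIndicator_coe F hB,
    Lp.coeFn_sub (lpIndicator F hA) (lpIndicator F hB)] with x h1 h2 h3 h4
  rw [h1, h4, Pi.sub_apply, h2, h3]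
  by_cases hxB : x ∈ B
  · simp [hxB, hBA hxB]
  · by_cases hxA : x ∈ A <;> simp [hxA, hxB]

theorem lpIndicator_compl_lpIndicator (F : Lp X (ENNReal.ofReal p₁) μ) {A B : Set S}
    (hA : MeasurableSet A) (hB : MeasurableSet B) :
    lpIndicator (lpIndicator F hA) hB.compl = lpIndicator F (hA.diff hB) := by
  apply Lp.ext
  filter_upwards [lpIndicator_coe F (hA.diff hB), lpIndicator_coe F hA,
    lpIndicator_coe (lpIndicator F hA) hB.compl] with x h1 h2 h3
  rw [h1, h3]
  by_cases hxB : x ∈ B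
  · simp [hxB]
  · by_cases hxA : x ∈ A <;> simp [hxA, hxB, h2]

/-- An oscillation estimate, together with an estimate on a set of positive measure, yields an
estimate almost everywhere. -/
theorem ae_enorm_le_of_essSup_le [SFinite μ] {g : S → Y} {B G : Set S} (hB : MeasurableSet B)
    (hGB : G ⊆ B) (hG : μ G ≠ 0) {a b : ℝ≥0∞}
    (ha : essSup (fun z : S × S => ‖g z.1 - g z.2‖ₑ) ((μ.restrict B).prod (μ.restrict B)) ≤ a)
    (hb : ∀ᵐ x ∂μ, x ∈ G → ‖g x‖ₑ ≤ b) : ∀ᵐ x ∂μ, x ∈ B → ‖g x‖ₑ ≤ a + b := by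
  have h1 := (ENNReal.ae_le_essSup (μ := (μ.restrict B).prod (μ.restrict B))
    fun z : S × S => ‖g z.1 - g z.2‖ₑ).mono fun z hz => hz.trans ha
  have h2 := Measure.ae_ae_of_ae_prod h1
  rw [ae_restrict_iff' hB] at h2
  filter_upwards [h2] with x hx hxB
  have h3 := (ae_restrict_iff' hB).1 (hx hxB)
  have h4 : ∃ y ∈ G, ‖g x - g y‖ₑ ≤ a ∧ ‖g y‖ₑ ≤ b := by
    by_contra hcon
    push Not at hcon
    apply hG
    rw [measure_eq_zero_iff_ae_notMem]
    filter_upwards [h3, hb] with y hy1 hy2 hyG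
    exact absurd (hy2 hyG) (not_le.2 (hcon y hyG (hy1 (hGB hyG))))
  obtain ⟨y, -, hy1, hy2⟩ := h4
  calc ‖g x‖ₑ = ‖(g x - g y) + g y‖ₑ := by rw [sub_add_cancel]
    _ ≤ ‖g x - g y‖ₑ + ‖g y‖ₑ := enorm_add_le _ _
    _ ≤ a + b := add_le_add hy1 hy2

/-- Along a decreasing chain, `F 1_{D 0}` is the sum of its parts on the successive differences and
on the last set. These parts are disjointly and boundedly supported, so `r`-sublinearity applies to
them. -/
theorem IsRSublinear.ae_enorm_le_sum {T : Lp X (ENNReal.ofReal p₁) μ →ₗ[𝕜] (S →ₘ[μ] Y)}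
    {p₀ r C_r : ℝ} (hr : 1 ≤ r) (hC : 0 ≤ C_r) (hT : IsRSublinear d T p₀ r C_r)
    (F : Lp X (ENNReal.ofReal p₁) μ)
    (hF : MemLp F (ENNReal.ofReal p₀) μ) (n : ℕ) (D : ℕ → Set S)
    (hD : ∀ i, MeasurableSet (D i)) (hanti : ∀ i < n, D (i + 1) ⊆ D i)
    (hbd : ∀ i, ∃ c ρ, D i ⊆ qBall d c ρ) :
    ∀ᵐ x ∂μ, ‖T (lpIndicator F (hD 0)) x‖ₑ ≤ ENNReal.ofReal C_r *
      (∑ i ∈ Finset.range n, ‖T (lpIndicator F ((hD i).diff (hD (i + 1)))) x‖ₑ ^ r +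
        ‖T (lpIndicator F (hD n)) x‖ₑ ^ r) ^ (1 / r) := by
  have hr0 : 0 < r := by linarith
  let B : ℕ → Set S := fun i => if i < n then D i \ D (i + 1) else D i
  have hB : ∀ i, MeasurableSet (B i) := by
    intro i
    simp only [B]
    split_ifs
    · exact (hD i).diff (hD (i + 1))
    · exact hD i
  have hBD : ∀ i, B i ⊆ D i := by
    intro i
    simp only [B]
    split_ifs
    · exact Set.sdiff_subset
    · exact subset_rfl
  have hDanti : ∀ i j, i ≤ j → j ≤ n → D j ⊆ D i := by
    intro i j hij
    induction j, hij using Nat.le_induction with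
    | base => exact fun _ => subset_rfl
    | succ j _ ih => exact fun hj => (hanti j (by omega)).trans (ih (by omega))
  have hdis : ∀ i j, i < j → j ≤ n → Disjoint (B i) (B j) := by
    intro i j hij hjn
    refine Set.disjoint_left.2 fun x hx hx' => ?_
    simp only [B, if_pos (lt_of_lt_of_le hij hjn)] at hx
    exact hx.2 (hDanti (i + 1) j hij hjn (hBD j hx'))
  let H : ℕ → Lp X (ENNReal.ofReal p₁) μ := fun i => lpIndicator F (hB i)
  have hHlt : ∀ i < n, H i = lpIndicator F ((hD i).diff (hD (i + 1))) := fun i hi =>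
    lpIndicator_congr F _ _ (if_pos hi)
  have hHn : H n = lpIndicator F (hD n) := lpIndicator_congr F _ _ (if_neg (lt_irrefl n))
  have hsum : ∑ k : Fin (n + 1), H k = lpIndicator F (hD 0) := by
    rw [Fin.sum_univ_eq_sum_range (fun i => H i), Finset.sum_range_succ, hHn,
      Finset.sum_congr rfl (g := fun i => lpIndicator F (hD i) - lpIndicator F (hD (i + 1)))
        fun i hi => ?_, Finset.sum_range_sub' (fun i => lpIndicator F (hD i)), sub_add_cancel]
    rw [hHlt i (Finset.mem_range.1 hi), lpIndicator_sdiff F _ _ (hanti i (Finset.mem_range.1 hi))]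
  have hmain := hT (n + 1) (fun k => H k) (fun k => ?_) (fun k => ?_) ?_
  · rw [hsum] at hmain
    filter_upwards [hmain] with x hx
    have e1 : ∀ (y : Y), ‖y‖ₑ ^ r = ENNReal.ofReal (‖y‖ ^ r) := fun y => by
      rw [← ENNReal.ofReal_rpow_of_nonneg (norm_nonneg y) hr0.le, ofReal_norm]
    have e2 : ∑ i ∈ Finset.range n, ‖T (lpIndicator F ((hD i).diff (hD (i + 1)))) x‖ₑ ^ r +
        ‖T (lpIndicator F (hD n)) x‖ₑ ^ r =
        ENNReal.ofReal (∑ k : Fin (n + 1), ‖T (H k) x‖ ^ r) := by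
      rw [Fin.sum_univ_eq_sum_range (fun i => ‖T (H i) x‖ ^ r), Finset.sum_range_succ,
        ENNReal.ofReal_add (Finset.sum_nonneg fun i _ => by positivity) (by positivity),
        ENNReal.ofReal_sum_of_nonneg fun i _ => by positivity, hHn, e1]
      congr 1
      refine Finset.sum_congr rfl fun i hi => ?_
      rw [e1, hHlt i (Finset.mem_range.1 hi)]
    rw [e2, ENNReal.ofReal_rpow_of_nonneg (Finset.sum_nonneg fun i _ => by positivity)
      (by positivity), ← ENNReal.ofReal_mul hC, ← ofReal_norm]
    exact ENNReal.ofReal_le_ofReal hx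
  · exact (hF.indicator (hB k)).ae_eq (lpIndicator_coe F (hB k)).symm
  · obtain ⟨c, ρ, hcρ⟩ := hbd k
    refine ⟨c, ρ, ?_⟩
    filter_upwards [lpIndicator_coe F (hB k)] with x hx hxc
    rw [hx, Set.indicator_of_notMem fun h => hxc (hcρ (hBD k h))]
  · intro j k hjk
    filter_upwards [lpIndicator_coe F (hB j), lpIndicator_coe F (hB k)] with x hj hk
    have hne : (j : ℕ) ≠ k := fun h => hjk (Fin.ext h)
    have hd : Disjoint (B j) (B k) := by
      rcases lt_or_gt_of_ne hne with h | h
      · exact hdis j k h (by omega)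
      · exact (hdis k j h (by omega)).symm
    by_cases hx : x ∈ B j
    · right
      rw [hk, Set.indicator_of_notMem (Set.disjoint_left.1 hd hx)]
    · left
      rw [hj, Set.indicator_of_notMem hx]

end SparseDomination

/-! ### Pointwise sparse domination. -/

section SparseDomination

open DyadicSystem

variable {S : Type u} [MeasurableSpace S] {d : S → S → ℝ} {μ : Measure S} {c_d c_μ c₀ C₀ δ : ℝ}
  {𝕜 : Type x} [RCLike 𝕜]
  {X : Type v} [NormedAddCommGroup X] [NormedSpace 𝕜 X]
  {Y : Type w} [NormedAddCommGroup Y] [NormedSpace 𝕜 Y] {p₁ p₂ : ℝ}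

/-- By convexity of the `r`-th power and since each `a i` enters at most two terms; the factors `2 ^
r`, `2 ^ (r - 1)` and `2` combine to `4 ^ r`. -/
theorem sum_rpow_consecutive_le {r : ℝ} (hr : 1 ≤ r) (a : ℕ → ℝ≥0∞) (n : ℕ) :
    (∑ i ∈ Finset.range n, (2 * (a i + a (i + 1))) ^ r + a n ^ r) ^ (1 / r) ≤
      4 * (∑ i ∈ Finset.range (n + 1), a i ^ r) ^ (1 / r) := by
  have hr0 : 0 < r := by linarith
  set c : ℝ≥0∞ := 2 ^ r * 2 ^ (r - 1) with hc
  have hc1 : 1 ≤ c := by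
    rw [hc]
    exact one_le_mul (ENNReal.one_le_rpow one_le_two hr0)
      (by simpa using ENNReal.rpow_le_rpow_of_exponent_le one_le_two (sub_nonneg.2 hr))
  have hc2 : 2 * c = 4 ^ r := by
    have h2 : (2 : ℝ≥0∞) ^ r = 2 * 2 ^ (r - 1) := by
      nth_rewrite 2 [← ENNReal.rpow_one 2]
      rw [← ENNReal.rpow_add _ _ two_ne_zero ENNReal.ofNat_ne_top]
      congr 1; ring
    have h4 : (4 : ℝ≥0∞) ^ r = 2 ^ r * 2 ^ r := by
      rw [← ENNReal.mul_rpow_of_nonneg _ _ hr0.le]; norm_num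
    rw [h4, hc, mul_left_comm, ← h2]
  have hterm : ∀ i, (2 * (a i + a (i + 1))) ^ r ≤ c * (a i ^ r + a (i + 1) ^ r) := by
    intro i
    rw [ENNReal.mul_rpow_of_nonneg _ _ hr0.le, hc, mul_assoc]
    gcongr
    exact ENNReal.rpow_add_le_mul_rpow_add_rpow _ _ hr
  have hle : ∑ i ∈ Finset.range n, (2 * (a i + a (i + 1))) ^ r + a n ^ r ≤
      4 ^ r * ∑ i ∈ Finset.range (n + 1), a i ^ r := by
    calc ∑ i ∈ Finset.range n, (2 * (a i + a (i + 1))) ^ r + a n ^ r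
        ≤ ∑ i ∈ Finset.range n, c * (a i ^ r + a (i + 1) ^ r) + c * a n ^ r := by
          refine add_le_add (Finset.sum_le_sum fun i _ => hterm i) ?_
          exact le_mul_of_one_le_left zero_le hc1
      _ = c * (∑ i ∈ Finset.range (n + 1), a i ^ r + ∑ i ∈ Finset.range n, a (i + 1) ^ r) := by
          rw [← Finset.mul_sum, Finset.sum_add_distrib, Finset.sum_range_succ]; ring
      _ ≤ c * (∑ i ∈ Finset.range (n + 1), a i ^ r + ∑ i ∈ Finset.range (n + 1), a i ^ r) := by
          gcongr
          rw [Finset.sum_range_succ' (fun i => a i ^ r)]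
          exact le_self_add
      _ = _ := by rw [← hc2]; ring
  calc _ ≤ (4 ^ r * ∑ i ∈ Finset.range (n + 1), a i ^ r) ^ (1 / r) := by gcongr
    _ = _ := by
        rw [ENNReal.mul_rpow_of_nonneg _ _ (by positivity), ← ENNReal.rpow_mul,
          mul_one_div_cancel hr0.ne', ENNReal.rpow_one]

theorem pMean_ne_top {p : ℝ} (hp : 0 < p) {F : S → X} (hF : MemLp F (ENNReal.ofReal p) μ)
    {B : Set S} (hB : μ B ≠ 0) : pMean p μ F B ≠ ∞ := by
  have h1 := hF.eLpNorm_ne_top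
  rw [eLpNorm_ofReal_eq hp] at h1
  have h2 : ∫⁻ x, ‖F x‖ₑ ^ p ∂μ ≠ ∞ := by
    intro h
    rw [h, ENNReal.top_rpow_of_pos (by positivity)] at h1
    exact h1 rfl
  refine ENNReal.rpow_ne_top_of_nonneg (by positivity) (ENNReal.mul_ne_top ?_ ?_)
  · exact ENNReal.inv_ne_top.2 hB
  · exact ne_top_of_le_ne_top h2 (setLIntegral_le_lintegral _ _)

/-- Pointwise `ℓʳ`-sparse domination of `T (F 1_{αQ₀})` on a cube `Q₀`. -/
theorem exists_sparse_domination (hS : IsSpaceOfHomogeneousType d μ c_d c_μ) (hcd : 1 ≤ c_d)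
    {𝒟 : DyadicSystem d c₀ C₀ δ} (hc₀ : 0 < c₀) (hC₀ : 0 < C₀) (hδ : 0 < δ) (hδ1 : δ < 1)
    (hδd : 2 * c_d * δ ≤ 1) {α : ℝ} (hα : 2 * c_d ≤ α) {Cα Cp : ℝ≥0} (hCα1 : 1 ≤ Cα)
    (hCp1 : 1 ≤ Cp) (hCα : ∀ Q : 𝒟.Cube, μ (Q.ball α) ≤ Cα * μ Q.carrier)
    (hCp : ∀ k x, μ (𝒟.cubeAt k x).carrier ≤ Cp * μ (𝒟.cubeAt (k + 1) x).carrier)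
    (hp₁ : 1 ≤ p₁) (hp₂ : 1 ≤ p₂) (T : Lp X (ENNReal.ofReal p₁) μ →ₗ[𝕜] (S →ₘ[μ] Y))
    (hT₁ : weakOpNorm T < ∞) (hT₂ : sharpMaximalOpNorm hS.measurableSet_ball T α p₂ < ∞)
    {r C_r : ℝ} (hr : 1 ≤ r) (hC : 0 ≤ C_r) (hTr : IsRSublinear d T (max p₁ p₂) r C_r)
    (F : Lp X (ENNReal.ofReal p₁) μ) (hF : MemLp F (ENNReal.ofReal (max p₁ p₂)) μ)
    (root : 𝒟.Cube) :
    ∃ (I : Type u) (_ : Countable I) (Q : I → 𝒟.Cube) (E : I → Set S),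
      (∀ i, MeasurableSet (E i) ∧ E i ⊆ (Q i).carrier ∧ μ (Q i).carrier ≤ 2 * μ (E i)) ∧
      Pairwise (Function.onFun Disjoint E) ∧
      ∀ᵐ x ∂μ, x ∈ root.carrier →
        ‖T (lpIndicator F (root.measurableSet_ball hS α)) x‖ₑ ≤
          ENNReal.ofReal C_r * (4 * ((16 * Cα * Cp : ℝ≥0) * (weakOpNorm T +
            sharpMaximalOpNorm hS.measurableSet_ball T α p₂))) *
          (∑' i, (Q i).carrier.indicator
            (fun _ => pMean (max p₁ p₂) μ F ((Q i).ball α) ^ r) x) ^ (1 / r) := by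
  have := hS.sigmaFinite
  have := countable_cube hS hc₀ hδ 𝒟
  have hα1 : 1 ≤ α := by linarith
  have hr0 : 0 < r := by linarith
  set p₀ := max p₁ p₂ with hp₀
  set N := weakOpNorm T + sharpMaximalOpNorm hS.measurableSet_ball T α p₂ with hN
  -- Chosen so that two bad sets, each of measure at most `Cα μ(Q) / l`, together fill at most `κ /
  -- 2` of `Q`, for `κ = 1 / (4 Cp)`. This `κ` makes `Ω Q` fill at most a quarter of each stopping
  -- cube below `Q`.
  set l : ℝ≥0 := 16 * Cα * Cp with hl
  have hl1 : 1 ≤ l := by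
    have h1 : 1 ≤ Cα * Cp := one_le_mul hCα1 hCp1
    calc (1 : ℝ≥0) ≤ 16 * 1 := by norm_num
      _ ≤ 16 * (Cα * Cp) := by gcongr
      _ = l := by rw [hl]; ring
  have hNt : N ≠ ∞ := ENNReal.add_ne_top.2 ⟨hT₁.ne, hT₂.ne⟩
  have hball : ∀ Q : 𝒟.Cube, MeasurableSet (Q.ball α) := fun Q => Q.measurableSet_ball hS α
  have hballt : ∀ Q : 𝒟.Cube, μ (Q.ball α) ≠ ∞ := fun Q => (hS.measure_ball_lt_top' _ _).ne
  have hpos : ∀ Q : 𝒟.Cube, 0 < μ Q.carrier := fun Q => Q.measure_pos hS hc₀ hδ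
  have hfin : ∀ Q : 𝒟.Cube, μ Q.carrier ≠ ∞ := fun Q => (Q.measure_lt_top hS).ne
  have hball0 : ∀ Q : 𝒟.Cube, μ (Q.ball α) ≠ 0 := fun Q =>
    ((hpos Q).trans_le (measure_mono (Q.carrier_subset_ball hC₀ hδ hα1))).ne'
  let a : 𝒟.Cube → ℝ≥0∞ := fun Q => pMean p₀ μ F (Q.ball α)
  have hat : ∀ Q, a Q ≠ ∞ := fun Q =>
    pMean_ne_top (by rw [hp₀]; positivity) hF (hball0 Q)
  let f : 𝒟.Cube → Lp X (ENNReal.ofReal p₁) μ := fun Q => lpIndicator F (hball Q)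
  let L : 𝒟.Cube → ℝ≥0∞ := fun Q => l * (N * a Q)
  have hfnorm : ∀ Q, ∀ q, 1 ≤ q → q ≤ p₀ →
      eLpNorm (f Q) (ENNReal.ofReal q) μ ≤ a Q * μ (Q.ball α) ^ (1 / q) := by
    intro Q q hq hqp
    rw [eLpNorm_congr_ae (lpIndicator_coe F (hball Q))]
    exact eLpNorm_indicator_le_pMean (by linarith) hqp (Lp.aestronglyMeasurable F) (hball Q)
      (hball0 Q) (hballt Q)
  have hfmem : ∀ Q, MemLp (f Q) (ENNReal.ofReal p₂) μ := by
    intro Q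
    refine ⟨Lp.aestronglyMeasurable _, (hfnorm Q p₂ hp₂ (le_max_right _ _)).trans_lt ?_⟩
    exact ENNReal.mul_lt_top (hat Q).lt_top
      (ENNReal.rpow_lt_top_of_nonneg (by positivity) (hballt Q))
  have hbad₁ : ∀ Q, μ {x | L Q < ‖T (f Q) x‖ₑ} ≤ μ (Q.ball α) / l := by
    intro Q
    refine measure_lt_le_of_weakLpNorm_le hp₁ (ENNReal.mul_ne_top hNt (hat Q)) ?_ hl1
    calc weakLpNorm (fun s => ‖T (f Q) s‖ₑ) p₁ μ
        ≤ weakOpNorm T * eLpNorm (f Q) (ENNReal.ofReal p₁) μ :=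
          weakLpNorm_le_weakOpNorm_mul T hT₁ (f Q)
      _ ≤ N * (a Q * μ (Q.ball α) ^ (1 / p₁)) := by
          gcongr
          · exact le_self_add
          · exact hfnorm Q p₁ hp₁ (le_max_left _ _)
      _ = _ := by ring
  have hbad₂ : ∀ Q, μ {x | L Q < sharpMaximal hS.measurableSet_ball T α (f Q) x} ≤
      μ (Q.ball α) / l := by
    intro Q
    refine measure_lt_le_of_weakLpNorm_le hp₂ (ENNReal.mul_ne_top hNt (hat Q)) ?_ hl1
    calc weakLpNorm (sharpMaximal hS.measurableSet_ball T α (f Q)) p₂ μ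
        ≤ sharpMaximalOpNorm hS.measurableSet_ball T α p₂ *
            eLpNorm (f Q) (ENNReal.ofReal p₂) μ :=
          weakLpNorm_le_sharpMaximalOpNorm_mul _ T hT₂ (f Q) (hfmem Q)
      _ ≤ N * (a Q * μ (Q.ball α) ^ (1 / p₂)) := by
          gcongr
          · exact le_add_self
          · exact hfnorm Q p₂ hp₂ (le_max_right _ _)
      _ = _ := by ring
  -- A measurable hull, since the sharp maximal function is a supremum over uncountably many balls.
  let Ω : 𝒟.Cube → Set S := fun Q => toMeasurable μ ({x | L Q < ‖T (f Q) x‖ₑ} ∪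
    {x | L Q < sharpMaximal hS.measurableSet_ball T α (f Q) x})
  have hΩ₁ : ∀ Q x, x ∉ Ω Q → ‖T (f Q) x‖ₑ ≤ L Q := fun Q x hx =>
    not_lt.1 fun h => hx (subset_toMeasurable μ _ (Or.inl h))
  have hΩ₂ : ∀ Q x, x ∉ Ω Q → sharpMaximal hS.measurableSet_ball T α (f Q) x ≤ L Q := fun Q x hx =>
    not_lt.1 fun h => hx (subset_toMeasurable μ _ (Or.inr h))
  have hCp0 : (Cp : ℝ≥0∞) ≠ 0 := by
    have : (0 : ℝ≥0) < Cp := one_pos.trans_le hCp1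
    exact_mod_cast this.ne'
  set κ : ℝ≥0∞ := ((4 * Cp : ℝ≥0) : ℝ≥0∞)⁻¹ with hκ
  have h4Cp : (1 : ℝ≥0) < 4 * Cp := by
    calc (1 : ℝ≥0) < 4 * 1 := by norm_num
      _ ≤ 4 * Cp := by gcongr
  have hκ1 : κ < 1 := by
    rw [hκ, ENNReal.inv_lt_one]
    exact_mod_cast h4Cp
  have hκ0 : κ ≠ 0 := ENNReal.inv_ne_zero.2 ENNReal.coe_ne_top
  have hκCp : κ * Cp = 4⁻¹ := by
    rw [hκ, ENNReal.coe_mul, ENNReal.mul_inv (Or.inl (by norm_num)) (Or.inl (by norm_num)),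
      mul_assoc, ENNReal.inv_mul_cancel hCp0 ENNReal.coe_ne_top, mul_one]
    rfl
  have hκl : 2 * ((Cα : ℝ≥0∞) / l) = κ / 2 := by
    have hCα0 : Cα ≠ 0 := (one_pos.trans_le hCα1).ne'
    have hCp0' : Cp ≠ 0 := (one_pos.trans_le hCp1).ne'
    have e : 2 * (Cα / l) = (4 * Cp)⁻¹ / 2 := by
      rw [hl]; field_simp; norm_num
    rw [hκ, ← ENNReal.coe_inv (by positivity), ← ENNReal.coe_div (by positivity)]
    have := congrArg (fun t : ℝ≥0 => (t : ℝ≥0∞)) e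
    simpa [ENNReal.coe_div two_ne_zero] using this
  have hΩsmall : ∀ Q : 𝒟.Cube, μ (Ω Q) ≤ κ / 2 * μ Q.carrier := by
    intro Q
    calc μ (Ω Q) = μ ({x | L Q < ‖T (f Q) x‖ₑ} ∪
          {x | L Q < sharpMaximal hS.measurableSet_ball T α (f Q) x}) := measure_toMeasurable _
      _ ≤ μ (Q.ball α) / l + μ (Q.ball α) / l :=
          (measure_union_le _ _).trans (add_le_add (hbad₁ Q) (hbad₂ Q))
      _ ≤ Cα * μ Q.carrier / l + Cα * μ Q.carrier / l := by gcongr <;> exact hCα Q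
      _ = 2 * ((Cα : ℝ≥0∞) / l) * μ Q.carrier := by
          rw [ENNReal.div_eq_inv_mul, ENNReal.div_eq_inv_mul]; ring
      _ = _ := by rw [hκl]
  obtain ⟨next, hrule, hnext, hnone, hhalf⟩ := exists_stoppingRule hS hcd hc₀ hC₀ hδ hδ1
    (fun Q => measurableSet_toMeasurable μ _) hκ0 hκ1
    (fun Q => (measure_mono Set.inter_subset_right).trans (hΩsmall Q)) hCp (Ω := Ω)
  -- the estimate for two consecutive stopping cubes
  have hstep : ∀ Q P, ∀ᵐ x ∂μ, next Q x = some P →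
      ‖T (lpIndicator F ((hball Q).diff (hball P))) x‖ₑ ≤ 2 * (L Q + L P) := by
    intro Q P
    by_cases hex : ∃ x, next Q x = some P
    swap
    · exact Eventually.of_forall fun x hx => absurd ⟨x, hx⟩ hex
    obtain ⟨x₀, hx₀⟩ := hex
    obtain ⟨-, -, hPQ, -⟩ := hrule Q x₀ P hx₀
    obtain ⟨hgen, hPΩ⟩ := hnext Q x₀ P hx₀
    have hsub : P.ball α ⊆ Q.ball α :=
      Cube.ball_subset_ball hS hcd hc₀ hC₀ hδ hδ1 hδd hα hPQ hgen
    set g := lpIndicator F ((hball Q).diff (hball P)) with hg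
    have hg₁ : g = lpIndicator (f Q) (hball P).compl :=
      (lpIndicator_compl_lpIndicator F (hball Q) (hball P)).symm
    have hg₂ : T g = T (f Q) - T (f P) := by
      rw [hg, lpIndicator_sdiff F (hball Q) (hball P) hsub, map_sub]
    set G := P.carrier \ (Ω Q ∪ Ω P) with hG
    -- `Ω Q` and `Ω P` each fill at most a quarter of `P`: the former by the stopping rule, the
    -- latter by `hΩsmall`.
    have hGpos : μ G ≠ 0 := by
      intro h0
      have h1 : μ P.carrier ≤ μ (P.carrier ∩ Ω Q) + μ (P.carrier ∩ Ω P) := by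
        calc μ P.carrier ≤ μ (G ∪ (P.carrier ∩ Ω Q ∪ P.carrier ∩ Ω P)) := by
              refine measure_mono fun y hy => ?_
              by_cases h : y ∈ Ω Q ∪ Ω P
              · rcases h with h | h
                · exact Or.inr (Or.inl ⟨hy, h⟩)
                · exact Or.inr (Or.inr ⟨hy, h⟩)
              · exact Or.inl ⟨hy, h⟩
          _ ≤ μ G + (μ (P.carrier ∩ Ω Q) + μ (P.carrier ∩ Ω P)) :=
              (measure_union_le _ _).trans (by gcongr; exact measure_union_le _ _)
          _ = _ := by rw [h0, zero_add]
      have h2 : μ (P.carrier ∩ Ω Q) ≤ 4⁻¹ * μ P.carrier := by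
        rw [← hκCp, mul_assoc]; exact hPΩ
      have h3 : μ (P.carrier ∩ Ω P) ≤ 4⁻¹ * μ P.carrier := by
        refine (measure_mono Set.inter_subset_right).trans ((hΩsmall P).trans ?_)
        gcongr
        rw [← hκCp]
        refine ENNReal.half_le_self.trans ?_
        exact le_mul_of_one_le_right zero_le (by exact_mod_cast hCp1)
      have h4 : μ P.carrier ≤ 2⁻¹ * μ P.carrier := by
        refine h1.trans ((add_le_add h2 h3).trans (le_of_eq ?_))
        rw [← add_mul]
        congr 1
        have : (4 : ℝ≥0∞)⁻¹ = 2⁻¹ / 2 := by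
          rw [ENNReal.div_eq_inv_mul, ← ENNReal.mul_inv (Or.inl two_ne_zero)
            (Or.inl ENNReal.ofNat_ne_top)]
          norm_num
        rw [this, ENNReal.add_halves]
      have h5 : 2⁻¹ * μ P.carrier < 1 * μ P.carrier := by
        rw [ENNReal.mul_lt_mul_iff_left (hpos P).ne' (hfin P)]
        exact ENNReal.inv_lt_one.2 ENNReal.one_lt_two
      rw [one_mul] at h5
      exact absurd h4 (not_le.2 h5)
    have hPB : P.carrier ⊆ qBall d P.center (C₀ * δ ^ P.1) := P.carrier_subset
    -- The ball around `P` has `P.ball α` as its `α`-dilate, so `g` is the truncation of `f Q` that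
    -- this ball contributes to the sharp maximal function at any of its points, in particular at
    -- one outside `Ω Q`.
    have hosc : essSup (fun z : S × S => ‖T g z.1 - T g z.2‖ₑ)
        ((μ.restrict (qBall d P.center (C₀ * δ ^ P.1))).prod
          (μ.restrict (qBall d P.center (C₀ * δ ^ P.1)))) ≤ L Q := by
      obtain ⟨y, hyP, hyΩ⟩ := nonempty_of_measure_ne_zero hGpos
      refine le_trans ?_ (hΩ₂ Q y fun h => hyΩ (Or.inl h))
      rw [hg₁]
      exact le_iSup_of_le P.center (le_iSup_of_le (C₀ * δ ^ P.1) (le_iSup_of_le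
        (mul_pos hC₀ (zpow_pos hδ _)) (le_iSup_of_le (hPB hyP) le_rfl)))
    have hsubae : T g =ᵐ[μ] T (f Q) - T (f P) := by rw [hg₂]; exact AEEqFun.coeFn_sub _ _
    have hGbound : ∀ᵐ y ∂μ, y ∈ G → ‖T g y‖ₑ ≤ L Q + L P := by
      filter_upwards [hsubae] with y hy hyG
      rw [hy, Pi.sub_apply]
      refine enorm_sub_le.trans (add_le_add ?_ ?_)
      · exact hΩ₁ Q y fun h => hyG.2 (Or.inl h)
      · exact hΩ₁ P y fun h => hyG.2 (Or.inr h)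
    filter_upwards [ae_enorm_le_of_essSup_le (hS.measurableSet_ball _ _)
      (Set.sdiff_subset.trans hPB) hGpos hosc hGbound] with y hy hyP
    refine (hy (hPB (hrule Q y P hyP).2.1)).trans ?_
    calc L Q + (L Q + L P) ≤ L Q + (L Q + L P) + L P := le_self_add
      _ = 2 * (L Q + L P) := by ring
  have hend : ∀ Q : 𝒟.Cube, ∀ᵐ x ∂μ, x ∈ Q.carrier → next Q x = none → ‖T (f Q) x‖ₑ ≤ L Q := by
    intro Q
    filter_upwards [hnone Q] with x hx hxQ hn using hΩ₁ Q x (hx hxQ hn)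
  have hext : ∀ (n : ℕ) (q : Fin (n + 1) → 𝒟.Cube) (i : ℕ), min i n < n + 1 := fun n q i => by omega
  -- The chain depends on `x`, so one null set must serve all chains; there are countably many
  -- finite ones. The index `min i n` extends a finite chain to the sequence that `ae_enorm_le_sum`
  -- takes.
  have hchain : ∀ᵐ x ∂μ, ∀ (n : ℕ) (q : Fin (n + 1) → 𝒟.Cube),
      (∀ i < n, (q ⟨min (i + 1) n, hext n q (i + 1)⟩).ball α ⊆ (q ⟨min i n, hext n q i⟩).ball α) →
      ‖T (f (q ⟨min 0 n, hext n q 0⟩)) x‖ₑ ≤ ENNReal.ofReal C_r *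
        (∑ i ∈ Finset.range n, ‖T (lpIndicator F ((hball (q ⟨min i n, hext n q i⟩)).diff
          (hball (q ⟨min (i + 1) n, hext n q (i + 1)⟩)))) x‖ₑ ^ r +
        ‖T (f (q ⟨min n n, hext n q n⟩)) x‖ₑ ^ r) ^ (1 / r) := by
    refine ae_all_iff.2 fun n => ae_all_iff.2 fun q => ?_
    by_cases h : ∀ i < n,
      (q ⟨min (i + 1) n, hext n q (i + 1)⟩).ball α ⊆ (q ⟨min i n, hext n q i⟩).ball α
    · filter_upwards [hTr.ae_enorm_le_sum hr hC F hF n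
        (fun i => (q ⟨min i n, hext n q i⟩).ball α) (fun i => hball _) h
        (fun i => ⟨_, _, subset_rfl⟩)] with x hx _
      exact hx
    · exact Eventually.of_forall fun x hx => absurd hx h
  let I : Type u := {i : ℕ × 𝒟.Cube // ∃ x, stoppingNode next root i.1 x = some i.2}
  refine ⟨I, inferInstance, fun i => i.1.2, fun i => stoppingRemainder next root i.1.1 i.1.2,
    fun i => ⟨hrule.measurableSet_stoppingRemainder _ _, hrule.stoppingRemainder_subset _ _,
      hrule.measure_le_stoppingRemainder hhalf i.2.choose_spec⟩, fun i j hij =>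
      pairwise_disjoint_stoppingRemainder fun h => hij (Subtype.ext h), ?_⟩
  filter_upwards [hrule.ae_exists_mem_stoppingRemainder hS hhalf (root := root), hchain,
    ae_all_iff.2 fun Q => ae_all_iff.2 fun P => hstep Q P, ae_all_iff.2 hend]
    with x hx1 hx2 hx3 hx4 hxroot
  obtain ⟨n, Q, hnode, hnone'⟩ := hx1 hxroot
  let qq : ℕ → 𝒟.Cube := fun i => (stoppingNode next root i x).getD root
  have hqq : ∀ i ≤ n, stoppingNode next root i x = some (qq i) := by
    intro i hi
    rcases hc : stoppingNode next root i x with _ | P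
    · have := stoppingNode_eq_none_of_le hi hc
      rw [hnode] at this
      cases this
    · simp [qq, hc]
  have hqn : qq n = Q := by
    have := hqq n le_rfl
    rw [hnode] at this
    exact (Option.some_inj.1 this).symm
  have hq0 : qq 0 = root := by
    have := hqq 0 (Nat.zero_le n)
    rw [stoppingNode, if_pos hxroot] at this
    exact (Option.some_inj.1 this).symm
  have hqnext : ∀ i < n, next (qq i) x = some (qq (i + 1)) := by
    intro i hi
    obtain ⟨P, hP1, hP2⟩ := stoppingNode_succ_eq_some.1 (hqq (i + 1) hi)
    rw [hqq i hi.le] at hP1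
    rw [Option.some_inj.1 hP1]
    exact hP2
  have hqball : ∀ i < n, (qq (i + 1)).ball α ⊆ (qq i).ball α := fun i hi =>
    Cube.ball_subset_ball hS hcd hc₀ hC₀ hδ hδ1 hδd hα (hrule _ _ _ (hqnext i hi)).2.2.1
      (hnext _ _ _ (hqnext i hi)).1
  have hmin : ∀ i ≤ n, min i n = i := fun i hi => min_eq_left hi
  have hmain := hx2 n (fun k => qq k) (fun i hi => by
    simp only [hmin i hi.le, hmin (i + 1) hi]
    exact hqball i hi)
  simp only [Nat.zero_min, hq0, min_self, hqn] at hmain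
  have hsum : ∑ i ∈ Finset.range n, ‖T (lpIndicator F ((hball (qq (min i n))).diff
      (hball (qq (min (i + 1) n))))) x‖ₑ ^ r + ‖T (f Q) x‖ₑ ^ r ≤
      ∑ i ∈ Finset.range n, (2 * (L (qq i) + L (qq (i + 1)))) ^ r + L (qq n) ^ r := by
    refine add_le_add (Finset.sum_le_sum fun i hi => ?_) ?_
    · have hi' := Finset.mem_range.1 hi
      have := hx3 (qq (min i n)) (qq (min (i + 1) n)) (by
        rw [hmin i hi'.le, hmin (i + 1) hi']; exact hqnext i hi')
      refine ENNReal.rpow_le_rpow (this.trans (le_of_eq ?_)) hr0.le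
      rw [hmin i hi'.le, hmin (i + 1) hi']
    · rw [hqn]
      exact ENNReal.rpow_le_rpow (hx4 Q (hrule.stoppingNode hnode).1 hnone') hr0.le
  refine hmain.trans ?_
  rw [mul_assoc (ENNReal.ofReal C_r)]
  gcongr
  refine (ENNReal.rpow_le_rpow hsum (by positivity)).trans
    ((sum_rpow_consecutive_le hr (fun i => L (qq i)) n).trans ?_)
  rw [mul_assoc 4]
  gcongr
  have hLr : ∀ Q, L Q ^ r = (l * N) ^ r * a Q ^ r := fun Q => by
    rw [← ENNReal.mul_rpow_of_nonneg _ _ hr0.le, mul_assoc]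
  simp only [hLr]
  rw [← Finset.mul_sum, ENNReal.mul_rpow_of_nonneg _ _ (by positivity), ← ENNReal.rpow_mul,
    mul_one_div_cancel hr0.ne', ENNReal.rpow_one]
  gcongr
  -- The cubes of the chain around `x` are distinct members of the sparse family, all containing
  -- `x`.
  let F' : Fin (n + 1) → I := fun k => ⟨(k, qq k), x, hqq k (by omega)⟩
  have hF' : Function.Injective F' := by
    intro j k hjk
    have : ((j : ℕ), qq j) = ((k : ℕ), qq k) := congrArg Subtype.val hjk
    exact Fin.ext (congrArg Prod.fst this)
  rw [← Fin.sum_univ_eq_sum_range (fun i => a (qq i) ^ r)]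
  refine le_trans (le_of_eq ?_) (ENNReal.tsum_comp_le_tsum_of_injective hF' _)
  rw [tsum_fintype]
  refine Finset.sum_congr rfl fun k _ => ?_
  rw [Set.indicator_of_mem]
  exact (hrule.stoppingNode (hqq k (by omega))).1

end SparseDomination

/-! ### Weighted bounds for countable sparse families from several systems. -/

section SparseOperator

variable {S : Type u} [MeasurableSpace S] {ι : Type*}

theorem ENNReal.sum_rpow_le_rpow_sum {s : ℝ} (hs : 1 ≤ s) (J : Finset ι) (a : ι → ℝ≥0∞) :
    ∑ i ∈ J, a i ^ s ≤ (∑ i ∈ J, a i) ^ s := by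
  classical
  induction J using Finset.induction_on with
  | empty => simp
  | insert i J hi ih =>
    rw [Finset.sum_insert hi, Finset.sum_insert hi]
    exact (add_le_add le_rfl ih).trans (ENNReal.add_rpow_le_rpow_add _ _ hs)

theorem ENNReal.rpow_sum_le_card_mul {s : ℝ} (hs : 0 < s) {m : ℕ} (a : Fin m → ℝ≥0∞) :
    (∑ i, a i) ^ s ≤ (m : ℝ≥0∞) ^ s * ∑ i, a i ^ s := by
  rcases Nat.eq_zero_or_pos m with rfl | hm
  · simp [ENNReal.zero_rpow_of_pos hs]
  have : Nonempty (Fin m) := ⟨⟨0, hm⟩⟩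
  obtain ⟨j, hj⟩ := Finite.exists_max a
  calc (∑ i, a i) ^ s ≤ (∑ _i : Fin m, a j) ^ s := by gcongr with i; exact hj i
    _ = (m : ℝ≥0∞) ^ s * a j ^ s := by
        rw [Finset.sum_const, Finset.card_univ, Fintype.card_fin, nsmul_eq_mul,
          ENNReal.mul_rpow_of_nonneg _ _ hs.le]
    _ ≤ _ := by
        gcongr
        exact Finset.single_le_sum (f := fun i => a i ^ s) (fun _ _ => zero_le) (Finset.mem_univ j)

/-- The constant in the weighted bound for sparse operators. -/
noncomputable def sparseConst (q ρ : ℝ) (C : ℝ≥0) (m : ℕ) : ℝ≥0∞ :=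
  (m : ℝ≥0∞) ^ (q / ρ) * (m * ((C : ℝ≥0∞) ^ (q - min ρ (q - 1)) *
    ENNReal.ofReal (q / (q - 1)) ^ min ρ (q - 1) * ENNReal.ofReal (q / min ρ (q - 1))) ^
      (q / min ρ (q - 1)))

theorem sparseConst_ne_top {q ρ : ℝ} (hq : 1 < q) (hρ : 0 < ρ) (C : ℝ≥0) (m : ℕ) :
    sparseConst q ρ C m ≠ ∞ := by
  have h1 : 0 < min ρ (q - 1) := lt_min hρ (by linarith)
  have h2 : 0 ≤ q - min ρ (q - 1) := by linarith [min_le_right ρ (q - 1)]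
  refine ENNReal.mul_ne_top (ENNReal.rpow_ne_top_of_nonneg (by positivity) (by simp))
    (ENNReal.mul_ne_top (by simp) (ENNReal.rpow_ne_top_of_nonneg (by positivity)
    (ENNReal.mul_ne_top (ENNReal.mul_ne_top ?_ ?_) ENNReal.ofReal_ne_top)))
  · exact ENNReal.rpow_ne_top_of_nonneg h2 ENNReal.coe_ne_top
  · exact ENNReal.rpow_ne_top_of_nonneg h1.le ENNReal.ofReal_ne_top

/-- The family is split by system, which makes each class nested, and `ρ` is lowered to `min ρ (q -
1)`, where `lintegral_sparse_le` applies. Lowering is allowed because the `ℓ^ρ` norm decreases in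
`ρ`. -/
theorem lintegral_finset_sparse_le {m : ℕ} (col : ι → Fin m) (P E : ι → Set S)
    (hP : ∀ i, MeasurableSet (P i)) (hE : ∀ i, MeasurableSet (E i))
    (hEP : ∀ i, E i ⊆ P i) (hdis : Pairwise (Function.onFun Disjoint E))
    (hlam : ∀ i j, col i = col j → Disjoint (P i) (P j) ∨ P i ⊆ P j ∨ P j ⊆ P i)
    (μ : Measure S) {w : S → ℝ≥0∞} (hw : Measurable w) (hw0 : ∀ x, w x ≠ 0) (hwt : ∀ x, w x ≠ ∞)
    {q ρ : ℝ} (hq : 1 < q) (hρ : 0 < ρ) (A C : ℝ≥0)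
    (hμ0 : ∀ i, μ (P i) ≠ 0) (hμt : ∀ i, μ (P i) ≠ ∞) (hC : ∀ i, μ (P i) ≤ C * μ (E i))
    (hA : ∀ i, (∫⁻ x in P i, w x ∂μ) * (∫⁻ x in P i, dualWeight q w x ∂μ) ^ (q - 1) ≤
      A * μ (P i) ^ q)
    {g : S → ℝ≥0∞} (hg : Measurable g) (b : ι → ℝ≥0)
    (hb : ∀ i, b i * μ (P i) ≤ ∫⁻ x in P i, g x ∂μ) (J : Finset ι) :
    ∫⁻ x, (∑ i ∈ J, (P i).indicator (fun _ => (b i : ℝ≥0∞) ^ ρ) x) ^ (q / ρ) * w x ∂μ ≤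
      sparseConst q ρ C m * (A : ℝ≥0∞) ^ (q / min ρ (q - 1)) * ∫⁻ x, g x ^ q * w x ∂μ := by
  classical
  have hq0 : 0 < q := by linarith
  set ρ' := min ρ (q - 1) with hρ'
  have hρ'0 : 0 < ρ' := lt_min hρ (by linarith)
  have hs : 1 ≤ ρ / ρ' := by rw [one_le_div hρ'0]; exact min_le_left _ _
  have hmeas : ∀ a : Fin m, Measurable fun x =>
      (∑ i ∈ J with col i = a, (P i).indicator (fun _ => (b i : ℝ≥0∞) ^ ρ') x) ^ (q / ρ') * w x :=
    fun a => ((Finset.measurable_sum _ fun i _ =>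
      measurable_const.indicator (hP i)).pow_const _).mul hw
  have hpt : ∀ x, (∑ i ∈ J, (P i).indicator (fun _ => (b i : ℝ≥0∞) ^ ρ) x) ^ (q / ρ) * w x ≤
      (m : ℝ≥0∞) ^ (q / ρ) * ∑ a : Fin m,
        ((∑ i ∈ J with col i = a, (P i).indicator (fun _ => (b i : ℝ≥0∞) ^ ρ') x) ^ (q / ρ') *
          w x) := by
    intro x
    rw [← Finset.sum_fiberwise J col, ← Finset.sum_mul, ← mul_assoc]
    gcongr
    refine (ENNReal.rpow_sum_le_card_mul (by positivity) _).trans ?_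
    gcongr with a
    have h1 : ∑ i ∈ J with col i = a, (P i).indicator (fun _ => (b i : ℝ≥0∞) ^ ρ) x ≤
        (∑ i ∈ J with col i = a, (P i).indicator (fun _ => (b i : ℝ≥0∞) ^ ρ') x) ^ (ρ / ρ') := by
      refine le_trans (le_of_eq (Finset.sum_congr rfl fun i _ => ?_))
        (ENNReal.sum_rpow_le_rpow_sum hs _ _)
      by_cases hx : x ∈ P i
      · simp only [Set.indicator_of_mem hx]
        rw [← ENNReal.rpow_mul, mul_div_cancel₀ _ hρ'0.ne']
      · simp only [Set.indicator_of_notMem hx]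
        rw [ENNReal.zero_rpow_of_pos (by positivity)]
    refine (ENNReal.rpow_le_rpow h1 (by positivity)).trans (le_of_eq ?_)
    rw [← ENNReal.rpow_mul]
    congr 1
    field_simp
  calc _ ≤ ∫⁻ x, (m : ℝ≥0∞) ^ (q / ρ) * ∑ a : Fin m,
        ((∑ i ∈ J with col i = a, (P i).indicator (fun _ => (b i : ℝ≥0∞) ^ ρ') x) ^ (q / ρ') *
          w x) ∂μ := lintegral_mono hpt
    _ = (m : ℝ≥0∞) ^ (q / ρ) * ∑ a : Fin m, ∫⁻ x,
        (∑ i ∈ J with col i = a, (P i).indicator (fun _ => (b i : ℝ≥0∞) ^ ρ') x) ^ (q / ρ') *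
          w x ∂μ := by
        rw [lintegral_const_mul _ (Finset.measurable_sum _ fun a _ => hmeas a),
          lintegral_finsetSum _ fun a _ => hmeas a]
    _ ≤ (m : ℝ≥0∞) ^ (q / ρ) * ∑ _a : Fin m,
        (((C : ℝ≥0∞) ^ (q - ρ') * ENNReal.ofReal (q / (q - 1)) ^ ρ' *
          ENNReal.ofReal (q / ρ')) ^ (q / ρ') * (A : ℝ≥0∞) ^ (q / ρ') *
            ∫⁻ x, g x ^ q * w x ∂μ) := by
        gcongr with a
        refine lintegral_sparse_le (J.filter fun i => col i = a) P E (fun i _ => hP i)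
          (fun i _ => hE i) (fun i _ => hEP i) (fun i _ j _ h => hdis h) ?_ μ hw hw0 hwt hq hρ'0
          (min_le_right _ _) A C (fun i _ => hμ0 i) (fun i _ => hμt i) (fun i _ => hC i)
          (fun i _ => hA i) hg b (fun i _ => hb i)
        intro i hi j hj
        exact hlam i j ((Finset.mem_filter.1 hi).2.trans (Finset.mem_filter.1 hj).2.symm)
    _ = _ := by
        rw [Finset.sum_const, Finset.card_univ, Fintype.card_fin, nsmul_eq_mul, sparseConst]
        ring

/-- Monotone convergence along finite subfamilies, whose bound does not depend on the subfamily.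
Finiteness had been needed for the absorption. -/
theorem lintegral_tsum_sparse_le [Countable ι] {m : ℕ} (col : ι → Fin m) (P E : ι → Set S)
    (hP : ∀ i, MeasurableSet (P i)) (hE : ∀ i, MeasurableSet (E i))
    (hEP : ∀ i, E i ⊆ P i) (hdis : Pairwise (Function.onFun Disjoint E))
    (hlam : ∀ i j, col i = col j → Disjoint (P i) (P j) ∨ P i ⊆ P j ∨ P j ⊆ P i)
    (μ : Measure S) {w : S → ℝ≥0∞} (hw : Measurable w) (hw0 : ∀ x, w x ≠ 0) (hwt : ∀ x, w x ≠ ∞)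
    {q ρ : ℝ} (hq : 1 < q) (hρ : 0 < ρ) (A C : ℝ≥0)
    (hμ0 : ∀ i, μ (P i) ≠ 0) (hμt : ∀ i, μ (P i) ≠ ∞) (hC : ∀ i, μ (P i) ≤ C * μ (E i))
    (hA : ∀ i, (∫⁻ x in P i, w x ∂μ) * (∫⁻ x in P i, dualWeight q w x ∂μ) ^ (q - 1) ≤
      A * μ (P i) ^ q)
    {g : S → ℝ≥0∞} (hg : Measurable g) (b : ι → ℝ≥0)
    (hb : ∀ i, b i * μ (P i) ≤ ∫⁻ x in P i, g x ∂μ) :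
    ∫⁻ x, (∑' i, (P i).indicator (fun _ => (b i : ℝ≥0∞) ^ ρ) x) ^ (q / ρ) * w x ∂μ ≤
      sparseConst q ρ C m * (A : ℝ≥0∞) ^ (q / min ρ (q - 1)) * ∫⁻ x, g x ^ q * w x ∂μ := by
  have hqρ : 0 < q / ρ := by have : 0 < q := by linarith
                             positivity
  have h1 : ∀ x, (∑' i, (P i).indicator (fun _ => (b i : ℝ≥0∞) ^ ρ) x) ^ (q / ρ) * w x =
      ⨆ J : Finset ι, (∑ i ∈ J, (P i).indicator (fun _ => (b i : ℝ≥0∞) ^ ρ) x) ^ (q / ρ) * w x := by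
    intro x
    rw [ENNReal.tsum_eq_iSup_sum, ← ENNReal.iSup_mul]
    congr 1
    exact (ENNReal.orderIsoRpow (q / ρ) hqρ).map_iSup _
  simp_rw [h1]
  rw [lintegral_iSup_directed_of_measurable]
  · exact iSup_le fun J => lintegral_finset_sparse_le col P E hP hE hEP hdis hlam μ hw hw0 hwt hq hρ
      A C hμ0 hμt hC hA hg b hb J
  · exact fun J => ((Finset.measurable_sum _ fun i _ =>
      measurable_const.indicator (hP i)).pow_const _).mul hw
  · refine Monotone.directed_le fun J J' h x => ?_
    dsimp only
    gcongr

end SparseOperator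

/-! ### Weighted bounds for `T` on boundedly supported functions. -/

section WeightedBound

open DyadicSystem

variable {S : Type u} [MeasurableSpace S] {d : S → S → ℝ} {μ : Measure S} {c_d c_μ c₀ C₀ δ : ℝ}
  {𝕜 : Type x} [RCLike 𝕜]
  {X : Type v} [NormedAddCommGroup X] [NormedSpace 𝕜 X]
  {Y : Type w} [NormedAddCommGroup Y] [NormedSpace 𝕜 Y] {p₁ p₂ : ℝ} {m : ℕ}

/-- The balls `αQ` over which the means are taken need not be nested or disjoint; the adjacent cubes
within one system are. The factor `2` turns the diameter bound into a strict inequality. -/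
theorem exists_adjacent_cube (hS : IsSpaceOfHomogeneousType d μ c_d c_μ) (hC₀ : 0 < C₀)
    (hδ : 0 < δ) {γ α : ℝ} (hγ : 0 < γ) (hα : 0 < α) {D : Fin m → DyadicSystem d c₀ C₀ δ}
    (hD : ∀ (s : S) (ρ : ℝ), 0 < ρ → ∃ (j : Fin m) (k : ℤ), ∃ z ∈ (D j).centers k,
        qBall d s ρ ⊆ (D j).cube k z ∧
        ∀ a ∈ (D j).cube k z, ∀ b ∈ (D j).cube k z, d a b ≤ γ * ρ)
    {𝒟 : DyadicSystem d c₀ C₀ δ} (Q : 𝒟.Cube) :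
    ∃ P : Σ j, (D j).Cube, Q.ball α ⊆ P.2.carrier ∧ P.2.carrier ⊆ Q.ball (2 * γ * α) := by
  have hρ : 0 < α * (C₀ * δ ^ Q.1) := by positivity
  obtain ⟨j, k, z, hz, h1, h2⟩ := hD Q.center _ hρ
  refine ⟨⟨j, ⟨k, ⟨z, hz⟩⟩⟩, h1, fun y hy => ?_⟩
  have h3 : d Q.center y ≤ γ * (α * (C₀ * δ ^ Q.1)) :=
    h2 _ (h1 (by simpa [qBall, hS.dist_self] using hρ)) _ hy
  have h4 : 0 < γ * (α * (C₀ * δ ^ Q.1)) := by positivity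
  change d Q.center y < 2 * γ * α * (C₀ * δ ^ Q.1)
  nlinarith

theorem nested_of_eq {D : Fin m → DyadicSystem d c₀ C₀ δ} (P Q : Σ j, (D j).Cube)
    (h : P.1 = Q.1) : Disjoint P.2.carrier Q.2.carrier ∨ P.2.carrier ⊆ Q.2.carrier ∨
      Q.2.carrier ⊆ P.2.carrier := by
  obtain ⟨j, P⟩ := P
  obtain ⟨j', Q⟩ := Q
  obtain rfl : j = j' := h
  exact Cube.nested P Q

theorem muckenhoupt_cube_le {𝒟 : DyadicSystem d c₀ C₀ δ}
    (hC₀ : 0 < C₀) (hδ : 0 < δ) {w : S → ℝ≥0∞} {q : ℝ} (hq : 1 < q) {A C : ℝ≥0}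
    (hA : ∀ c ρ, 0 < ρ → (∫⁻ x in qBall d c ρ, w x ∂μ) *
      (∫⁻ x in qBall d c ρ, dualWeight q w x ∂μ) ^ (q - 1) ≤ A * μ (qBall d c ρ) ^ q)
    {β : ℝ} (hβ : 1 ≤ β) (hC : ∀ Q : 𝒟.Cube, μ (Q.ball β) ≤ C * μ Q.carrier) (Q : 𝒟.Cube) :
    (∫⁻ x in Q.carrier, w x ∂μ) * (∫⁻ x in Q.carrier, dualWeight q w x ∂μ) ^ (q - 1) ≤
      (A * C ^ q : ℝ≥0) * μ Q.carrier ^ q := by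
  have hsub : Q.carrier ⊆ Q.ball β := Q.carrier_subset_ball hC₀ hδ hβ
  have hq1 : 0 ≤ q - 1 := by linarith
  calc _ ≤ (∫⁻ x in Q.ball β, w x ∂μ) * (∫⁻ x in Q.ball β, dualWeight q w x ∂μ) ^ (q - 1) := by
        gcongr
    _ ≤ A * μ (Q.ball β) ^ q := hA _ _ (by positivity)
    _ ≤ A * (C * μ Q.carrier) ^ q := by gcongr; exact hC Q
    _ = _ := by
        rw [ENNReal.mul_rpow_of_nonneg _ _ (by linarith), ENNReal.coe_mul,
          ENNReal.coe_rpow_of_nonneg _ (by linarith), mul_assoc]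

/-- The weighted `Lᵖ` bound for `T F` on a cube, up to the constant of the sparse operators. -/
theorem setLIntegral_cube_rpow_le (hS : IsSpaceOfHomogeneousType d μ c_d c_μ) (hcd : 1 ≤ c_d)
    (hc₀ : 0 < c₀) (hC₀ : 0 < C₀) (hδ : 0 < δ) (hδ1 : δ < 1) (hδd : 2 * c_d * δ ≤ 1)
    {γ α : ℝ} (hγ : 1 ≤ γ) (hα : 2 * c_d ≤ α) {D : Fin m → DyadicSystem d c₀ C₀ δ}
    (hD : ∀ (s : S) (ρ : ℝ), 0 < ρ → ∃ (j : Fin m) (k : ℤ), ∃ z ∈ (D j).centers k,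
        qBall d s ρ ⊆ (D j).cube k z ∧
        ∀ a ∈ (D j).cube k z, ∀ b ∈ (D j).cube k z, d a b ≤ γ * ρ)
    {C : ℝ≥0} (hC1 : 1 ≤ C)
    (hC : ∀ j, ∀ Q : (D j).Cube, μ (Q.ball (2 * γ * α)) ≤ C * μ Q.carrier)
    (hCp : ∀ j k x, μ ((D j).cubeAt k x).carrier ≤ C * μ ((D j).cubeAt (k + 1) x).carrier)
    (hp₁ : 1 ≤ p₁) (hp₂ : 1 ≤ p₂) (T : Lp X (ENNReal.ofReal p₁) μ →ₗ[𝕜] (S →ₘ[μ] Y))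
    (hT₁ : weakOpNorm T < ∞) (hT₂ : sharpMaximalOpNorm hS.measurableSet_ball T α p₂ < ∞)
    {r C_r : ℝ} (hr : 1 ≤ r) (hC_r : 0 ≤ C_r) (hTr : IsRSublinear d T (max p₁ p₂) r C_r)
    {p : ℝ} (hp : max p₁ p₂ < p) {w : S → ℝ≥0∞} (hw : Measurable w) (hw0 : ∀ x, w x ≠ 0)
    (hwt : ∀ x, w x ≠ ∞) {A : ℝ≥0}
    (hA : ∀ c ρ, 0 < ρ → (∫⁻ x in qBall d c ρ, w x ∂μ) *
      (∫⁻ x in qBall d c ρ, dualWeight (p / max p₁ p₂) w x ∂μ) ^ (p / max p₁ p₂ - 1) ≤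
        A * μ (qBall d c ρ) ^ (p / max p₁ p₂))
    (F : Lp X (ENNReal.ofReal p₁) μ) (hF : MemLp F (ENNReal.ofReal (max p₁ p₂)) μ)
    (j₀ : Fin m) (root : (D j₀).Cube) :
    ∫⁻ x in root.carrier, ‖T (lpIndicator F (root.measurableSet_ball hS α)) x‖ₑ ^ p * w x ∂μ ≤
      (ENNReal.ofReal C_r * (4 * ((16 * C * C : ℝ≥0) * (weakOpNorm T +
            sharpMaximalOpNorm hS.measurableSet_ball T α p₂)))) ^ p *
        ((C : ℝ≥0∞) ^ (p / max p₁ p₂) *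
          (sparseConst (p / max p₁ p₂) (r / max p₁ p₂) (C * 2) m *
            ((A * C ^ (p / max p₁ p₂) : ℝ≥0) : ℝ≥0∞) ^
              (p / max p₁ p₂ / min (r / max p₁ p₂) (p / max p₁ p₂ - 1)) *
            ∫⁻ x, ‖F x‖ₑ ^ p * w x ∂μ)) := by
  set p₀ := max p₁ p₂ with hp₀
  have hp₀1 : 1 ≤ p₀ := hp₁.trans (le_max_left _ _)
  have hp₀0 : 0 < p₀ := by linarith
  have hp0 : 0 < p := by linarith
  have hr0 : 0 < r := by linarith
  have hq : 1 < p / p₀ := by rwa [one_lt_div hp₀0]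
  have hα0 : 0 < α := by linarith
  have hα1 : 1 ≤ α := by linarith
  have hβ : α ≤ 2 * γ * α := by nlinarith
  have hCα : ∀ Q : (D j₀).Cube, μ (Q.ball α) ≤ C * μ Q.carrier := fun Q =>
    (measure_mono (qBall_mono (by gcongr))).trans (hC j₀ Q)
  obtain ⟨I, _, Q, E, hE, hdis, hdom⟩ := exists_sparse_domination hS hcd hc₀ hC₀ hδ hδ1 hδd hα
    hC1 hC1 hCα (hCp j₀) hp₁ hp₂ T hT₁ hT₂ hr hC_r hTr F hF root
  rw [← hp₀] at hdom
  choose P hQP hPQ using fun i => exists_adjacent_cube hS hC₀ hδ (by linarith : 0 < γ) hα0 hD (Q i)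
  set M := ENNReal.ofReal C_r * (4 * ((16 * C * C : ℝ≥0) * (weakOpNorm T +
            sharpMaximalOpNorm hS.measurableSet_ball T α p₂))) with hM
  have hQP' : ∀ i, (Q i).carrier ⊆ (P i).2.carrier := fun i =>
    ((Q i).carrier_subset_ball hC₀ hδ hα1).trans (hQP i)
  have hpos : ∀ i, μ (P i).2.carrier ≠ 0 := fun i => ((P i).2.measure_pos hS hc₀ hδ).ne'
  have hfin : ∀ i, μ (P i).2.carrier ≠ ∞ := fun i => ((P i).2.measure_lt_top hS).ne
  have hμP : ∀ i, μ (P i).2.carrier ≤ C * μ (Q i).carrier := fun i =>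
    (measure_mono (hPQ i)).trans (hC j₀ (Q i))
  have hFp : ∫⁻ x, ‖F x‖ₑ ^ p₀ ∂μ ≠ ∞ := by
    have h1 := hF.2.ne
    rw [eLpNorm_ofReal_eq hp₀0] at h1
    intro h
    rw [h, ENNReal.top_rpow_of_pos (by positivity)] at h1
    exact h1 rfl
  let b : I → ℝ≥0 := fun i =>
    ((μ (P i).2.carrier)⁻¹ * ∫⁻ x in (P i).2.carrier, ‖F x‖ₑ ^ p₀ ∂μ).toNNReal
  have hbc : ∀ i, (b i : ℝ≥0∞) =
      (μ (P i).2.carrier)⁻¹ * ∫⁻ x in (P i).2.carrier, ‖F x‖ₑ ^ p₀ ∂μ := fun i =>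
    ENNReal.coe_toNNReal (ENNReal.mul_ne_top (ENNReal.inv_ne_top.2 (hpos i))
      (ne_top_of_le_ne_top hFp (setLIntegral_le_lintegral _ _)))
  -- Passing from `αQ` to the larger cube `P i` costs a factor `C`, since the measures are
  -- comparable. The sets `E i` are kept, which turns the sparseness constant `2` into `2 C`.
  have hmean : ∀ i, pMean p₀ μ F ((Q i).ball α) ^ r ≤
      (C : ℝ≥0∞) ^ (r / p₀) * (b i : ℝ≥0∞) ^ (r / p₀) := by
    intro i
    rw [pMean, ← ENNReal.rpow_mul, one_div, inv_mul_eq_div,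
      ← ENNReal.mul_rpow_of_nonneg _ _ (by positivity : 0 ≤ r / p₀), hbc, ← mul_assoc]
    gcongr
    · rw [← div_eq_mul_inv, ENNReal.le_div_iff_mul_le (Or.inl (hpos i)) (Or.inl (hfin i)),
        ← ENNReal.div_eq_inv_mul]
      refine ENNReal.div_le_of_le_mul ((hμP i).trans ?_)
      gcongr
      exact (Q i).carrier_subset_ball hC₀ hδ hα1
    · exact hQP i
  have hsum : ∀ x, (∑' i, (Q i).carrier.indicator (fun _ => pMean p₀ μ F ((Q i).ball α) ^ r) x) ≤
      (C : ℝ≥0∞) ^ (r / p₀) *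
        ∑' i, (P i).2.carrier.indicator (fun _ => (b i : ℝ≥0∞) ^ (r / p₀)) x := by
    intro x
    rw [← ENNReal.tsum_mul_left]
    refine ENNReal.tsum_le_tsum fun i => ?_
    by_cases hx : x ∈ (Q i).carrier
    · rw [Set.indicator_of_mem hx, Set.indicator_of_mem (hQP' i hx)]
      exact hmean i
    · rw [Set.indicator_of_notMem hx]
      exact zero_le
  have hpt : ∀ᵐ x ∂μ.restrict root.carrier,
      ‖T (lpIndicator F (root.measurableSet_ball hS α)) x‖ₑ ^ p * w x ≤
      M ^ p * ((C : ℝ≥0∞) ^ (p / p₀) *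
        ((∑' i, (P i).2.carrier.indicator (fun _ => (b i : ℝ≥0∞) ^ (r / p₀)) x) ^
          (p / p₀ / (r / p₀)) * w x)) := by
    rw [ae_restrict_iff' root.measurableSet]
    filter_upwards [hdom] with x hx hxr
    rw [← mul_assoc, ← mul_assoc]
    gcongr
    refine (ENNReal.rpow_le_rpow (hx hxr) hp0.le).trans ?_
    rw [ENNReal.mul_rpow_of_nonneg _ _ hp0.le, mul_assoc]
    gcongr
    rw [← ENNReal.rpow_mul]
    refine (ENNReal.rpow_le_rpow (hsum x) (by positivity)).trans (le_of_eq ?_)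
    rw [ENNReal.mul_rpow_of_nonneg _ _ (by positivity), ← ENNReal.rpow_mul]
    congr 2 <;> field_simp
  have hmeas : Measurable fun x =>
      (∑' i, (P i).2.carrier.indicator (fun _ => (b i : ℝ≥0∞) ^ (r / p₀)) x) ^
          (p / p₀ / (r / p₀)) * w x :=
    ((Measurable.tsum fun i =>
      measurable_const.indicator (P i).2.measurableSet).pow_const _).mul hw
  refine (lintegral_mono_ae hpt).trans ((setLIntegral_le_lintegral _ _).trans ?_)
  rw [lintegral_const_mul _ (hmeas.const_mul _), lintegral_const_mul _ hmeas]
  gcongr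
  have hg : ∀ x, (‖F x‖ₑ ^ p₀) ^ (p / p₀) = ‖F x‖ₑ ^ p := fun x => by
    rw [← ENNReal.rpow_mul, mul_div_cancel₀ _ hp₀0.ne']
  simp_rw [← hg]
  refine lintegral_tsum_sparse_le (fun i => (P i).1) (fun i => (P i).2.carrier) E
    (fun i => (P i).2.measurableSet) (fun i => (hE i).1) (fun i => (hE i).2.1.trans (hQP' i)) hdis
    (fun i j h => nested_of_eq _ _ h) μ hw hw0 hwt hq (by positivity) _ _ hpos hfin ?_
    (fun i => muckenhoupt_cube_le hC₀ hδ hq hA (hα1.trans hβ) (hC _) _)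
    ((Lp.stronglyMeasurable F).enorm.pow_const _) b ?_
  · intro i
    rw [ENNReal.coe_mul, mul_assoc]
    refine (hμP i).trans ?_
    gcongr
    exact (hE i).2.2
  · intro i
    rw [hbc, mul_comm, ← mul_assoc, ENNReal.mul_inv_cancel (hpos i) (hfin i), one_mul]

/-- The weighted `Lᵖ` bound for `T F`, for boundedly supported `F`. -/
theorem lintegral_rpow_le_of_bounded_support (hS : IsSpaceOfHomogeneousType d μ c_d c_μ)
    (hcd : 1 ≤ c_d)
    (hc₀ : 0 < c₀) (hC₀ : 0 < C₀) (hδ : 0 < δ) (hδ1 : δ < 1) (hδd : 2 * c_d * δ ≤ 1)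
    {γ α : ℝ} (hγ : 1 ≤ γ) (hα : 2 * c_d ≤ α) {D : Fin m → DyadicSystem d c₀ C₀ δ}
    (hD : ∀ (s : S) (ρ : ℝ), 0 < ρ → ∃ (j : Fin m) (k : ℤ), ∃ z ∈ (D j).centers k,
        qBall d s ρ ⊆ (D j).cube k z ∧
        ∀ a ∈ (D j).cube k z, ∀ b ∈ (D j).cube k z, d a b ≤ γ * ρ)
    {C : ℝ≥0} (hC1 : 1 ≤ C)
    (hC : ∀ j, ∀ Q : (D j).Cube, μ (Q.ball (2 * γ * α)) ≤ C * μ Q.carrier)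
    (hCp : ∀ j k x, μ ((D j).cubeAt k x).carrier ≤ C * μ ((D j).cubeAt (k + 1) x).carrier)
    (hp₁ : 1 ≤ p₁) (hp₂ : 1 ≤ p₂) (T : Lp X (ENNReal.ofReal p₁) μ →ₗ[𝕜] (S →ₘ[μ] Y))
    (hT₁ : weakOpNorm T < ∞) (hT₂ : sharpMaximalOpNorm hS.measurableSet_ball T α p₂ < ∞)
    {r C_r : ℝ} (hr : 1 ≤ r) (hC_r : 0 ≤ C_r) (hTr : IsRSublinear d T (max p₁ p₂) r C_r)
    {p : ℝ} (hp : max p₁ p₂ < p) {w : S → ℝ≥0∞} (hw : Measurable w) (hw0 : ∀ x, w x ≠ 0)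
    (hwt : ∀ x, w x ≠ ∞) {A : ℝ≥0}
    (hA : ∀ c ρ, 0 < ρ → (∫⁻ x in qBall d c ρ, w x ∂μ) *
      (∫⁻ x in qBall d c ρ, dualWeight (p / max p₁ p₂) w x ∂μ) ^ (p / max p₁ p₂ - 1) ≤
        A * μ (qBall d c ρ) ^ (p / max p₁ p₂))
    (F : Lp X (ENNReal.ofReal p₁) μ) (hF : MemLp F (ENNReal.ofReal (max p₁ p₂)) μ)
    {c : S} {R : ℝ} (hsupp : ∀ᵐ x ∂μ, x ∉ qBall d c R → F x = 0) :
    ∫⁻ x, ‖T F x‖ₑ ^ p * w x ∂μ ≤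
      (ENNReal.ofReal C_r * (4 * ((16 * C * C : ℝ≥0) * (weakOpNorm T +
            sharpMaximalOpNorm hS.measurableSet_ball T α p₂)))) ^ p *
        ((C : ℝ≥0∞) ^ (p / max p₁ p₂) *
          (sparseConst (p / max p₁ p₂) (r / max p₁ p₂) (C * 2) m *
            ((A * C ^ (p / max p₁ p₂) : ℝ≥0) : ℝ≥0∞) ^
              (p / max p₁ p₂ / min (r / max p₁ p₂) (p / max p₁ p₂ - 1)) *
            ∫⁻ x, ‖F x‖ₑ ^ p * w x ∂μ)) := by
  have hdir : Directed (· ⊆ ·) fun n : ℕ => qBall d c n :=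
    Monotone.directed_le fun n k h => qBall_mono (by exact_mod_cast h)
  rw [← setLIntegral_univ, ← IsSpaceOfHomogeneousType.iUnion_qBall (d := d) c, setLIntegral_iUnion_of_directed _ hdir]
  refine iSup_le fun n => ?_
  have hρ : 0 < max (n + 1 : ℝ) R := lt_max_of_lt_left (by positivity)
  -- The root must contain the ball of integration and the support of `F`. Cubes of a single dyadic
  -- system need not exhaust the space, so the root is taken from whichever adjacent system has one;
  -- its system may vary with `n`.
  obtain ⟨j, k, z, hz, hsub, -⟩ := hD c _ hρ
  let root : (D j).Cube := ⟨k, ⟨z, hz⟩⟩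
  have hroot : qBall d c (max (n + 1 : ℝ) R) ⊆ root.carrier := hsub
  have hn : qBall d c n ⊆ root.carrier :=
    (qBall_mono ((by linarith : (n : ℝ) ≤ n + 1).trans (le_max_left _ _))).trans hroot
  have hFroot : lpIndicator F (root.measurableSet_ball hS α) = F := by
    refine Lp.ext ((lpIndicator_coe F _).trans ?_)
    filter_upwards [hsupp] with x hx
    by_cases hxr : x ∈ root.ball α
    · rw [Set.indicator_of_mem hxr]
    · rw [Set.indicator_of_notMem hxr, hx fun h => hxr
        (root.carrier_subset_ball hC₀ hδ (by linarith) (hroot (qBall_mono (le_max_right _ _) h)))]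
  have hmain := setLIntegral_cube_rpow_le hS hcd hc₀ hC₀ hδ hδ1 hδd hγ hα hD hC1 hC hCp hp₁ hp₂ T
    hT₁ hT₂ hr hC_r hTr hp hw hw0 hwt hA F hF j root
  rw [hFroot] at hmain
  exact (lintegral_mono_set hn).trans hmain

end WeightedBound

/-! ### Muckenhoupt weights and the constant `K`. -/

section Weights

variable {S : Type u} [MeasurableSpace S] {d : S → S → ℝ} {μ : Measure S} {c_d c_μ : ℝ}

theorem IsWeight.aemeasurable {W : S → ℝ} (hW : IsWeight d μ W) [Nonempty S] :
    AEMeasurable (fun x => ENNReal.ofReal (W x)) μ := by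
  obtain ⟨c⟩ := ‹Nonempty S›
  have h : AEMeasurable (fun x => ENNReal.ofReal (W x)) (μ.restrict (⋃ n : ℕ, qBall d c n)) :=
    aemeasurable_iUnion_iff.2 fun n =>
      (hW.integrableOn_ball c n).aestronglyMeasurable.aemeasurable.ennreal_ofReal
  rwa [IsSpaceOfHomogeneousType.iUnion_qBall, Measure.restrict_univ] at h

/-- A weight is only almost everywhere measurable; the sparse estimates need a measurable version
that is positive and finite at every point. -/
theorem IsWeight.exists_measurable {W : S → ℝ} (hW : IsWeight d μ W) [Nonempty S] :
    ∃ v : S → ℝ≥0∞, Measurable v ∧ (∀ x, v x ≠ 0) ∧ (∀ x, v x ≠ ∞) ∧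
      (fun x => ENNReal.ofReal (W x)) =ᵐ[μ] v := by
  classical
  have hf := hW.aemeasurable
  set f := hf.mk
  refine ⟨fun x => if hf.mk _ x = 0 ∨ hf.mk _ x = ∞ then 1 else hf.mk _ x, ?_, ?_, ?_, ?_⟩
  · refine Measurable.ite ?_ measurable_const hf.measurable_mk
    exact (hf.measurable_mk (measurableSet_singleton 0)).union
      (hf.measurable_mk (measurableSet_singleton ∞))
  · intro x
    dsimp only
    split_ifs with h
    · exact one_ne_zero
    · exact fun h' => h (Or.inl h')
  · intro x
    dsimp only
    split_ifs with h
    · exact ENNReal.one_ne_top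
    · exact fun h' => h (Or.inr h')
  · filter_upwards [hf.ae_eq_mk] with x hx
    rw [← hx, if_neg]
    simp [hW.pos x]

theorem muckenhoupt_ball_le (hS : IsSpaceOfHomogeneousType d μ c_d c_μ) {W : S → ℝ}
    (hW : IsWeight d μ W) {v : S → ℝ≥0∞} (hv : (fun x => ENNReal.ofReal (W x)) =ᵐ[μ] v) {q : ℝ}
    (hq : 1 < q) (c : S) {ρ : ℝ} (hρ : 0 < ρ) :
    (∫⁻ x in qBall d c ρ, v x ∂μ) * (∫⁻ x in qBall d c ρ, dualWeight q v x ∂μ) ^ (q - 1) ≤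
      muckenhouptChar d μ q W * μ (qBall d c ρ) ^ q := by
  set B := qBall d c ρ
  have h0 : μ B ≠ 0 := (hS.measure_ball_pos c ρ hρ).ne'
  have ht : μ B ≠ ∞ := (hS.measure_ball_lt_top c ρ hρ).ne
  have hq1 : 0 ≤ q - 1 := by linarith
  have h1 : ∫⁻ x in B, v x ∂μ = (⨍⁻ s in B, ENNReal.ofReal (W s) ∂μ) * μ B := by
    rw [setLAverage_eq, ENNReal.div_mul_cancel h0 ht]
    exact lintegral_congr_ae (ae_restrict_of_ae (hv.mono fun x hx => hx.symm))
  have h2 : ∫⁻ x in B, dualWeight q v x ∂μ =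
      (⨍⁻ s in B, ENNReal.ofReal (W s)⁻¹ ^ (1 / (q - 1)) ∂μ) * μ B := by
    rw [setLAverage_eq, ENNReal.div_mul_cancel h0 ht]
    refine lintegral_congr_ae (ae_restrict_of_ae (hv.mono fun x hx => ?_))
    dsimp only [dualWeight] at hx ⊢
    rw [← hx, ENNReal.ofReal_inv_of_pos (hW.pos x), ENNReal.inv_rpow,
      ENNReal.rpow_neg]
  have h3 : μ B ^ q = μ B * μ B ^ (q - 1) := by
    nth_rewrite 2 [← ENNReal.rpow_one (μ B)]
    rw [← ENNReal.rpow_add _ _ h0 ht, add_sub_cancel]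
  rw [h1, h2, ENNReal.mul_rpow_of_nonneg _ _ hq1, h3, mul_mul_mul_comm]
  gcongr
  exact le_iSup_of_le c (le_iSup_of_le ρ (le_iSup_of_le hρ le_rfl))

/-- The power of the characteristic after taking `p`-th roots: `1 / r` if `r ≤ p - p₀`, and `1 / (p
- p₀)` in the case where the exponent had to be lowered. -/
theorem weight_exponent_eq {p₀ p r : ℝ} (hp₀ : 0 < p₀) (hp : p₀ < p) (hr : 0 < r) :
    p / p₀ / min (r / p₀) (p / p₀ - 1) * (1 / p) = max (1 / (p - p₀)) (1 / r) := by
  have hp0 : 0 < p := hp₀.trans hp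
  have hpp : 0 < p - p₀ := by linarith
  have e : p / p₀ - 1 = (p - p₀) / p₀ := by field_simp
  rw [e]
  rcases le_total r (p - p₀) with h | h
  · rw [min_eq_left (by gcongr), max_eq_right (one_div_le_one_div_of_le hr h)]
    field_simp
  · rw [min_eq_right (by gcongr), max_eq_left (one_div_le_one_div_of_le hpp h)]
    field_simp

theorem eLpNorm_withDensity_eq {Z : Type*} [NormedAddCommGroup Z] {p : ℝ} (hp : 0 < p)
    {v : S → ℝ≥0∞} (hv : Measurable v) {g : S → Z} (hg : StronglyMeasurable g) :
    eLpNorm g (ENNReal.ofReal p) (μ.withDensity v) = (∫⁻ x, ‖g x‖ₑ ^ p * v x ∂μ) ^ (1 / p) := by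
  rw [eLpNorm_ofReal_eq hp, lintegral_withDensity_eq_lintegral_mul _ hv (hg.enorm.pow_const _)]
  simp_rw [Pi.mul_apply, mul_comm]

/-- The weighted bound for `T`, on boundedly supported functions. -/
theorem exists_weighted_bound (c_d c_μ : ℝ) (hcd : 1 ≤ c_d) (hcμ : 1 ≤ c_μ) {p₀ p r α : ℝ}
    (hp₀ : 1 ≤ p₀) (hp : p₀ < p) (hr : 1 ≤ r) (hα : 2 * c_d ≤ α) :
    ∃ K : ℝ≥0, ∀ (S : Type u) [MeasurableSpace S] (d : S → S → ℝ) (μ : Measure S)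
      (hS : IsSpaceOfHomogeneousType d μ c_d c_μ)
      (𝕜 : Type x) [RCLike 𝕜]
      (X : Type v) [NormedAddCommGroup X] [NormedSpace 𝕜 X]
      (Y : Type w) [NormedAddCommGroup Y] [NormedSpace 𝕜 Y]
      (p₁ p₂ : ℝ), 1 ≤ p₁ → 1 ≤ p₂ → p₀ = max p₁ p₂ →
      ∀ (T : Lp X (ENNReal.ofReal p₁) μ →ₗ[𝕜] (S →ₘ[μ] Y)) (C_r : ℝ),
      weakOpNorm T < ∞ →
      sharpMaximalOpNorm hS.measurableSet_ball T α p₂ < ∞ →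
      0 < C_r → IsRSublinear d T p₀ r C_r →
      ∀ W : S → ℝ, IsWeight d μ W → muckenhouptChar d μ (p / p₀) W < ∞ →
      ∀ F : Lp X (ENNReal.ofReal p₁) μ, MemLp F (ENNReal.ofReal p₀) μ →
      (∃ (c : S) (R : ℝ), ∀ᵐ x ∂μ, x ∉ qBall d c R → F x = 0) →
        eLpNorm (T F) (ENNReal.ofReal p) (weightedMeasure μ W) ≤
          K * (weakOpNorm T + sharpMaximalOpNorm hS.measurableSet_ball T α p₂)
            * ENNReal.ofReal C_r * muckenhouptChar d μ (p / p₀) W ^ max (1 / (p - p₀)) (1 / r) *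
          eLpNorm F (ENNReal.ofReal p) (weightedMeasure μ W) := by
  -- Every constant below comes from this universal choice of parameters, which makes `K` uniform
  -- over all spaces; `n₁` counts the doublings for dilated cubes and `n₂` those for parents of
  -- cubes.
  obtain ⟨c₀, C₀, δ, γ, m, hδd, hadj⟩ := exists_hasAdjacentDyadicSystems.{u} c_d c_μ hcd hcμ
  obtain ⟨n₁, hn₁⟩ := pow_unbounded_of_one_lt (c_d * (2 * γ * α * C₀) / c₀) one_lt_two
  obtain ⟨n₂, hn₂⟩ := pow_unbounded_of_one_lt (c_d * (2 * c_d * C₀ + C₀) / (c₀ * δ)) one_lt_two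
  set n := max n₁ n₂ with hn
  set C : ℝ≥0 := c_μ.toNNReal ^ n with hCdef
  set q := p / p₀ with hq
  set e := q / min (r / p₀) (q - 1) with he
  set K₁ := sparseConst q (r / p₀) (C * 2) m with hK₁
  have hp₀0 : 0 < p₀ := by linarith
  have hp0 : 0 < p := by linarith
  have hq1 : 1 < q := by rwa [hq, one_lt_div hp₀0]
  have hr0 : 0 < r := by linarith
  have he0 : 0 ≤ e := by
    have : 0 < min (r / p₀) (q - 1) := lt_min (by positivity) (by linarith)
    positivity
  have hK₁t : K₁ ≠ ∞ := sparseConst_ne_top hq1 (by positivity) _ _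
  set K₂ : ℝ≥0∞ := 4 * (16 * C * C : ℝ≥0) *
    ((C : ℝ≥0∞) ^ q * (K₁ * ((C ^ q : ℝ≥0) : ℝ≥0∞) ^ e)) ^ (1 / p) with hK₂
  have hK₂t : K₂ ≠ ∞ := by
    refine ENNReal.mul_ne_top (ENNReal.mul_ne_top ENNReal.ofNat_ne_top ENNReal.coe_ne_top)
      (ENNReal.rpow_ne_top_of_nonneg (by positivity) (ENNReal.mul_ne_top ?_
      (ENNReal.mul_ne_top hK₁t ?_)))
    · exact ENNReal.rpow_ne_top_of_nonneg (by positivity) ENNReal.coe_ne_top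
    · exact ENNReal.rpow_ne_top_of_nonneg he0 ENNReal.coe_ne_top
  refine ⟨K₂.toNNReal, ?_⟩
  rw [ENNReal.coe_toNNReal hK₂t]
  intro S _ d μ hS 𝕜 _ X _ _ Y _ _ p₁ p₂ hp₁ hp₂ hp₁₂ T C_r hT₁ hT₂ hC_r hTr W hW hchar F hF hsupp
  obtain ⟨c, R, hsupp⟩ := hsupp
  have : Nonempty S := ⟨c⟩
  obtain ⟨hc₀, hcC, hδ, hδ1, hγ, D, hD⟩ := hadj S d μ hS
  have hC₀ : 0 < C₀ := hc₀.trans_le hcC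
  have hC1 : 1 ≤ C := by
    rw [hCdef]
    exact one_le_pow₀ (by simpa using hcμ)
  have hCcoe : (C : ℝ≥0∞) = ENNReal.ofReal c_μ ^ n := by
    rw [hCdef, ENNReal.coe_pow]; rfl
  have hC : ∀ j, ∀ Q : (D j).Cube, μ (Q.ball (2 * γ * α)) ≤ C * μ Q.carrier := by
    intro j Q
    rw [hCcoe]
    refine Q.measure_ball_le hS hcd hc₀ hδ ?_
    rw [div_lt_iff₀ hc₀] at hn₁
    refine hn₁.le.trans ?_
    gcongr
    · exact one_le_two
    · exact le_max_left _ _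
  have hCp : ∀ j k x, μ ((D j).cubeAt k x).carrier ≤ C * μ ((D j).cubeAt (k + 1) x).carrier := by
    intro j k x
    rw [hCcoe]
    refine DyadicSystem.measure_cubeAt_le hS hcd hc₀ hC₀ hδ hδ1 ?_ k x
    rw [div_lt_iff₀ (by positivity)] at hn₂
    refine hn₂.le.trans ?_
    gcongr
    · exact one_le_two
    · exact le_max_right _ _
  obtain ⟨v, hv, hv0, hvt, hWv⟩ := hW.exists_measurable
  subst hp₁₂
  set A := (muckenhouptChar d μ q W).toNNReal with hA
  have hAc : (A : ℝ≥0∞) = muckenhouptChar d μ q W := ENNReal.coe_toNNReal hchar.ne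
  have hmain := lintegral_rpow_le_of_bounded_support hS hcd hc₀ hC₀ hδ hδ1 hδd hγ hα hD hC1 hC hCp
    hp₁ hp₂ T hT₁ hT₂ hr hC_r.le hTr hp hv hv0 hvt (A := A)
    (fun c ρ hρ => by rw [hAc]; exact muckenhoupt_ball_le hS hW hWv hq1 c hρ) F hF hsupp
  rw [← hq, ← he, ← hK₁] at hmain
  have hν : weightedMeasure μ W = μ.withDensity v := withDensity_congr_ae hWv
  have hp0' : 0 ≤ 1 / p := by positivity
  rw [hν, eLpNorm_withDensity_eq hp0 hv (T F).stronglyMeasurable,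
    eLpNorm_withDensity_eq hp0 hv (Lp.stronglyMeasurable F)]
  refine (ENNReal.rpow_le_rpow hmain hp0').trans (le_of_eq ?_)
  rw [ENNReal.mul_rpow_of_nonneg _ _ hp0', ← ENNReal.rpow_mul, mul_one_div_cancel hp0.ne',
    ENNReal.rpow_one, ENNReal.coe_mul A, ENNReal.mul_rpow_of_nonneg _ _ he0, hAc, hK₂,
    ← weight_exponent_eq hp₀0 hp hr0, ← hq, ← he, ENNReal.rpow_mul,
    show (C : ℝ≥0∞) ^ q * (K₁ * (muckenhouptChar d μ q W ^ e * ((C ^ q : ℝ≥0) : ℝ≥0∞) ^ e) *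
      ∫⁻ x, ‖F x‖ₑ ^ p * v x ∂μ) = ((C : ℝ≥0∞) ^ q * (K₁ * ((C ^ q : ℝ≥0) : ℝ≥0∞) ^ e)) *
        (muckenhouptChar d μ q W ^ e * ∫⁻ x, ‖F x‖ₑ ^ p * v x ∂μ) by ring,
    ENNReal.mul_rpow_of_nonneg _ _ hp0', ENNReal.mul_rpow_of_nonneg (muckenhouptChar d μ q W ^ e) _
    hp0']
  ring

end Weights

/-! ### Removing the bounded support. -/

section Truncation

variable {S : Type u} [MeasurableSpace S] {d : S → S → ℝ} {μ ν : Measure S} {c_d c_μ : ℝ}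
  {𝕜 : Type x} [RCLike 𝕜]
  {X : Type v} [NormedAddCommGroup X] [NormedSpace 𝕜 X]
  {Y : Type w} [NormedAddCommGroup Y] [NormedSpace 𝕜 Y] {p₁ : ℝ}

theorem tendsto_eLpNorm_indicator_compl {p : ℝ} (hp : 0 < p) {G : S → X}
    (hG : MemLp G (ENNReal.ofReal p) ν) {B : ℕ → Set S} (hB : ∀ n, MeasurableSet (B n))
    (hmono : Monotone B) (hcover : ⋃ n, B n = Set.univ) :
    Tendsto (fun n => eLpNorm ((B n)ᶜ.indicator G) (ENNReal.ofReal p) ν) atTop (nhds 0) := by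
  have hint : ∫⁻ x, ‖G x‖ₑ ^ p ∂ν ≠ ∞ := by
    have h1 := hG.2.ne
    rw [eLpNorm_ofReal_eq hp] at h1
    intro h
    rw [h, ENNReal.top_rpow_of_pos (by positivity)] at h1
    exact h1 rfl
  have h : Tendsto (fun n => ∫⁻ x, ‖(B n)ᶜ.indicator G x‖ₑ ^ p ∂ν) atTop
      (nhds (∫⁻ _, 0 ∂ν)) := by
    refine tendsto_lintegral_of_dominated_convergence' (fun x => ‖G x‖ₑ ^ p)
      (fun n => (hG.1.indicator (hB n).compl).enorm.pow_const _)
      (fun n => ae_of_all _ fun x => ?_) hint (ae_of_all _ fun x => ?_)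
    · dsimp only
      gcongr
      exact enorm_indicator_le_enorm_self _ _
    · obtain ⟨n, hn⟩ := Set.mem_iUnion.1 (hcover.symm ▸ Set.mem_univ x)
      refine tendsto_const_nhds.congr' ?_
      filter_upwards [eventually_ge_atTop n] with k hk
      rw [Set.indicator_of_notMem (Set.notMem_compl_iff.2 (hmono hk hn)), enorm_zero, ENNReal.zero_rpow_of_pos hp]
  rw [lintegral_zero] at h
  simp_rw [eLpNorm_ofReal_eq hp]
  have h2 := h.ennrpow_const (1 / p)
  rwa [ENNReal.zero_rpow_of_pos (by positivity)] at h2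

/-- The weak-type bound does not give convergence in norm, but convergence in measure is enough to
extract a subsequence that converges almost everywhere. -/
theorem tendstoInMeasure_of_weakOpNorm (hp₁ : 0 < p₁)
    (T : Lp X (ENNReal.ofReal p₁) μ →ₗ[𝕜] (S →ₘ[μ] Y)) (hT : weakOpNorm T < ∞)
    (f : ℕ → Lp X (ENNReal.ofReal p₁) μ) (F : Lp X (ENNReal.ofReal p₁) μ)
    (hf : Tendsto (fun n => eLpNorm (F - f n : Lp X (ENNReal.ofReal p₁) μ)
      (ENNReal.ofReal p₁) μ) atTop (nhds 0)) :
    TendstoInMeasure μ (fun n => (T (f n) : S → Y)) atTop (T F) := by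
  refine tendstoInMeasure_of_ne_top fun ε hε hεt => ?_
  obtain ⟨t, ht0, ht⟩ := ENNReal.lt_iff_exists_nnreal_btwn.1 hε
  have ht0' : (t : ℝ≥0∞) ≠ 0 := ht0.ne'
  have hbd : ∀ n, μ {x | ε ≤ edist (T (f n) x) (T F x)} ≤
      ((t : ℝ≥0∞)⁻¹ * (weakOpNorm T *
        eLpNorm (F - f n : Lp X (ENNReal.ofReal p₁) μ) (ENNReal.ofReal p₁) μ)) ^ p₁ := by
    intro n
    have h1 : (t : ℝ≥0∞) * μ {x | (t : ℝ≥0∞) < ‖T (F - f n) x‖ₑ} ^ (1 / p₁) ≤ _ :=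
      (le_iSup (fun t : ℝ≥0 => (t : ℝ≥0∞) * μ {s | (t : ℝ≥0∞) < ‖T (F - f n) s‖ₑ} ^ (1 / p₁))
        t).trans (weakLpNorm_le_weakOpNorm_mul T hT (F - f n))
    rw [ENNReal.mul_le_iff_le_inv ht0' ENNReal.coe_ne_top, one_div,
      ENNReal.rpow_inv_le_iff hp₁] at h1
    refine (measure_mono_ae ?_).trans h1
    rw [map_sub]
    filter_upwards [AEEqFun.coeFn_sub (T F) (T (f n))] with x hx
    intro (h : ε ≤ edist (T (f n) x) (T F x))
    change (t : ℝ≥0∞) < ‖(T F - T (f n) : S →ₘ[μ] Y) x‖ₑ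
    rw [hx, Pi.sub_apply, ← edist_eq_enorm_sub, edist_comm]
    exact ht.trans_le h
  refine tendsto_of_tendsto_of_tendsto_of_le_of_le tendsto_const_nhds ?_ (fun n => zero_le) hbd
  have h1 := (ENNReal.Tendsto.const_mul (ENNReal.Tendsto.const_mul hf (Or.inr hT.ne))
    (Or.inr (ENNReal.inv_ne_top.2 ht0'))).ennrpow_const p₁
  simpa [ENNReal.zero_rpow_of_pos hp₁] using h1

/-- Hölder's inequality against the dual weight, which is integrable on balls because the `A_q`
characteristic is finite. -/
theorem memLp_indicator_ball (hS : IsSpaceOfHomogeneousType d μ c_d c_μ) {W : S → ℝ}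
    (hW : IsWeight d μ W) {p₀ p : ℝ} (hp₀ : 0 < p₀) (hp : p₀ < p)
    (hchar : muckenhouptChar d μ (p / p₀) W < ∞) {G : S → X} (hGm : StronglyMeasurable G)
    (hG : MemLp G (ENNReal.ofReal p) (weightedMeasure μ W)) (c : S) {ρ : ℝ} (hρ : 0 < ρ) :
    MemLp ((qBall d c ρ).indicator G) (ENNReal.ofReal p₀) μ := by
  have : Nonempty S := ⟨c⟩
  obtain ⟨v, hv, hv0, hvt, hWv⟩ := hW.exists_measurable
  have hp0 : 0 < p := by linarith
  have hq1 : 1 < p / p₀ := by rwa [one_lt_div hp₀]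
  have hB := hS.measurableSet_ball c ρ
  have hμ0 : μ (qBall d c ρ) ≠ 0 := (hS.measure_ball_pos c ρ hρ).ne'
  have hμt : μ (qBall d c ρ) ≠ ∞ := (hS.measure_ball_lt_top c ρ hρ).ne
  have hν : weightedMeasure μ W = μ.withDensity v := withDensity_congr_ae hWv
  have hσ : (∫⁻ x in qBall d c ρ, dualWeight (p / p₀) v x ∂μ) ^ (p / p₀ - 1) ≠ ∞ := by
    intro h
    have h1 := muckenhoupt_ball_le hS hW hWv hq1 c hρ
    rw [h, ENNReal.mul_top (setLIntegral_pos_of_pos μ hv hv0 hμ0), top_le_iff] at h1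
    exact ENNReal.mul_ne_top hchar.ne (ENNReal.rpow_ne_top_of_nonneg (by positivity) hμt) h1
  have hGp : ∫⁻ x, ‖G x‖ₑ ^ p * v x ∂μ ≠ ∞ := by
    have h1 := hG.2.ne
    rw [hν, eLpNorm_withDensity_eq hp0 hv hGm] at h1
    intro h
    rw [h, ENNReal.top_rpow_of_pos (by positivity)] at h1
    exact h1 rfl
  have hH := setLIntegral_rpow_le_dualWeight μ hv hv0 hvt hq1 (hGm.enorm.pow_const p₀)
    (qBall d c ρ)
  have hg : ∀ x, (‖G x‖ₑ ^ p₀) ^ (p / p₀) = ‖G x‖ₑ ^ p := fun x => by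
    rw [← ENNReal.rpow_mul, mul_div_cancel₀ _ hp₀.ne']
  simp_rw [hg] at hH
  refine (memLp_indicator_iff_restrict hB).2 ⟨hGm.aestronglyMeasurable, ?_⟩
  rw [eLpNorm_ofReal_eq hp₀]
  refine ENNReal.rpow_lt_top_of_nonneg (by positivity) fun h => ?_
  rw [h, ENNReal.top_rpow_of_pos (by positivity), top_le_iff] at hH
  exact ENNReal.mul_ne_top (ne_top_of_le_ne_top hGp (setLIntegral_le_lintegral _ _)) hσ hH

/-- A bound for `T` from `Lᵖ(ν; X)` to `Lᵖ(ν; Y)` on truncations to balls holds on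
`L^{p₁}(μ; X) ∩ Lᵖ(ν; X)`. -/
theorem eLpNorm_le_of_truncation {B : ℕ → Set S} (hB : ∀ n, MeasurableSet (B n))
    (hmono : Monotone B) (hcover : ⋃ n, B n = Set.univ) (hp₁ : 0 < p₁)
    (T : Lp X (ENNReal.ofReal p₁) μ →ₗ[𝕜] (S →ₘ[μ] Y)) (hT : weakOpNorm T < ∞)
    (hνμ : ν ≪ μ) {p : ℝ} {M : ℝ≥0∞} (F : Lp X (ENNReal.ofReal p₁) μ)
    (hF : ∀ n, eLpNorm (T (lpIndicator F (hB n))) (ENNReal.ofReal p) ν ≤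
      M * eLpNorm (lpIndicator F (hB n)) (ENNReal.ofReal p) ν) :
    eLpNorm (T F) (ENNReal.ofReal p) ν ≤ M * eLpNorm F (ENNReal.ofReal p) ν := by
  have hconv : Tendsto (fun n => eLpNorm (F - lpIndicator F (hB n) : Lp X (ENNReal.ofReal p₁) μ)
      (ENNReal.ofReal p₁) μ) atTop (nhds 0) := by
    refine (tendsto_eLpNorm_indicator_compl hp₁ (Lp.memLp F) hB hmono hcover).congr fun n => ?_
    refine eLpNorm_congr_ae ?_
    filter_upwards [Lp.coeFn_sub F (lpIndicator F (hB n)), lpIndicator_coe F (hB n)] with x h1 h2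
    rw [h1, Pi.sub_apply, h2]
    by_cases hx : x ∈ B n <;> simp [hx]
  obtain ⟨ns, -, hns⟩ := (tendstoInMeasure_of_weakOpNorm hp₁ T hT _ F hconv).exists_seq_tendsto_ae
  -- Fatou's lemma along the subsequence; the limit of `T` on the truncations is `T F`.
  refine (Lp.eLpNorm_lim_le_liminf_eLpNorm
    (fun n => (T (lpIndicator F (hB (ns n)))).stronglyMeasurable.aestronglyMeasurable) _
    (hνμ.ae_le hns)).trans ?_
  refine liminf_le_of_le (by isBoundedDefault) fun b hb => ?_
  obtain ⟨n, hn⟩ := hb.exists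
  refine hn.trans ((hF (ns n)).trans ?_)
  gcongr
  rw [eLpNorm_congr_ae (hνμ.ae_le (lpIndicator_coe F (hB (ns n))))]
  exact eLpNorm_indicator_le _

end Truncation

/-! ### Extension by density. -/

section Extension

variable {S : Type u} [MeasurableSpace S] {d : S → S → ℝ} {μ ν : Measure S} {c_d c_μ : ℝ}
  {𝕜 : Type x} [RCLike 𝕜]
  {X : Type v} [NormedAddCommGroup X] [NormedSpace 𝕜 X]
  {Y : Type w} [NormedAddCommGroup Y] [NormedSpace 𝕜 Y] {p₁ p : ℝ}

variable (μ ν 𝕜 X p₁ p) in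
/-- The intersection `L^{p₁}(μ; X) ∩ Lᵖ(ν; X)`, as a subspace of `L^{p₁}(μ; X)`. -/
def lpInter (hνμ : ν ≪ μ) : Submodule 𝕜 (Lp X (ENNReal.ofReal p₁) μ) where
  carrier := {f | MemLp f (ENNReal.ofReal p) ν}
  zero_mem' := (memLp_congr_ae (hνμ.ae_le (Lp.coeFn_zero _ _ _))).2 MemLp.zero
  add_mem' := fun {f g} hf hg =>
    (memLp_congr_ae (hνμ.ae_le (Lp.coeFn_add f g))).2 (MemLp.add hf hg)
  smul_mem' := fun c {f} hf =>
    (memLp_congr_ae (hνμ.ae_le (Lp.coeFn_smul c f))).2 (MemLp.const_smul hf c)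

theorem memLp_of_mem_lpInter {hνμ : ν ≪ μ} (f : lpInter μ ν 𝕜 X p₁ p hνμ) :
    MemLp (f : Lp X (ENNReal.ofReal p₁) μ) (ENNReal.ofReal p) ν := f.2

/-- The inclusion of `L^{p₁}(μ; X) ∩ Lᵖ(ν; X)` into `Lᵖ(ν; X)`. -/
noncomputable def lpInterToLp (hνμ : ν ≪ μ) :
    lpInter μ ν 𝕜 X p₁ p hνμ →ₗ[𝕜] Lp X (ENNReal.ofReal p) ν where
  toFun f := MemLp.toLp _ (memLp_of_mem_lpInter f)
  map_add' f g := by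
    rw [← MemLp.toLp_add]
    exact MemLp.toLp_congr _ _ (hνμ.ae_le (Lp.coeFn_add f.1 g.1))
  map_smul' c f := by
    rw [RingHom.id_apply, ← MemLp.toLp_const_smul]
    exact MemLp.toLp_congr _ _ (hνμ.ae_le (Lp.coeFn_smul c f.1))

/-- The restriction of `T` to `L^{p₁}(μ; X) ∩ Lᵖ(ν; X)`, with values in `Lᵖ(ν; Y)`. -/
noncomputable def lpInterMap (hνμ : ν ≪ μ) (T : Lp X (ENNReal.ofReal p₁) μ →ₗ[𝕜] (S →ₘ[μ] Y))
    (hT : ∀ f ∈ lpInter μ ν 𝕜 X p₁ p hνμ, MemLp (T f) (ENNReal.ofReal p) ν) :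
    lpInter μ ν 𝕜 X p₁ p hνμ →ₗ[𝕜] Lp Y (ENNReal.ofReal p) ν where
  toFun f := MemLp.toLp _ (hT f.1 f.2)
  map_add' f g := by
    rw [← MemLp.toLp_add]
    refine MemLp.toLp_congr _ _ (hνμ.ae_le ?_)
    rw [Submodule.coe_add, map_add]
    exact AEEqFun.coeFn_add _ _
  map_smul' c f := by
    rw [RingHom.id_apply, ← MemLp.toLp_const_smul]
    refine MemLp.toLp_congr _ _ (hνμ.ae_le ?_)
    rw [Submodule.coe_smul, map_smul]
    exact AEEqFun.coeFn_smul _ _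

/-- Truncations of `g` to the sets `B n` lie in the intersection by `hmem`, and converge to `g` by
dominated convergence. -/
theorem denseRange_lpInterToLp [Fact (1 ≤ ENNReal.ofReal p)] (hp : 0 < p) (hνμ : ν ≪ μ)
    {B : ℕ → Set S} (hB : ∀ n, MeasurableSet (B n)) (hmono : Monotone B)
    (hcover : ⋃ n, B n = Set.univ)
    (hmem : ∀ (g : Lp X (ENNReal.ofReal p) ν) n,
      MemLp ((B n).indicator g) (ENNReal.ofReal p₁) μ) :
    DenseRange (lpInterToLp (𝕜 := 𝕜) (X := X) (p₁ := p₁) (p := p) hνμ) := by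
  intro g
  have hν : ∀ n, MemLp (hmem g n).toLp (ENNReal.ofReal p) ν := fun n =>
    (memLp_congr_ae (hνμ.ae_le (hmem g n).coeFn_toLp)).2 ((Lp.memLp g).indicator (hB n))
  refine mem_closure_of_tendsto (f := fun n => lpInterToLp (𝕜 := 𝕜) hνμ ⟨(hmem g n).toLp, hν n⟩)
    (b := atTop) ?_ (Eventually.of_forall fun n => Set.mem_range_self _)
  rw [Lp.tendsto_Lp_iff_tendsto_eLpNorm']
  refine (tendsto_eLpNorm_indicator_compl hp (Lp.memLp g) hB hmono hcover).congr fun n => ?_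
  rw [eLpNorm_sub_comm]
  refine eLpNorm_congr_ae ?_
  filter_upwards [(hν n).coeFn_toLp, hνμ.ae_le (hmem g n).coeFn_toLp] with x h1 h2
  rw [Pi.sub_apply]
  change _ = g x - (hν n).toLp _ x
  rw [h1, h2]
  by_cases hx : x ∈ B n <;> simp [hx]

end Extension

/-! ### The main theorem. -/

theorem corollary1p2 (c_d c_μ : ℝ) (hcd : 1 ≤ c_d) (hcμ : 1 ≤ c_μ) :
    -- the parameters of adjacent dyadic systems, in particular `δ`, exist and depend only on
    -- `c_d` and `c_μ`
    (∃ (c₀ C₀ δ γ : ℝ) (m : ℕ), ∀ (S : Type u) [MeasurableSpace S] (d : S → S → ℝ)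
      (μ : Measure S), IsSpaceOfHomogeneousType d μ c_d c_μ →
        HasAdjacentDyadicSystems d c₀ C₀ δ γ m) ∧
    -- the weighted bound, with a constant `K` that depends only on `c_d, c_μ, p₀, p, r, α`
    ∀ (p₀ p r α : ℝ), 1 ≤ p₀ → p₀ < p → 1 ≤ r → ∀ [Fact (1 ≤ ENNReal.ofReal p)],
    ∃ K : ℝ≥0, ∀ (S : Type u) [MeasurableSpace S] (d : S → S → ℝ) (μ : Measure S)
      (hS : IsSpaceOfHomogeneousType d μ c_d c_μ)
      (c₀ C₀ δ γ : ℝ) (m : ℕ), HasAdjacentDyadicSystems d c₀ C₀ δ γ m → 3 * c_d ^ 2 / δ ≤ α →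
      ∀ (𝕜 : Type x) [RCLike 𝕜]
      (X : Type v) [NormedAddCommGroup X] [NormedSpace 𝕜 X] [CompleteSpace X]
      (Y : Type w) [NormedAddCommGroup Y] [NormedSpace 𝕜 Y] [CompleteSpace Y]
      (p₁ p₂ : ℝ), 1 ≤ p₁ → 1 ≤ p₂ → p₀ = max p₁ p₂ →
      ∀ (T : Lp X (ENNReal.ofReal p₁) μ →ₗ[𝕜] (S →ₘ[μ] Y)) (C_r : ℝ),
      weakOpNorm T < ∞ →
      sharpMaximalOpNorm hS.measurableSet_ball T α p₂ < ∞ →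
      0 < C_r → IsRSublinear d T p₀ r C_r →
      ∀ W : S → ℝ, IsWeight d μ W → muckenhouptChar d μ (p / p₀) W < ∞ →
      ∃ TW : Lp X (ENNReal.ofReal p) (weightedMeasure μ W) →L[𝕜]
          Lp Y (ENNReal.ofReal p) (weightedMeasure μ W),
        -- `TW` agrees with `T` on the intersection of their domains, and is the only such map
        AgreesWith TW T ∧
        (∀ TW' : Lp X (ENNReal.ofReal p) (weightedMeasure μ W) →L[𝕜]
            Lp Y (ENNReal.ofReal p) (weightedMeasure μ W),
          AgreesWith TW' T → TW' = TW) ∧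
        ‖TW‖ₑ ≤ K * (weakOpNorm T + sharpMaximalOpNorm hS.measurableSet_ball T α p₂)
          * ENNReal.ofReal C_r
          * muckenhouptChar d μ (p / p₀) W ^ max (1 / (p - p₀)) (1 / r) := by
  refine ⟨?_, fun p₀ p r α hp₀ hp hr _ => ?_⟩
  · obtain ⟨c₀, C₀, δ, γ, m, -, h⟩ := exists_hasAdjacentDyadicSystems.{u} c_d c_μ hcd hcμ
    exact ⟨c₀, C₀, δ, γ, m, h⟩
  -- `K` is fixed before `δ`, when no lower bound on `α` is available yet; hence the maximum. Once
  -- `δ < 1` is given, `3 c_d² / δ ≤ α` shows that it equals `α`.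
  obtain ⟨K, hK⟩ := exists_weighted_bound.{u, v, w, x} c_d c_μ hcd hcμ hp₀ hp hr
    (le_max_right α (2 * c_d))
  refine ⟨K, fun S _ d μ hS c₀ C₀ δ γ m hadj hα 𝕜 _ X _ _ _ Y _ _ _ p₁ p₂ hp₁ hp₂ hp₁₂ T C_r hT₁ hT₂
    hC_r hTr W hW hchar => ?_⟩
  rcases isEmpty_or_nonempty S with hemp | ⟨⟨c⟩⟩
  · refine ⟨0, fun f g _ => Eventually.of_forall isEmptyElim, fun TW' _ => ?_, ?_⟩
    · ext1 g
      exact Lp.ext (Eventually.of_forall isEmptyElim)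
    · rw [← ofReal_norm, norm_zero, ENNReal.ofReal_zero]
      exact zero_le
  obtain ⟨-, -, hδ, hδ1, -⟩ := hadj
  have hα' : max α (2 * c_d) = α := by
    refine max_eq_left (le_trans ?_ hα)
    rw [le_div_iff₀ hδ]
    nlinarith
  rw [hα'] at hK
  specialize hK S d μ hS 𝕜 X Y p₁ p₂ hp₁ hp₂ hp₁₂ T C_r hT₁ hT₂ hC_r hTr W hW hchar
  set M : ℝ≥0∞ := K * (weakOpNorm T + sharpMaximalOpNorm hS.measurableSet_ball T α p₂)
          * ENNReal.ofReal C_r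
          * muckenhouptChar d μ (p / p₀) W ^ max (1 / (p - p₀)) (1 / r) with hM
  have hp₀0 : 0 < p₀ := by linarith
  have hp0 : 0 < p := by linarith
  have hp₁0 : 0 < p₁ := by linarith
  have hp₁p₀ : p₁ ≤ p₀ := hp₁₂ ▸ le_max_left _ _
  have hMt : M ≠ ∞ := by
    refine ENNReal.mul_ne_top (ENNReal.mul_ne_top (ENNReal.mul_ne_top ENNReal.coe_ne_top
      (ENNReal.add_ne_top.2 ⟨hT₁.ne, hT₂.ne⟩)) ENNReal.ofReal_ne_top)
      (ENNReal.rpow_ne_top_of_nonneg (le_max_of_le_right (by positivity)) hchar.ne)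
  have : Nonempty S := ⟨c⟩
  obtain ⟨v, hv, hv0, -, hWv⟩ := hW.exists_measurable
  have hν : weightedMeasure μ W = μ.withDensity v := withDensity_congr_ae hWv
  set ν := weightedMeasure μ W with hνdef
  have hνμ : ν ≪ μ := withDensity_absolutelyContinuous _ _
  have hμν : μ ≪ ν := hν ▸ withDensity_absolutelyContinuous' hv.aemeasurable (ae_of_all _ hv0)
  let B : ℕ → Set S := fun n => qBall d c (n + 1)
  have hB : ∀ n, MeasurableSet (B n) := fun n => hS.measurableSet_ball _ _
  have hmono : Monotone B := fun n k h => qBall_mono (by gcongr)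
  have hcover : ⋃ n, B n = Set.univ := by
    refine Set.univ_subset_iff.1 (IsSpaceOfHomogeneousType.iUnion_qBall (d := d) c ▸ ?_)
    exact Set.iUnion_mono fun n => qBall_mono (by linarith)
  have hBmem : ∀ (G : S → X), StronglyMeasurable G → MemLp G (ENNReal.ofReal p) ν → ∀ n,
      MemLp ((B n).indicator G) (ENNReal.ofReal p₀) μ := fun G hGm hG n =>
    memLp_indicator_ball hS hW hp₀0 hp hchar hGm hG c (by positivity)
  -- The truncations of `F` to balls lie in `L^{p₀}` and have bounded support, so `hK` applies to
  -- them.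
  have hbound : ∀ F : Lp X (ENNReal.ofReal p₁) μ, MemLp F (ENNReal.ofReal p) ν →
      eLpNorm (T F) (ENNReal.ofReal p) ν ≤ M * eLpNorm F (ENNReal.ofReal p) ν := by
    intro F hF
    refine eLpNorm_le_of_truncation hB hmono hcover hp₁0 T hT₁ hνμ F fun n => hK _ ?_ ⟨c, n + 1, ?_⟩
    · exact (memLp_congr_ae (lpIndicator_coe F (hB n))).2
        (hBmem F (Lp.stronglyMeasurable F) hF n)
    · filter_upwards [lpIndicator_coe F (hB n)] with x hx hxB
      rw [hx, Set.indicator_of_notMem hxB]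
  have hTmem : ∀ f ∈ lpInter μ ν 𝕜 X p₁ p hνμ, MemLp (T f) (ENNReal.ofReal p) ν := fun f hf =>
    ⟨(T f).stronglyMeasurable.aestronglyMeasurable,
      (hbound f hf).trans_lt (ENNReal.mul_lt_top hMt.lt_top (MemLp.eLpNorm_lt_top hf))⟩
  have hdense : DenseRange (lpInterToLp (𝕜 := 𝕜) (X := X) (p₁ := p₁) (p := p) hνμ) := by
    refine denseRange_lpInterToLp hp0 hνμ hB hmono hcover fun g n => ?_
    have h := hBmem g (Lp.stronglyMeasurable g) (Lp.memLp g) n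
    rw [memLp_indicator_iff_restrict (hB n)] at h ⊢
    have : IsFiniteMeasure (μ.restrict (B n)) :=
      isFiniteMeasure_restrict.2 (hS.measure_ball_lt_top' _ _).ne
    exact h.mono_exponent (ENNReal.ofReal_le_ofReal hp₁p₀)
  have hnorm : ∀ f, ‖lpInterMap hνμ T hTmem f‖ ≤ M.toReal * ‖lpInterToLp hνμ f‖ := by
    intro f
    change ‖MemLp.toLp _ (hTmem f.1 f.2)‖ ≤ M.toReal * ‖MemLp.toLp _ (memLp_of_mem_lpInter f)‖
    rw [Lp.norm_toLp, Lp.norm_toLp, ← ENNReal.toReal_mul]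
    exact ENNReal.toReal_mono (ENNReal.mul_ne_top hMt (memLp_of_mem_lpInter f).eLpNorm_ne_top)
      (hbound f.1 f.2)
  -- The pairs tested in `AgreesWith` are exactly the elements of the intersection. So agreement
  -- with `T` prescribes the operator on a dense subspace, and `hnorm` gives existence, uniqueness
  -- and the norm bound.
  have hagree : ∀ (f : Lp X (ENNReal.ofReal p₁) μ) (g : Lp X (ENNReal.ofReal p) ν),
      f =ᵐ[μ] g → ∃ f' : lpInter μ ν 𝕜 X p₁ p hνμ, f'.1 = f ∧ lpInterToLp hνμ f' = g := by
    intro f g hfg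
    have hf : MemLp f (ENNReal.ofReal p) ν := (memLp_congr_ae (hνμ.ae_le hfg)).2 (Lp.memLp g)
    exact ⟨⟨f, hf⟩, rfl, Lp.ext (hf.coeFn_toLp.trans (hνμ.ae_le hfg))⟩
  refine ⟨(lpInterMap hνμ T hTmem).extendOfNorm (lpInterToLp hνμ), ?_, ?_, ?_⟩
  · intro f g hfg
    obtain ⟨f', rfl, rfl⟩ := hagree f g hfg
    rw [LinearMap.extendOfNorm_eq hdense ⟨_, hnorm⟩]
    exact hμν.ae_le (hTmem f'.1 f'.2).coeFn_toLp
  · intro TW' hTW'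
    refine (LinearMap.extendOfNorm_unique hdense _ hnorm TW' (LinearMap.ext fun f => ?_)).symm
    have h : TW' (lpInterToLp hνμ f) =ᵐ[ν] T f.1 := hνμ.ae_le (hTW' f.1 (lpInterToLp hνμ f)
      (hμν.ae_le (memLp_of_mem_lpInter f).coeFn_toLp.symm))
    exact Lp.ext (h.trans (hTmem f.1 f.2).coeFn_toLp.symm)
  · rw [← ENNReal.ofReal_toReal hMt, ← ofReal_norm]
    exact ENNReal.ofReal_le_ofReal
      (LinearMap.opNorm_extendOfNorm_le hdense ENNReal.toReal_nonneg hnorm)
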